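/- Let $\mathfrak M$ be a complex manifold of complex dimension $n$ (Hausdorff and countable at infinity), equipped with a Riemannian metric; distances are taken with respect to it. Let $\Omega\Subset\mathfrak M$ be a relatively compact domain with generic corners, i.e. $\Omega=\bigcap_{j=1}^N\Omega_j$, where each $\Omega_j\subset\mathfrak M$ is a domain with smooth boundary (near each $p\in\partial\Omega_j$ one has $\Omega_j=\{r<0\}$ for a smooth real function $r$ with $dr(p)\ne0$), and for every $S\subset\{1,\dots,N\}$ and every $p\in\bigcap_{j\in S}\partial\Omega_j$ the largest complex subspace of $\bigcap_{j\in S}T_p(\partial\Omega_j)$ has complex dimension $n-|S|$ (equivalently, $\bigwedge_{j\in S}\overline\partial r_j\neq0$ at $p$ for local defining functions $r_j$ of $\Omega_j$; thus $\bigcap_{j\in S}\partial\Omega_j$, if non-empty, is a generic CR manifold of CR-dimension $n-|S|$). For $k\ge0$ let $\mathcal A^{-k}(\Omega)$ be the space of holomorphic functions $f$ on $\Omega$ with $\|f\|_{\mathcal A^{-k}}=\sup_{z\in\Omega}|f(z)|\,\mathrm{dist}(z,\partial\Omega)^k<\infty$ (with $\mathrm{dist}(z,\emptyset)=1$), and let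 $\mathcal A^{-\infty}(\Omega)=\bigcup_k\mathcal A^{-k}(\Omega)$ with the (locally convex) inductive limit topology. Let $\mathcal D^{n,n}(\mathfrak M)$ be the space of smooth compactly supported $(n,n)$-forms with its inductive limit topology, and let $\mathcal D'_0(\mathfrak M)$ be its dual with the strong topology. There is a unique continuous linear map $\mathsf{ce}:\mathcal A^{-\infty}(\Omega)\to\mathcal D'_0(\mathfrak M)$ such that the following hold for all $f\in\mathcal A^{-\infty}(\Omega)$. 1. $(\mathsf{ce} f)|_\Omega=f$, i.e. $\langle\mathsf{ce} f,\phi\rangle=\int_\Omega f\phi$ for every $\phi\in\mathcal D^{n,n}(\mathfrak M)$ with support in $\Omega$. 2. Let $U$ be a holomorphic coordinate neighborhood, let $\phi\in\mathcal D^{n,n}(\mathfrak M)$ have support in $U$, and let $v\in\mathbb C^n$ be a vector which, in the coordinates on $U$, points outward from $\Omega_j$ at each point of $\partial\Omega_j\cap\operatorname{supp}\phi$, for every $j$ (i.e. $dr(v)>0$ for a local defining function $r$ of $\Omega_j$). Then, with $f_\epsilon(z)=f(z-\epsilon v)$ in these coordinates, the following limit exists and $$\langle\mathsf{ce} f,\phi\rangle=\lim_{\epsilon\downarrow0}\int_\Omega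 f_\epsilon\,\phi .$$ 3. If $f$ extends to a continuous function on $\overline\Omega$, then $\mathsf{ce} f$ is the distribution induced by the function which coincides with this extension on $\overline\Omega$ and vanishes outside $\overline\Omega$. -/

import Mathlib

open Set Filter Topology Manifold MeasureTheory
open scoped ContDiff ENNReal Bundle

noncomputable section

/-! ### Complex manifolds and their underlying real manifolds -/

/-- The coordinate space `ℂⁿ`. A complex manifold of dimension `n` is a space `M` with
`[ChartedSpace (Cn n) M] [IsManifold 𝓘(ℂ, Cn n) ω M]`; the same charts make it a real manifold with
model `𝓘(ℝ, Cn n)`. The tangent space at `p` is `Cn n`, identified through the chart at `p`, and its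
complex structure is multiplication by `Complex.I`. -/
abbrev Cn (n : ℕ) : Type := Fin n → ℂ

instance isManifold_real {n : ℕ} {M : Type*} [TopologicalSpace M] [ChartedSpace (Cn n) M]
    [IsManifold 𝓘(ℂ, Cn n) ω M] : IsManifold 𝓘(ℝ, Cn n) ω M := by
  apply isManifold_of_contDiffOn
  intro e e' he he'
  have h := contDiffGroupoid ω 𝓘(ℂ, Cn n) |>.compatible he he'
  rw [contDiffGroupoid, mem_groupoid_of_pregroupoid] at h
  exact (h.1 : ContDiffOn ℂ ω _ _).restrict_scalars ℝ

/-- The holomorphic charts of `M`: all charts compatible with the complex structure. -/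
abbrev holCharts (n : ℕ) (M : Type*) [TopologicalSpace M] [ChartedSpace (Cn n) M] :
    Set (OpenPartialHomeomorph M (Cn n)) :=
  IsManifold.maximalAtlas 𝓘(ℂ, Cn n) ω M

/-! ### Locally convex inductive limits -/

/-- The locally convex inductive limit topology on `F` for maps `incl i : G i → F`: the finest
locally convex vector space topology on `F` for which all `incl i` are continuous. -/
@[reducible]
def lcInductiveTopology {ι F : Type*} [AddCommGroup F] [Module ℂ F] {G : ι → Type*}
    (t : ∀ i, TopologicalSpace (G i)) (incl : ∀ i, G i → F) : TopologicalSpace F :=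
  sInf {s : TopologicalSpace F | (∀ i, @Continuous _ _ (t i) s (incl i)) ∧
    @IsTopologicalAddGroup F s _ ∧ @ContinuousSMul ℂ F _ _ s ∧ @LocallyConvexSpace ℝ F _ _ _ _ s}

/-! ### Smoothly bounded domains and generic corners -/

section Geometry

variable {n : ℕ} {M : Type*} [TopologicalSpace M] [ChartedSpace (Cn n) M]

/-- The differential at `p` of a real function on `M`. -/
def realDifferential (n : ℕ) {M : Type*} [TopologicalSpace M] [ChartedSpace (Cn n) M]
    (r : M → ℝ) (p : M) : Cn n →L[ℝ] ℝ :=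
  mfderiv 𝓘(ℝ, Cn n) 𝓘(ℝ, ℝ) r p

/-- `r` is a (smooth, local) defining function of `D` near `p`:
near `p`, the set `D` is `{r < 0}`, and `dr ≠ 0` at `p`. -/
def IsLocalDefiningFunction (D : Set M) (p : M) (r : M → ℝ) : Prop :=
  (∃ U : Set M, IsOpen U ∧ p ∈ U ∧ ContMDiffOn 𝓘(ℝ, Cn n) 𝓘(ℝ, ℝ) ∞ r U ∧
    ∀ z ∈ U, (z ∈ D ↔ r z < 0)) ∧
  realDifferential n r p ≠ 0

/-- A smoothly bounded domain: open, connected, with a smooth defining function near every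
boundary point. -/
structure IsSmoothlyBoundedDomain (D : Set M) : Prop where
  isOpen : IsOpen D
  isConnected : IsConnected D
  exists_defining : ∀ p ∈ frontier D, ∃ r : M → ℝ, IsLocalDefiningFunction (n := n) D p r

/-- The real tangent space at `p` of the boundary hypersurface of `D`: the kernel of `dr` for a
defining function `r` near `p` (this kernel is the same for all of them). -/
def boundaryTangentSpace (D : Set M) (p : M) : Set (Cn n) :=
  {w | ∀ r : M → ℝ, IsLocalDefiningFunction (n := n) D p r →
    realDifferential n r p w = 0}

/-- The complex tangent space at `p` of the corner `⋂_{j ∈ S} ∂D_j`: the largest complex subspace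
of the intersection of the tangent spaces of the hypersurfaces `∂D_j`, `j ∈ S`. -/
def cornerComplexTangentSpace {N : ℕ} (D : Fin N → Set M) (S : Finset (Fin N)) (p : M) :
    Submodule ℂ (Cn n) where
  carrier := {w | ∀ c : ℂ, ∀ j ∈ S, c • w ∈ boundaryTangentSpace (n := n) (D j) p}
  add_mem' := by
    intro a b ha hb c j hj r hr
    rw [smul_add, map_add, ha c j hj r hr, hb c j hj r hr, add_zero]
  zero_mem' := by
    intro c j _ r _
    rw [smul_zero, map_zero]
  smul_mem' := by
    intro a w hw c j hj
    rw [smul_smul]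
    exact hw (c * a) j hj

/-- `Ω = ⋂_j D_j` is a relatively compact domain with generic corners: each `D_j` is a smoothly
bounded domain and at every point of `⋂_{j ∈ S} ∂D_j` this corner has CR dimension `n - |S|`.
As the tangent space of the corner is taken to be the intersection of those of the `∂D_j`, the
condition says that the forms `∂̄r_j`, `j ∈ S`, are linearly independent; in particular the
hypersurfaces meet transversally and the corner is a generic CR manifold. -/
structure IsDomainWithGenericCorners {N : ℕ} (D : Fin N → Set M) (Ω : Set M) : Prop where
  eq_iInter : Ω = ⋂ j, D j
  isOpen : IsOpen Ω
  isConnected : IsConnected Ω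
  isCompact_closure : IsCompact (closure Ω)
  smoothlyBounded : ∀ j, IsSmoothlyBoundedDomain (n := n) (D j)
  generic : ∀ S : Finset (Fin N), ∀ p ∈ ⋂ j ∈ S, frontier (D j),
    Module.finrank ℂ (cornerComplexTangentSpace (n := n) D S p) + S.card = n

/-- In the coordinates `e`, the vector `v` points outward from `D` at the boundary point `p`. -/
def PointsOutward (e : OpenPartialHomeomorph M (Cn n)) (v : Cn n) (D : Set M) (p : M) : Prop :=
  ∃ r : M → ℝ, IsLocalDefiningFunction (n := n) D p r ∧ 0 < fderiv ℝ (r ∘ e.symm) (e p) v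

end Geometry

/-! ### Test forms of top degree and distributions -/

section Forms

variable {n : ℕ} {M : Type*} [TopologicalSpace M] [ChartedSpace (Cn n) M]

/-- Complex valued forms of degree `2n`, that is, `(n,n)`-forms, without regularity:
an alternating form on each tangent space. -/
abbrev TopForm (n : ℕ) (M : Type*) : Type _ := M → (Cn n) [⋀^Fin (2 * n)]→L[ℝ] ℂ

/-- The real basis `∂/∂x₁, ∂/∂y₁, …, ∂/∂xₙ, ∂/∂yₙ` of `ℂⁿ`, with the complex orientation. -/
def stdFrame (n : ℕ) (m : Fin (2 * n)) : Cn n :=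
  Pi.single ⟨m.val / 2, by omega⟩ (if m.val % 2 = 0 then 1 else Complex.I)

/-- The function `φ₀` on `e.target` with `φ = φ₀ dx₁ ∧ dy₁ ∧ ⋯ ∧ dxₙ ∧ dyₙ` in the chart `e`. -/
def formCoeff (e : OpenPartialHomeomorph M (Cn n)) (φ : TopForm n M) (y : Cn n) : ℂ :=
  φ (e.symm y) fun m =>
    (mfderiv 𝓘(ℝ, Cn n) 𝓘(ℝ, Cn n) e.symm y : Cn n →L[ℝ] Cn n) (stdFrame n m)

theorem formCoeff_add (e : OpenPartialHomeomorph M (Cn n)) (φ ψ : TopForm n M) :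
    formCoeff e (φ + ψ) = formCoeff e φ + formCoeff e ψ := rfl

theorem formCoeff_smul (e : OpenPartialHomeomorph M (Cn n)) (c : ℂ) (φ : TopForm n M) :
    formCoeff e (c • φ) = c • formCoeff e φ := rfl

/-- The smooth compactly supported `(n,n)`-forms, as a subspace of all forms. -/
def testFormSubmodule (n : ℕ) (M : Type*) [TopologicalSpace M] [ChartedSpace (Cn n) M] :
    Submodule ℂ (TopForm n M) where
  carrier := {φ | (∀ e ∈ holCharts n M, ContDiffOn ℝ ∞ (formCoeff e φ) e.target) ∧
    HasCompactSupport φ}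
  add_mem' := by
    rintro φ ψ ⟨h1, h2⟩ ⟨h3, h4⟩
    refine ⟨fun e he => ?_, h2.add h4⟩
    rw [formCoeff_add]
    exact (h1 e he).add (h3 e he)
  zero_mem' := ⟨fun _ _ => contDiffOn_const, HasCompactSupport.zero⟩
  smul_mem' := by
    rintro c φ ⟨h1, h2⟩
    refine ⟨fun e he => ?_, ?_⟩
    · rw [formCoeff_smul]
      exact contDiffOn_const.smul (h1 e he)
    · exact h2.mono' ((Function.support_const_smul_subset c φ).trans (subset_tsupport φ))

/-- The space `𝒟^{n,n}(M)` of test forms. -/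
def TestForm (n : ℕ) (M : Type*) [TopologicalSpace M] [ChartedSpace (Cn n) M] : Type _ :=
  testFormSubmodule n M

instance : AddCommGroup (TestForm n M) := inferInstanceAs (AddCommGroup (testFormSubmodule n M))

instance : Module ℂ (TestForm n M) := inferInstanceAs (Module ℂ (testFormSubmodule n M))

/-- The form underlying a test form. -/
def TestForm.form (φ : TestForm n M) : TopForm n M := (φ : testFormSubmodule n M).1

/-- The support of a test form. -/
def TestForm.supp (φ : TestForm n M) : Set M := tsupport φ.form

/-- The test forms with support in the compact set `K`. -/
def TestFormOn (n : ℕ) {M : Type*} [TopologicalSpace M] [ChartedSpace (Cn n) M]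
    (K : TopologicalSpace.Compacts M) : Type _ :=
  {φ : TestForm n M // φ.supp ⊆ K}

/-- The `C^∞` topology on the test forms with support in `K`: uniform convergence, on the compact
subsets of every coordinate chart, of the coefficient together with each of its derivatives. -/
instance (K : TopologicalSpace.Compacts M) : TopologicalSpace (TestFormOn n K) :=
  ⨅ (e : holCharts n M) (m : ℕ), TopologicalSpace.induced
    (fun φ : TestFormOn n K => UniformOnFun.ofFun {L : Set (Cn n) | IsCompact L ∧ L ⊆ e.1.target}
      (iteratedFDeriv ℝ m (formCoeff e.1 φ.1.form)))
    inferInstance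

/-- The inductive limit topology on `𝒟^{n,n}(M)`. -/
instance : TopologicalSpace (TestForm n M) :=
  lcInductiveTopology (fun K : TopologicalSpace.Compacts M =>
    (inferInstance : TopologicalSpace (TestFormOn n K))) (fun _ φ => φ.1)

instance : IsTopologicalAddGroup (TestForm n M) :=
  topologicalAddGroup_sInf fun _ h => h.2.1

instance : ContinuousSMul ℂ (TestForm n M) :=
  continuousSMul_sInf fun _ h => h.2.2.1

instance : LocallyConvexSpace ℝ (TestForm n M) :=
  LocallyConvexSpace.sInf fun _ h => h.2.2.2

/-- The space `𝒟'₀(M)` of distributions, the dual of `𝒟^{n,n}(M)`. Its topology (Mathlib's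
default on spaces of continuous linear maps) is the strong one, of uniform convergence on bounded
sets. -/
abbrev DistributionSpace (n : ℕ) (M : Type*) [TopologicalSpace M] [ChartedSpace (Cn n) M] : Type _ :=
  TestForm n M →L[ℂ] ℂ

/-- The integral of `u φ` over the domain of the chart `e`. -/
def chartIntegral (e : OpenPartialHomeomorph M (Cn n)) (u : M → ℂ) (φ : TopForm n M) : ℂ :=
  ∫ y in e.target, u (e.symm y) * formCoeff e φ y

variable [IsManifold 𝓘(ℂ, Cn n) ω M] [T2Space M] [SigmaCompactSpace M]

/-- A smooth partition of unity on `M` subordinate to coordinate charts. -/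
def chartPartition (n : ℕ) (M : Type*) [TopologicalSpace M] [ChartedSpace (Cn n) M]
    [IsManifold 𝓘(ℂ, Cn n) ω M] [T2Space M] [SigmaCompactSpace M] :
    SmoothPartitionOfUnity M 𝓘(ℝ, Cn n) M univ :=
  (SmoothPartitionOfUnity.exists_isSubordinate_chartAt_source 𝓘(ℝ, Cn n) M).choose

/-- The integral `∫_M u φ` of the function `u` against the test form `φ`, by a partition of unity
`(ρ_x)` subordinate to coordinate charts: `∑_x ∫ ρ_x u φ`, each term computed in a chart. -/
def formIntegral (u : M → ℂ) (φ : TestForm n M) : ℂ :=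
  ∑ᶠ x : M, chartIntegral (chartAt (Cn n) x) (fun z => (chartPartition n M x z : ℂ) * u z) φ.form

end Forms

/-! ### Holomorphic functions of polynomial growth -/

section Growth

variable {n : ℕ} {M : Type*} [TopologicalSpace M] [ChartedSpace (Cn n) M]
  [Bundle.RiemannianBundle (fun x : M => TangentSpace 𝓘(ℝ, Cn n) x)]

/-- The distance from `z` to `∂Ω` for the given Riemannian metric, truncated at `1` (so it is `1`
when `∂Ω` is empty). For relatively compact connected `Ω` the distance to a nonempty `∂Ω` is bounded
on `Ω`, so the truncation changes the norms below only to equivalent ones. -/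
def boundaryDist (n : ℕ) {M : Type*} [TopologicalSpace M] [ChartedSpace (Cn n) M]
    [Bundle.RiemannianBundle (fun x : M => TangentSpace 𝓘(ℝ, Cn n) x)] (Ω : Set M) (z : M) : ℝ :=
  (min 1 (⨅ w ∈ frontier Ω, riemannianEDist 𝓘(ℝ, Cn n) z w)).toReal

theorem boundaryDist_nonneg (Ω : Set M) (z : M) : 0 ≤ boundaryDist n Ω z :=
  ENNReal.toReal_nonneg

theorem boundaryDist_le_one (Ω : Set M) (z : M) : boundaryDist n Ω z ≤ 1 :=
  ENNReal.toReal_mono ENNReal.one_ne_top (min_le_left _ _)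

/-- The holomorphic functions `f` on `Ω` with `|f| dist(·, ∂Ω)^k` bounded. A function on `Ω` is
represented by its extension by zero to `M`. -/
def growthSubmodule (n : ℕ) {M : Type*} [TopologicalSpace M] [ChartedSpace (Cn n) M]
    [Bundle.RiemannianBundle (fun x : M => TangentSpace 𝓘(ℝ, Cn n) x)] (Ω : Set M) (k : ℕ) :
    Submodule ℂ (M → ℂ) where
  carrier := {f | (∀ z ∉ Ω, f z = 0) ∧ MDifferentiableOn 𝓘(ℂ, Cn n) 𝓘(ℂ, ℂ) f Ω ∧
    ∃ C : ℝ, ∀ z ∈ Ω, ‖f z‖ * boundaryDist n Ω z ^ k ≤ C}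
  add_mem' := by
    rintro f g ⟨hf0, hf, C, hC⟩ ⟨hg0, hg, C', hC'⟩
    refine ⟨fun z hz => by simp [hf0 z hz, hg0 z hz], hf.add hg, C + C', fun z hz => ?_⟩
    calc ‖f z + g z‖ * boundaryDist n Ω z ^ k
        ≤ (‖f z‖ + ‖g z‖) * boundaryDist n Ω z ^ k :=
          mul_le_mul_of_nonneg_right (norm_add_le _ _) (pow_nonneg (boundaryDist_nonneg _ _) _)
      _ ≤ C + C' := by rw [add_mul]; exact add_le_add (hC z hz) (hC' z hz)
  zero_mem' := ⟨fun _ _ => rfl, mdifferentiableOn_const, 0, fun z _ => by simp⟩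
  smul_mem' := by
    rintro c f ⟨hf0, hf, C, hC⟩
    refine ⟨fun z hz => by simp [hf0 z hz], hf.const_smul c, ‖c‖ * C, fun z hz => ?_⟩
    rw [Pi.smul_apply, norm_smul, mul_assoc]
    exact mul_le_mul_of_nonneg_left (hC z hz) (norm_nonneg c)

/-- The space `𝒜^{-k}(Ω)`. -/
def GrowthSpace (n : ℕ) {M : Type*} [TopologicalSpace M] [ChartedSpace (Cn n) M]
    [Bundle.RiemannianBundle (fun x : M => TangentSpace 𝓘(ℝ, Cn n) x)] (Ω : Set M) (k : ℕ) :
    Type _ :=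
  growthSubmodule n Ω k

instance (Ω : Set M) (k : ℕ) : AddCommGroup (GrowthSpace n Ω k) :=
  inferInstanceAs (AddCommGroup (growthSubmodule n Ω k))

/-- The function underlying an element of `𝒜^{-k}(Ω)`. -/
def GrowthSpace.fn {Ω : Set M} {k : ℕ} (f : GrowthSpace n Ω k) : M → ℂ :=
  (f : growthSubmodule n Ω k).1

theorem GrowthSpace.bddAbove {Ω : Set M} {k : ℕ} (f : GrowthSpace n Ω k) :
    BddAbove (range fun z : Ω => ‖f.fn z‖ * boundaryDist n Ω z ^ k) := by
  obtain ⟨C, hC⟩ := (f : growthSubmodule n Ω k).2.2.2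
  exact ⟨C, by rintro _ ⟨z, rfl⟩; exact hC z z.2⟩

/-- The space `𝒜^{-k}(Ω)` with the norm `‖f‖ = sup_{z ∈ Ω} |f(z)| dist(z, ∂Ω)^k`. -/
instance (Ω : Set M) (k : ℕ) : SeminormedAddCommGroup (GrowthSpace n Ω k) :=
  AddGroupSeminorm.toSeminormedAddCommGroup
    { toFun := fun f => ⨆ z : Ω, ‖f.fn z‖ * boundaryDist n Ω z ^ k
      map_zero' := by
        have h : ∀ z : Ω, ‖(0 : GrowthSpace n Ω k).fn z‖ * boundaryDist n Ω z ^ k = 0 := fun z => by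
          change ‖(0 : ℂ)‖ * _ = 0
          simp
        simp [h]
      add_le' := fun f g => by
        refine Real.iSup_le (fun z => ?_) (add_nonneg
          (Real.iSup_nonneg fun z => mul_nonneg (norm_nonneg _) (pow_nonneg (boundaryDist_nonneg _ _) _))
          (Real.iSup_nonneg fun z => mul_nonneg (norm_nonneg _) (pow_nonneg (boundaryDist_nonneg _ _) _)))
        refine le_trans ?_ (add_le_add (le_ciSup f.bddAbove z) (le_ciSup g.bddAbove z))
        rw [← add_mul]
        exact mul_le_mul_of_nonneg_right (norm_add_le (f.fn z) (g.fn z))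
          (pow_nonneg (boundaryDist_nonneg _ _) _)
      neg' := fun f => by
        refine congrArg iSup (funext fun z => ?_)
        change ‖-f.fn z‖ * _ = _
        rw [norm_neg] }

theorem growthSubmodule_mono (Ω : Set M) : Monotone (growthSubmodule n Ω) := by
  rintro k l hkl f ⟨h0, h1, C, hC⟩
  exact ⟨h0, h1, C, fun z hz => (mul_le_mul_of_nonneg_left
    (pow_le_pow_of_le_one (boundaryDist_nonneg _ _) (boundaryDist_le_one _ _) hkl)
    (norm_nonneg _)).trans (hC z hz)⟩

/-- The holomorphic functions of polynomial growth on `Ω`: the union of all `𝒜^{-k}(Ω)`. -/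
def polyGrowthSubmodule (n : ℕ) {M : Type*} [TopologicalSpace M] [ChartedSpace (Cn n) M]
    [Bundle.RiemannianBundle (fun x : M => TangentSpace 𝓘(ℝ, Cn n) x)] (Ω : Set M) :
    Submodule ℂ (M → ℂ) where
  carrier := ⋃ k, (growthSubmodule n Ω k : Set (M → ℂ))
  add_mem' := by
    intro f g hf hg
    obtain ⟨k, hk⟩ := mem_iUnion.1 hf
    obtain ⟨l, hl⟩ := mem_iUnion.1 hg
    exact mem_iUnion.2 ⟨max k l, add_mem (growthSubmodule_mono Ω (le_max_left k l) hk)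
      (growthSubmodule_mono Ω (le_max_right k l) hl)⟩
  zero_mem' := mem_iUnion.2 ⟨0, zero_mem _⟩
  smul_mem' := by
    intro c f hf
    obtain ⟨k, hk⟩ := mem_iUnion.1 hf
    exact mem_iUnion.2 ⟨k, Submodule.smul_mem _ c hk⟩

/-- The space `𝒜^{-∞}(Ω)` of holomorphic functions of polynomial growth on `Ω`. -/
def PolyGrowth (n : ℕ) {M : Type*} [TopologicalSpace M] [ChartedSpace (Cn n) M]
    [Bundle.RiemannianBundle (fun x : M => TangentSpace 𝓘(ℝ, Cn n) x)] (Ω : Set M) : Type _ :=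
  polyGrowthSubmodule n Ω

instance (Ω : Set M) : AddCommGroup (PolyGrowth n Ω) :=
  inferInstanceAs (AddCommGroup (polyGrowthSubmodule n Ω))

instance (Ω : Set M) : Module ℂ (PolyGrowth n Ω) :=
  inferInstanceAs (Module ℂ (polyGrowthSubmodule n Ω))

/-- The function on `Ω` (extended by zero to `M`) underlying an element of `𝒜^{-∞}(Ω)`. -/
def PolyGrowth.fn {Ω : Set M} (f : PolyGrowth n Ω) : M → ℂ := (f : polyGrowthSubmodule n Ω).1

/-- The inclusion of `𝒜^{-k}(Ω)` in `𝒜^{-∞}(Ω)`. -/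
def GrowthSpace.toPolyGrowth {Ω : Set M} {k : ℕ} (f : GrowthSpace n Ω k) : PolyGrowth n Ω :=
  (⟨f.fn, mem_iUnion.2 ⟨k, (f : growthSubmodule n Ω k).2⟩⟩ : polyGrowthSubmodule n Ω)

/-- The inductive limit topology on `𝒜^{-∞}(Ω)`. -/
instance (Ω : Set M) : TopologicalSpace (PolyGrowth n Ω) :=
  lcInductiveTopology (fun k : ℕ => (inferInstance : TopologicalSpace (GrowthSpace n Ω k)))
    (fun _ f => f.toPolyGrowth)

instance (Ω : Set M) : IsTopologicalAddGroup (PolyGrowth n Ω) :=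
  topologicalAddGroup_sInf fun _ h => h.2.1

instance (Ω : Set M) : ContinuousSMul ℂ (PolyGrowth n Ω) :=
  continuousSMul_sInf fun _ h => h.2.2.1

instance (Ω : Set M) : LocallyConvexSpace ℝ (PolyGrowth n Ω) :=
  LocallyConvexSpace.sInf fun _ h => h.2.2.2

end Growth

end

/-! Bell's operators give a convergent expression for the divergent integral `∫_Ω f φ`. Near a
boundary point let the corner be `W = {r_j < 0, j ∈ S}`. Genericity means that the forms `∂̄r_j` are
linearly independent, so there are smooth `(0,1)` fields `a_j` with `∂̄r_i(a_j) = δ_ij`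
(`exists_dual_vectors`, `exists_isCornerFrame`). Let `L_j ψ` be the divergence of `ψ a_j`. A
holomorphic `h` is annihilated by `(0,1)` fields. Hence for a weight `G` of degree `k` in `r_j`, in
the sense that `r_j ∂̄G(a_j) = k G`, integration by parts gives `∫_W h G r_j L_j ψ = -(k+1) ∫_W h G
ψ`. The other `r_i` are constants for `a_j`, so one may run through all `j ∈ S`. With `R = ∏ r_j`
and `L` the composition of the `L_j`, this yields `∫_W h R^(k+1) L^(k+1) ψ = c ∫_W h R^k L^k ψ` with
`c ≠ 0` (`IsCornerFrame.bellPairing_succ`). The identity needs only that `h R^k` is bounded. Cutting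
off at the scale `1/m` in each `r_j` produces an error `m r_j η'(m r_j)`, which is bounded and tends
to zero pointwise.

On compact subsets of the frame, `|R| ≤ C dist(·, ∂Ω)`, because a compactly supported smooth
function which equals `R` there and vanishes on `∂Ω` is Lipschitz for the Riemannian distance
(`IsCornerFrame.exists_cornerWeight_le`). So for `f ∈ 𝒜^{-k}(Ω)` the integrals of `f R^k L^k ψ`
converge absolutely, and their normalized sum over a finite partition of unity is the definition of
`⟨ce f, φ⟩`. It does not depend on `k`, and it is bounded by `‖f‖` times the supremum of finitely
many derivatives of the coefficients of `φ`. As both spaces carry inductive limit topologies, this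
gives continuity.

If a holomorphic function is bounded on `supp φ`, the pairing of order `k` equals that of order `0`,
which is the honest integral. This gives the first and, since `∂Ω` is a null set, the third
property. It also applies to the shifted functions `f_ε`, whose integrals are therefore the pairings
of order `k` of `f_ε`. An outward shift vector satisfies `|r_j(z)| ≤ 4 |r_j(z - εv)|`, so `|f_ε
R^k|` is dominated by a constant times `|f| dist^k` at the shifted point. Dominated convergence
gives the limit formula (`CornerPiece.tendsto_bellPairing_shift`).

For uniqueness, the sum of the vectors dual to the `dr_j` points outward near a given point from all
the hypersurfaces. A partition of unity splits every test form into pieces to which the limit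
formula applies, and limits are unique. -/

noncomputable section

/-! ### The Cauchy–Riemann operator on `ℂⁿ` and divergences of `(0,1)` vector fields -/

section CauchyRiemann

variable {n : ℕ}

/-- Twice the antilinear part of the real differential of `F` at `z`, applied to `w`. -/
def dbar (F : Cn n → ℂ) (z w : Cn n) : ℂ :=
  fderiv ℝ F z w + Complex.I * fderiv ℝ F z (Complex.I • w)

theorem dbar_add_right (F : Cn n → ℂ) (z w w' : Cn n) :
    dbar F z (w + w') = dbar F z w + dbar F z w' := by
  simp only [dbar, smul_add, map_add]
  ring

theorem dbar_zero_right (F : Cn n → ℂ) (z : Cn n) : dbar F z 0 = 0 := by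
  simp [dbar]

theorem dbar_smul_right (F : Cn n → ℂ) (z w : Cn n) (c : ℂ) :
    dbar F z (c • w) = (starRingEnd ℂ) c * dbar F z w := by
  have h1 : c • w = c.re • w + c.im • (Complex.I • w) := by
    ext m
    simp only [Pi.smul_apply, Pi.add_apply, smul_eq_mul, Complex.real_smul]
    conv_lhs => rw [← Complex.re_add_im c]
    ring
  have h2 : Complex.I • (c • w) = c.re • (Complex.I • w) - c.im • w := by
    rw [h1]
    ext m
    simp only [Pi.smul_apply, Pi.add_apply, Pi.sub_apply, smul_eq_mul, Complex.real_smul]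
    linear_combination (c.im : ℂ) * w m * Complex.I_sq
  have h3 : (starRingEnd ℂ) c = c.re - c.im * Complex.I := by
    apply Complex.ext <;> simp
  rw [dbar, h2, h1, h3, dbar]
  simp only [map_add, map_sub, map_smul, Complex.real_smul]
  linear_combination (c.im : ℂ) * (fderiv ℝ F z (Complex.I • w)) * Complex.I_sq

theorem dbar_eq_sum (F : Cn n → ℂ) (z w : Cn n) :
    dbar F z w = ∑ m, (starRingEnd ℂ) (w m) * dbar F z (Pi.single m 1) := by
  have h : ∀ s : Finset (Fin n), dbar F z (∑ m ∈ s, w m • Pi.single m (1 : ℂ)) =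
      ∑ m ∈ s, (starRingEnd ℂ) (w m) * dbar F z (Pi.single m 1) := by
    intro s
    induction s using Finset.induction_on with
    | empty => simp [dbar_zero_right]
    | insert m s hm ih =>
      rw [Finset.sum_insert hm, Finset.sum_insert hm, dbar_add_right, ih, dbar_smul_right]
  have hw : w = ∑ m, w m • Pi.single m (1 : ℂ) := by
    ext i
    simp [Finset.sum_apply, Pi.single_apply]
  conv_lhs => rw [hw]
  exact h _

theorem dbar_mul {F G : Cn n → ℂ} {z : Cn n} (hF : DifferentiableAt ℝ F z)
    (hG : DifferentiableAt ℝ G z) (w : Cn n) :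
    dbar (fun y => F y * G y) z w = dbar F z w * G z + F z * dbar G z w := by
  simp only [dbar, fderiv_fun_mul hF hG, add_apply,
    smul_apply, smul_eq_mul]
  ring

theorem dbar_eq_zero_of_differentiableAt {h : Cn n → ℂ} {z : Cn n}
    (hh : DifferentiableAt ℂ h z) (w : Cn n) : dbar h z w = 0 := by
  have : fderiv ℝ h z = (fderiv ℂ h z).restrictScalars ℝ :=
    (hh.hasFDerivAt.restrictScalars ℝ).fderiv
  simp only [dbar, this, ContinuousLinearMap.coe_restrictScalars', map_smul, smul_eq_mul]
  linear_combination (fderiv ℂ h z w) * Complex.I_sq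

theorem dbar_congr {F G : Cn n → ℂ} {z : Cn n} (h : F =ᶠ[𝓝 z] G) (w : Cn n) :
    dbar F z w = dbar G z w := by
  simp only [dbar, h.fderiv_eq]

theorem dbar_const (c : ℂ) (z w : Cn n) : dbar (fun _ : Cn n => c) z w = 0 := by
  simp [dbar]

theorem dbar_add {F G : Cn n → ℂ} {z : Cn n} (hF : DifferentiableAt ℝ F z)
    (hG : DifferentiableAt ℝ G z) (w : Cn n) :
    dbar (fun y => F y + G y) z w = dbar F z w + dbar G z w := by
  simp only [dbar, fderiv_fun_add hF hG, add_apply]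
  ring

theorem dbar_ofReal_comp {η : ℝ → ℝ} {q : Cn n → ℝ} {z : Cn n}
    (hη : DifferentiableAt ℝ η (q z)) (hq : DifferentiableAt ℝ q z) (w : Cn n) :
    dbar (fun y => (η (q y) : ℂ)) z w = ((deriv η (q z) : ℝ) : ℂ) * dbar (fun y => (q y : ℂ)) z w := by
  have h1 : ∀ u, fderiv ℝ (fun y => (q y : ℂ)) z u = ((fderiv ℝ q z u : ℝ) : ℂ) := fun u => by
    have := (Complex.ofRealCLM.hasFDerivAt.comp z hq.hasFDerivAt).fderiv
    have h2 : fderiv ℝ (fun y => (q y : ℂ)) z = Complex.ofRealCLM.comp (fderiv ℝ q z) := this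
    simp [h2]
  have h3 : ∀ u, fderiv ℝ (fun y => (η (q y) : ℂ)) z u =
      ((deriv η (q z) * fderiv ℝ q z u : ℝ) : ℂ) := fun u => by
    have h4 : HasFDerivAt (fun y => η (q y)) (deriv η (q z) • fderiv ℝ q z) z :=
      hη.hasDerivAt.comp_hasFDerivAt z hq.hasFDerivAt
    have h2 : fderiv ℝ (fun y => (η (q y) : ℂ)) z =
        Complex.ofRealCLM.comp (deriv η (q z) • fderiv ℝ q z) :=
      (Complex.ofRealCLM.hasFDerivAt.comp z h4).fderiv
    simp [h2]
  simp only [dbar, h1, h3]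
  push_cast
  ring

theorem dbar_prod_eq_zero {ι : Type*} (s : Finset ι) {F : ι → Cn n → ℂ} {z w : Cn n}
    (hF : ∀ i ∈ s, DifferentiableAt ℝ (F i) z) (h : ∀ i ∈ s, dbar (F i) z w = 0) :
    dbar (fun y => ∏ i ∈ s, F i y) z w = 0 := by
  classical
  induction s using Finset.induction_on with
  | empty => simpa using dbar_const 1 z w
  | insert i s hi ih =>
    simp only [Finset.prod_insert hi]
    have hs : DifferentiableAt ℝ (fun y => ∏ i ∈ s, F i y) z :=
      (HasFDerivAt.finsetProd fun j hj =>
        (hF j (Finset.mem_insert_of_mem hj)).hasFDerivAt).differentiableAt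
    rw [dbar_mul (hF i (Finset.mem_insert_self i s)) hs, h i (Finset.mem_insert_self i s),
      ih (fun j hj => hF j (Finset.mem_insert_of_mem hj))
        (fun j hj => h j (Finset.mem_insert_of_mem hj))]
    simp

/-- The divergence of `F` times the `(0,1)` vector field with coefficients `conj a`. -/
def vecDiv (a : Cn n → Cn n) (F : Cn n → ℂ) (z : Cn n) : ℂ :=
  ∑ m, dbar (fun y => (starRingEnd ℂ) (a y m) * F y) z (Pi.single m 1)

theorem contDiff_conj_coord {a : Cn n → Cn n} (ha : ContDiff ℝ ∞ a) (m : Fin n) :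
    ContDiff ℝ ∞ fun y => (starRingEnd ℂ) (a y m) :=
  (Complex.conjCLE : ℂ ≃L[ℝ] ℂ).contDiff.comp ((contDiff_pi.1 ha) m)

/-- Leibniz rule for a divergence: the field acts on `F` as a derivation, and the divergence stays
on `G`. The coefficients of the field are conjugated because `dbar` is antilinear in the vector. -/
theorem vecDiv_mul {a : Cn n → Cn n} (ha : ContDiff ℝ ∞ a) {F G : Cn n → ℂ} {z : Cn n}
    (hF : DifferentiableAt ℝ F z) (hG : DifferentiableAt ℝ G z) :
    vecDiv a (fun y => F y * G y) z = dbar F z (a z) * G z + F z * vecDiv a G z := by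
  rw [vecDiv, vecDiv, dbar_eq_sum F z (a z), Finset.sum_mul, Finset.mul_sum,
    ← Finset.sum_add_distrib]
  refine Finset.sum_congr rfl fun m _ => ?_
  have ham := ((contDiff_conj_coord ha m).differentiable (by simp)) z
  rw [← mul_left_comm_fun ham hF hG m]
where
  mul_left_comm_fun {a : Cn n → Cn n} {F G : Cn n → ℂ} {z : Cn n} {m : Fin n}
      (ham : DifferentiableAt ℝ (fun y => (starRingEnd ℂ) (a y m)) z)
      (hF : DifferentiableAt ℝ F z) (hG : DifferentiableAt ℝ G z) (k : Fin n) :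
      dbar (fun y => (starRingEnd ℂ) (a y m) * (F y * G y)) z (Pi.single k 1) =
        (starRingEnd ℂ) (a z m) * dbar F z (Pi.single k 1) * G z +
          F z * dbar (fun y => (starRingEnd ℂ) (a y m) * G y) z (Pi.single k 1) := by
    rw [dbar_mul ham (hF.fun_mul hG), dbar_mul hF hG, dbar_mul ham hG]
    ring

theorem vecDiv_congr {a : Cn n → Cn n} {F G : Cn n → ℂ} {z : Cn n} (h : F =ᶠ[𝓝 z] G) :
    vecDiv a F z = vecDiv a G z :=
  Finset.sum_congr rfl fun m _ => dbar_congr (h.mono fun y hy => by simp only [hy]) _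

theorem vecDiv_zero (a : Cn n → Cn n) (z : Cn n) : vecDiv a (fun _ => 0) z = 0 := by
  simp [vecDiv, dbar_const]

theorem vecDiv_eq_zero_of_notMem_tsupport {a : Cn n → Cn n} {F : Cn n → ℂ} {z : Cn n}
    (hz : z ∉ tsupport F) : vecDiv a F z = 0 :=
  (vecDiv_congr (notMem_tsupport_iff_eventuallyEq.1 hz)).trans (vecDiv_zero a z)

theorem tsupport_vecDiv_subset (a : Cn n → Cn n) (F : Cn n → ℂ) :
    tsupport (vecDiv a F) ⊆ tsupport F :=
  closure_minimal (fun z hz => by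
    by_contra h
    exact hz (vecDiv_eq_zero_of_notMem_tsupport h)) (isClosed_tsupport F)

theorem contDiff_dbar {F : Cn n → ℂ} (hF : ContDiff ℝ ∞ F) (w : Cn n) :
    ContDiff ℝ ∞ fun z => dbar F z w := by
  have h : ContDiff ℝ ∞ (fderiv ℝ F) := hF.fderiv_right (by simp)
  exact (h.clm_apply contDiff_const).add (contDiff_const.mul (h.clm_apply contDiff_const))

theorem contDiff_vecDiv {a : Cn n → Cn n} (ha : ContDiff ℝ ∞ a) {F : Cn n → ℂ}
    (hF : ContDiff ℝ ∞ F) : ContDiff ℝ ∞ (vecDiv a F) :=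
  ContDiff.sum fun m _ => contDiff_dbar ((contDiff_conj_coord ha m).mul hF) _

/-! ### Integration by parts -/

/-- Cauchy's estimate on balls of a fixed radius that stay in `O`, so complex differentiability
suffices. -/
theorem exists_norm_fderiv_le_of_differentiableOn {h : Cn n → ℂ} {O K : Set (Cn n)}
    (hO : IsOpen O) (hK : IsCompact K) (hKO : K ⊆ O) (hh : DifferentiableOn ℂ h O) :
    ∃ C, ∀ z ∈ K, ‖fderiv ℝ h z‖ ≤ C := by
  obtain ⟨δ, hδ, hδO⟩ := hK.exists_cthickening_subset_open hO hKO
  have hc : IsCompact (Metric.cthickening δ K) := hK.cthickening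
  obtain ⟨B, hB⟩ := hc.exists_bound_of_continuousOn (hh.continuousOn.mono hδO)
  -- Two values of `h` differ by at most `2|B|`; the summand `1` puts the image in an open ball.
  refine ⟨(2 * |B| + 1) / δ, fun z hz => ?_⟩
  have hball : Metric.ball z δ ⊆ Metric.cthickening δ K := fun y hy =>
    Metric.mem_cthickening_of_dist_le y z δ K hz hy.le
  have hmaps : MapsTo h (Metric.ball z δ) (Metric.ball (h z) (2 * |B| + 1)) := fun y hy => by
    rw [Metric.mem_ball, dist_eq_norm]
    have h1 := hB y (hball hy)
    have h2 := hB z (hball (Metric.mem_ball_self hδ))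
    have h3 := norm_sub_le (h y) (h z)
    have h4 := le_abs_self B
    linarith
  have h5 := Complex.norm_fderiv_le_div_of_mapsTo_ball (hh.mono (hball.trans hδO))
    (hmaps.mono_right Metric.ball_subset_closedBall) hδ
  have : fderiv ℝ h z = (fderiv ℂ h z).restrictScalars ℝ :=
    (((hh z (hKO hz)).differentiableAt (hO.mem_nhds (hKO hz))).hasFDerivAt.restrictScalars ℝ).fderiv
  rw [this, ContinuousLinearMap.norm_restrictScalars]
  exact h5

/-- Integration by parts against the constant `1`. A bound on the derivative replaces its
continuity, since the derivative is always measurable. -/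
theorem integral_fderiv_eq_zero {F : Cn n → ℂ} (hF : Differentiable ℝ F)
    (hc : HasCompactSupport F) {C : ℝ} (hC : ∀ z, ‖fderiv ℝ F z‖ ≤ C) (v : Cn n) :
    Integrable (fun z => fderiv ℝ F z v) ∧ ∫ z, fderiv ℝ F z v = 0 := by
  have hi : Integrable (fun z => fderiv ℝ F z v) := by
    have h1 : IntegrableOn (fun z => fderiv ℝ F z v) (tsupport F) := by
      refine Measure.integrableOn_of_bounded (M := C * ‖v‖) hc.isCompact.measure_lt_top.ne
        (measurable_fderiv_apply_const ℝ F v).aestronglyMeasurable ?_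
      exact Eventually.of_forall fun z => ((fderiv ℝ F z).le_opNorm v).trans
        (mul_le_mul_of_nonneg_right (hC z) (norm_nonneg v))
    rwa [integrableOn_iff_integrable_of_support_subset] at h1
    intro z hz
    by_contra h
    exact hz (by simp [fderiv_of_notMem_tsupport ℝ h])
  refine ⟨hi, ?_⟩
  have := integral_mul_fderiv_eq_neg_fderiv_mul_of_integrable (μ := volume) (𝕜 := ℂ)
    (f := fun _ : Cn n => (1 : ℂ)) (g := F) (v := v) (by simp) (by simpa using hi)
    (by simpa using hF.continuous.integrable_of_hasCompactSupport hc)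
    (fun x _ => differentiableAt_const _) (fun x _ => hF x)
  simpa using this

theorem integral_dbar_eq_zero {F : Cn n → ℂ} (hF : Differentiable ℝ F)
    (hc : HasCompactSupport F) {C : ℝ} (hC : ∀ z, ‖fderiv ℝ F z‖ ≤ C) (v : Cn n) :
    Integrable (fun z => dbar F z v) ∧ ∫ z, dbar F z v = 0 := by
  obtain ⟨h1, h2⟩ := integral_fderiv_eq_zero hF hc hC v
  obtain ⟨h3, h4⟩ := integral_fderiv_eq_zero hF hc hC (Complex.I • v)
  refine ⟨h1.add (h3.const_mul _), ?_⟩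
  simp only [dbar]
  rw [integral_add h1 (h3.const_mul _), integral_const_mul, h2, h4]
  simp

/-- As `∂̄h = 0`, the factor `h` can be moved under the derivatives, and the integrand becomes a
divergence with compact support. -/
theorem integral_mul_vecDiv_eq_zero {h q : Cn n → ℂ} {a : Cn n → Cn n} {O : Set (Cn n)}
    (hO : IsOpen O) (hh : DifferentiableOn ℂ h O) (ha : ContDiff ℝ ∞ a) (hq : ContDiff ℝ ∞ q)
    (hqc : HasCompactSupport q) (hqO : tsupport q ⊆ O) :
    ∫ z, h z * vecDiv a q z = 0 := by
  have hhz : ∀ z ∈ tsupport q, DifferentiableAt ℂ h z := fun z hz =>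
    (hh z (hqO hz)).differentiableAt (hO.mem_nhds (hqO hz))
  -- Outside `O` nothing is known about `h`, but `h p` vanishes near every point outside `tsupport
  -- q`. It is therefore differentiable everywhere, with bounded derivative.
  have key : ∀ p : Cn n → ℂ, ContDiff ℝ ∞ p → tsupport p ⊆ tsupport q → ∀ v,
      Integrable (fun z => dbar (fun y => h y * p y) z v) ∧
        ∫ z, dbar (fun y => h y * p y) z v = 0 := by
    intro p hp hpq v
    have hts : tsupport (fun y => h y * p y) ⊆ tsupport p :=
      closure_mono (Function.support_mul_subset_right h p)
    have hpc : HasCompactSupport (fun y => h y * p y) :=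
      hqc.of_isClosed_subset (isClosed_tsupport _) (hts.trans hpq)
    have hd : Differentiable ℝ (fun y => h y * p y) := fun z => by
      by_cases hz : z ∈ tsupport q
      · exact ((hhz z hz).restrictScalars ℝ).mul (hp.differentiable (by simp) z)
      · have : (fun y => h y * p y) =ᶠ[𝓝 z] fun _ => 0 :=
          notMem_tsupport_iff_eventuallyEq.1 fun h => hz (hpq (hts h))
        exact (differentiableAt_const (0 : ℂ)).congr_of_eventuallyEq this
    obtain ⟨C1, hC1⟩ := exists_norm_fderiv_le_of_differentiableOn hO hqc hqO hh
    obtain ⟨C2, hC2⟩ := hqc.isCompact.exists_bound_of_continuousOn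
      (hh.continuousOn.mono hqO)
    obtain ⟨C3, hC3⟩ := hqc.isCompact.exists_bound_of_continuousOn hp.continuous.continuousOn
    obtain ⟨C4, hC4⟩ := hqc.isCompact.exists_bound_of_continuousOn
      (hp.continuous_fderiv (by simp)).continuousOn
    refine integral_dbar_eq_zero hd hpc (C := |C2| * |C4| + |C3| * |C1|) (fun z => ?_) v
    by_cases hz : z ∈ tsupport q
    · rw [fderiv_fun_mul ((hhz z hz).restrictScalars ℝ) (hp.differentiable (by simp) z)]
      refine (norm_add_le _ _).trans ?_
      rw [norm_smul, norm_smul]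
      gcongr
      · exact (hC2 z hz).trans (le_abs_self _)
      · exact (hC4 z hz).trans (le_abs_self _)
      · exact (hC3 z hz).trans (le_abs_self _)
      · exact (hC1 z hz).trans (le_abs_self _)
    · rw [fderiv_of_notMem_tsupport ℝ fun h => hz (hpq (hts h))]
      simpa using by positivity
  have hsum : ∀ z, h z * vecDiv a q z =
      ∑ m, dbar (fun y => h y * ((starRingEnd ℂ) (a y m) * q y)) z (Pi.single m 1) := by
    intro z
    rw [vecDiv, Finset.mul_sum]
    refine Finset.sum_congr rfl fun m _ => ?_
    by_cases hz : z ∈ tsupport q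
    · have hp := ((contDiff_conj_coord ha m).mul hq).differentiable (by simp) z
      rw [dbar_mul ((hhz z hz).restrictScalars ℝ) hp, dbar_eq_zero_of_differentiableAt (hhz z hz)]
      simp
    · have h0 : q =ᶠ[𝓝 z] fun _ => 0 := notMem_tsupport_iff_eventuallyEq.1 hz
      rw [dbar_congr (G := fun _ => 0) (h0.mono fun y hy => by simp [hy]),
        dbar_congr (F := fun y => h y * _) (G := fun _ => 0) (h0.mono fun y hy => by simp [hy]),
        dbar_const, mul_zero]
  simp_rw [hsum]
  have hk := fun m => key _ ((contDiff_conj_coord ha m).mul hq)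
    (closure_mono (Function.support_mul_subset_right _ q)) (Pi.single m 1)
  rw [integral_finsetSum _ fun m _ => (hk m).1]
  exact Finset.sum_eq_zero fun m _ => (hk m).2

end CauchyRiemann

/-! ### A cutoff function on the half line -/

/-- A smooth function which is `1` on `(-∞, -2]` and `0` on `[-1, ∞)`. -/
def edgeCutoff (t : ℝ) : ℝ := Real.smoothTransition (-t - 1)

theorem contDiff_edgeCutoff : ContDiff ℝ ∞ edgeCutoff :=
  Real.smoothTransition.contDiff.comp (contDiff_neg.sub contDiff_const)

theorem edgeCutoff_eq_one {t : ℝ} (ht : t ≤ -2) : edgeCutoff t = 1 :=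
  Real.smoothTransition.one_of_one_le (by linarith)

theorem edgeCutoff_eq_zero {t : ℝ} (ht : -1 ≤ t) : edgeCutoff t = 0 :=
  Real.smoothTransition.zero_of_nonpos (by linarith)

theorem abs_edgeCutoff_le_one (t : ℝ) : |edgeCutoff t| ≤ 1 := by
  rw [edgeCutoff, abs_of_nonneg (Real.smoothTransition.nonneg _)]
  exact Real.smoothTransition.le_one _

theorem deriv_edgeCutoff_eq_zero_of_lt {t : ℝ} (ht : t < -2) : deriv edgeCutoff t = 0 := by
  have : edgeCutoff =ᶠ[𝓝 t] fun _ => 1 :=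
    (eventually_lt_nhds ht).mono fun s hs => edgeCutoff_eq_one hs.le
  simpa using this.deriv_eq

theorem deriv_edgeCutoff_eq_zero_of_gt {t : ℝ} (ht : -1 < t) : deriv edgeCutoff t = 0 := by
  have : edgeCutoff =ᶠ[𝓝 t] fun _ => 0 :=
    (eventually_gt_nhds ht).mono fun s hs => edgeCutoff_eq_zero (le_of_lt hs)
  simpa using this.deriv_eq

theorem continuous_deriv_edgeCutoff : Continuous (deriv edgeCutoff) :=
  contDiff_edgeCutoff.continuous_deriv (by simp)

/-- One factor `r_j` compensates the growth of the derivative of the rescaled cutoff, uniformly in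
the scale: take `t = (m + 1) r_j`. -/
theorem exists_abs_mul_deriv_edgeCutoff_le : ∃ C, ∀ t, |t * deriv edgeCutoff t| ≤ C := by
  obtain ⟨C, hC⟩ := (isCompact_Icc (a := (-2 : ℝ)) (b := -1)).exists_bound_of_continuousOn
    (f := fun t => t * deriv edgeCutoff t) (continuous_id.mul continuous_deriv_edgeCutoff).continuousOn
  refine ⟨|C|, fun t => ?_⟩
  by_cases ht : t ∈ Icc (-2 : ℝ) (-1)
  · exact (hC t ht).trans (le_abs_self C)
  · rcases lt_or_ge t (-2) with h | h
    · simp [deriv_edgeCutoff_eq_zero_of_lt h]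
    · have : -1 < t := not_le.1 fun h' => ht ⟨h, h'⟩
      simp [deriv_edgeCutoff_eq_zero_of_gt this]

/-! ### Bell's operators at a generic corner -/

section Corner

variable {n N : ℕ}

/-- In the open set `U` the set `W` is a generic corner `{r j < 0, j ∈ S}`, and `a j`, `j ∈ S`, are
`(0,1)` vector fields dual to the `r j`. -/
structure IsCornerFrame (U W : Set (Cn n)) (S : Finset (Fin N)) (r : Fin N → Cn n → ℝ)
    (a : Fin N → Cn n → Cn n) : Prop where
  isOpen : IsOpen U
  isOpen_domain : IsOpen W
  contDiff_r : ∀ j, ContDiff ℝ ∞ (r j)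
  contDiff_a : ∀ j, ContDiff ℝ ∞ (a j)
  dual : ∀ z ∈ U, ∀ i ∈ S, ∀ j ∈ S,
    dbar (fun y => (r i y : ℂ)) z (a j z) = if i = j then 1 else 0
  mem_iff : ∀ z ∈ U, (z ∈ W ↔ ∀ j ∈ S, r j z < 0)

variable {U W : Set (Cn n)} {S : Finset (Fin N)} {r : Fin N → Cn n → ℝ}
  {a : Fin N → Cn n → Cn n}

/-- The cutoff functions exhausting the corner. -/
def cornerCutoff (T : Finset (Fin N)) (r : Fin N → Cn n → ℝ) (m : ℕ) (z : Cn n) : ℂ :=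
  ∏ i ∈ T, (edgeCutoff ((m + 1 : ℝ) * r i z) : ℂ)

theorem contDiff_ofReal_comp {q : Cn n → ℝ} (hq : ContDiff ℝ ∞ q) :
    ContDiff ℝ ∞ fun z => (q z : ℂ) :=
  Complex.ofRealCLM.contDiff.comp hq

theorem contDiff_edgeCutoff_mul {q : Cn n → ℝ} (hq : ContDiff ℝ ∞ q) (c : ℝ) :
    ContDiff ℝ ∞ fun z => (edgeCutoff (c * q z) : ℂ) :=
  contDiff_ofReal_comp (contDiff_edgeCutoff.comp (contDiff_const.mul hq))

theorem contDiff_cornerCutoff (T : Finset (Fin N)) (hr : ∀ j, ContDiff ℝ ∞ (r j)) (m : ℕ) :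
    ContDiff ℝ ∞ (cornerCutoff T r m) :=
  contDiff_prod fun i _ => contDiff_edgeCutoff_mul (hr i) _

theorem norm_cornerCutoff_le_one (T : Finset (Fin N)) (r : Fin N → Cn n → ℝ) (m : ℕ) (z : Cn n) :
    ‖cornerCutoff T r m z‖ ≤ 1 := by
  rw [cornerCutoff, norm_prod]
  refine Finset.prod_le_one (fun i _ => norm_nonneg _) fun i _ => ?_
  rw [Complex.norm_real]
  exact abs_edgeCutoff_le_one _

theorem eventually_mul_le_neg_two {t : ℝ} (ht : t < 0) :
    ∀ᶠ m : ℕ in atTop, (m + 1 : ℝ) * t < -2 := by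
  have h : Tendsto (fun m : ℕ => (m + 1 : ℝ) * t) atTop atBot :=
    (tendsto_atTop_add_const_right _ _ tendsto_natCast_atTop_atTop).atTop_mul_const_of_neg ht
  exact h.eventually (eventually_lt_atBot _)

theorem eventually_cornerCutoff_eq_one {T : Finset (Fin N)} {z : Cn n}
    (hz : ∀ j ∈ T, r j z < 0) : ∀ᶠ m : ℕ in atTop, cornerCutoff T r m z = 1 := by
  have : ∀ᶠ m : ℕ in atTop, ∀ j ∈ T, (m + 1 : ℝ) * r j z < -2 :=
    (Finset.eventually_all T).2 fun j hj => eventually_mul_le_neg_two (hz j hj)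
  refine this.mono fun m hm => Finset.prod_eq_one fun i hi => ?_
  rw [edgeCutoff_eq_one (hm i hi).le, Complex.ofReal_one]

theorem eventually_nhds_cornerCutoff_eq_zero {T : Finset (Fin N)} {z : Cn n} {j : Fin N}
    (hj : j ∈ T) (hr : Continuous (r j)) (hz : 0 ≤ r j z) (m : ℕ) :
    ∀ᶠ y in 𝓝 z, cornerCutoff T r m y = 0 := by
  have h1 : -1 < (m + 1 : ℝ) * r j z :=
    lt_of_lt_of_le (by norm_num) (mul_nonneg (by positivity) hz)
  have h2 : ∀ᶠ y in 𝓝 z, -1 < (m + 1 : ℝ) * r j y :=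
    (continuous_const.mul hr).continuousAt.eventually (eventually_gt_nhds h1)
  refine h2.mono fun y hy => Finset.prod_eq_zero hj ?_
  rw [edgeCutoff_eq_zero (le_of_lt hy), Complex.ofReal_zero]

theorem integrableOn_mul_of_bound {h Q : Cn n → ℂ} {O K : Set (Cn n)} (hW : IsOpen W)
    (hh : ContinuousOn h (W ∩ O)) (hK : IsCompact K) (hKO : K ⊆ O) (hQ : Continuous Q)
    {C : ℝ} (hC : ∀ z ∈ W ∩ K, ‖h z * Q z‖ ≤ C) :
    IntegrableOn (fun z => h z * Q z) (W ∩ K) := by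
  have hm : MeasurableSet (W ∩ K) := hW.measurableSet.inter hK.measurableSet
  refine IntegrableOn.of_bound
    ((measure_mono inter_subset_right).trans_lt hK.measure_lt_top) ?_ C ?_
  · exact (((hh.mono (inter_subset_inter_right W hKO)).mul
      hQ.continuousOn).aestronglyMeasurable hm)
  · exact (ae_restrict_iff' hm).2 (Eventually.of_forall hC)

theorem setIntegral_eq_inter_tsupport {h ψ Q : Cn n → ℂ} (hW : IsOpen W)
    (hQ : ∀ z ∉ tsupport ψ, Q z = 0) :
    ∫ z in W, h z * Q z = ∫ z in W ∩ tsupport ψ, h z * Q z := by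
  refine setIntegral_eq_of_subset_of_forall_sdiff_eq_zero hW.measurableSet inter_subset_left ?_
  intro z hz
  rw [hQ z fun h => hz.2 ⟨hz.1, h⟩, mul_zero]

/-- Multiplied by the cutoff functions, a function becomes smooth when extended by zero outside the
corner. -/
theorem IsCornerFrame.contDiff_indicator (hd : IsCornerFrame U W S r a) {q ψ : Cn n → ℂ}
    (hq : ContDiff ℝ ∞ q) (hqψ : tsupport q ⊆ tsupport ψ) (hψc : HasCompactSupport ψ)
    (hψU : tsupport ψ ⊆ U) (m : ℕ) :
    ContDiff ℝ ∞ (W.indicator fun z => cornerCutoff S r m z * q z) ∧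
      HasCompactSupport (W.indicator fun z => cornerCutoff S r m z * q z) ∧
      tsupport (W.indicator fun z => cornerCutoff S r m z * q z) ⊆ W ∩ tsupport ψ := by
  set F := fun z => cornerCutoff S r m z * q z with hF
  have hFs : ContDiff ℝ ∞ F := (contDiff_cornerCutoff S hd.contDiff_r m).mul hq
  -- At a point of the support outside `W` some `r_j` is nonnegative. The cutoff already vanishes
  -- for `r_j ≥ -1/(m+1)`, hence on a whole neighbourhood.
  have hout : ∀ z, z ∉ W ∩ tsupport ψ → W.indicator F =ᶠ[𝓝 z] fun _ => 0 := by
    intro z hz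
    by_cases h : z ∈ tsupport ψ
    · have hzW : z ∉ W := fun h' => hz ⟨h', h⟩
      rw [hd.mem_iff z (hψU h)] at hzW
      push Not at hzW
      obtain ⟨j, hj, hjz⟩ := hzW
      refine (eventually_nhds_cornerCutoff_eq_zero hj (hd.contDiff_r j).continuous hjz m).mono
        fun y hy => ?_
      simp [Set.indicator, hF, hy]
    · refine (notMem_tsupport_iff_eventuallyEq.1 fun h' => h (hqψ h')).mono fun y hy => ?_
      simp [Set.indicator, hF, hy]
  have hts : tsupport (W.indicator F) ⊆ W ∩ tsupport ψ := fun z hz => by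
    by_contra h
    exact notMem_tsupport_iff_eventuallyEq.2 (hout z h) hz
  refine ⟨contDiff_iff_contDiffAt.2 fun z => ?_,
    hψc.of_isClosed_subset (isClosed_tsupport _) (hts.trans inter_subset_right), hts⟩
  by_cases h : z ∈ W ∩ tsupport ψ
  · refine hFs.contDiffAt.congr_of_eventuallyEq ?_
    filter_upwards [hd.isOpen_domain.mem_nhds h.1] with y hy
    exact Set.indicator_of_mem hy F
  · exact contDiffAt_const.congr_of_eventuallyEq (hout z h)

/-- By duality `a j` differentiates only the factor with index `j` and treats the other factors as
constants. -/
theorem IsCornerFrame.dbar_cornerCutoff (hd : IsCornerFrame U W S r a) {z : Cn n} (hz : z ∈ U)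
    {j : Fin N} (hj : j ∈ S) (m : ℕ) :
    dbar (cornerCutoff S r m) z (a j z) =
      (((m + 1 : ℝ) * deriv edgeCutoff ((m + 1 : ℝ) * r j z) : ℝ) : ℂ) *
        cornerCutoff (S.erase j) r m z := by
  have hsm : ∀ i, DifferentiableAt ℝ (fun z => (edgeCutoff ((m + 1 : ℝ) * r i z) : ℂ)) z :=
    fun i => (contDiff_edgeCutoff_mul (hd.contDiff_r i) _).differentiable (by simp) z
  have hdiff : ∀ i, i ∈ S → dbar (fun y => (edgeCutoff ((m + 1 : ℝ) * r i y) : ℂ)) z (a j z) =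
      if i = j then (((m + 1 : ℝ) * deriv edgeCutoff ((m + 1 : ℝ) * r j z) : ℝ) : ℂ) else 0 := by
    intro i hi
    have h1 := dbar_ofReal_comp (η := fun t => edgeCutoff ((m + 1 : ℝ) * t)) (q := r i) (z := z)
      ((contDiff_edgeCutoff.comp (contDiff_const.mul contDiff_id)).differentiable (by simp) _)
      ((hd.contDiff_r i).differentiable (by simp) z) (a j z)
    rw [h1, hd.dual z hz i hi j hj, deriv_comp_mul_left]
    by_cases h : i = j
    · subst h
      simp
    · simp [h]
  have hprod : cornerCutoff S r m = fun y => (edgeCutoff ((m + 1 : ℝ) * r j y) : ℂ) *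
      cornerCutoff (S.erase j) r m y := by
    funext y
    exact (Finset.mul_prod_erase S (fun i => (edgeCutoff ((m + 1 : ℝ) * r i y) : ℂ)) hj).symm
  have hzero : dbar (cornerCutoff (S.erase j) r m) z (a j z) = 0 := by
    refine dbar_prod_eq_zero (S.erase j) (fun i _ => hsm i) fun i hi => ?_
    rw [hdiff i (Finset.mem_of_mem_erase hi), if_neg (Finset.ne_of_mem_erase hi)]
  rw [hprod, dbar_mul (hsm j)
    ((contDiff_cornerCutoff _ hd.contDiff_r m).differentiable (by simp) z), hzero, hdiff j hj,
    if_pos rfl, mul_zero, add_zero]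

/-- One integration by parts along the vector field `a j`. -/
theorem IsCornerFrame.integral_mul_vecDiv (hd : IsCornerFrame U W S r a) {j : Fin N} (hj : j ∈ S)
    {h ψ : Cn n → ℂ} {O : Set (Cn n)} (hO : IsOpen O) (hh : DifferentiableOn ℂ h (W ∩ O))
    (hψ : ContDiff ℝ ∞ ψ) (hψc : HasCompactSupport ψ) (hψU : tsupport ψ ⊆ U)
    (hψO : tsupport ψ ⊆ O) {G : Cn n → ℝ} (hG : ContDiff ℝ ∞ G) {k : ℕ}
    (hGk : ∀ z ∈ U, (r j z : ℂ) * dbar (fun y => (G y : ℂ)) z (a j z) = k * G z)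
    {C : ℝ} (hC : ∀ z ∈ W ∩ tsupport ψ, ‖h z * G z‖ ≤ C) :
    ∫ z in W, h z * ((G z : ℂ) * r j z * vecDiv (a j) ψ z) =
      -(k + 1 : ℂ) * ∫ z in W, h z * ((G z : ℂ) * ψ z) := by
  have hW := hd.isOpen_domain
  have hrj := contDiff_ofReal_comp (hd.contDiff_r j)
  have hGc := contDiff_ofReal_comp hG
  have hvψ : ContDiff ℝ ∞ (vecDiv (a j) ψ) := contDiff_vecDiv (hd.contDiff_a j) hψ
  have hvψ0 : ∀ z ∉ tsupport ψ, vecDiv (a j) ψ z = 0 := fun z hz =>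
    vecDiv_eq_zero_of_notMem_tsupport hz
  have hψ0 : ∀ z ∉ tsupport ψ, ψ z = 0 := fun z hz => image_eq_zero_of_notMem_tsupport hz
  have hK := hψc.isCompact
  -- `G * Q m` is the divergence of the cutoff times `G r_j ψ`. Its three contributions are the
  -- derivative of the cutoff, the derivative of `G r_j`, equal to `(k + 1) G`, and the divergence
  -- of `ψ`. `P` is what remains of `Q m` when the cutoff is `1`.
  set P : Cn n → ℂ := fun z => (k + 1) * ψ z + r j z * vecDiv (a j) ψ z with hP
  set Q : ℕ → Cn n → ℂ := fun m z =>
    (((m + 1 : ℝ) * r j z * deriv edgeCutoff ((m + 1 : ℝ) * r j z) : ℝ) : ℂ) *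
      cornerCutoff (S.erase j) r m z * ψ z + cornerCutoff S r m z * P z with hQ
  have hPc : Continuous P := (continuous_const.mul hψ.continuous).add
    (hrj.continuous.mul hvψ.continuous)
  have hQc : ∀ m, Continuous (Q m) := fun m => by
    have h1 : Continuous fun z => (m + 1 : ℝ) * r j z :=
      continuous_const.mul (hd.contDiff_r j).continuous
    exact (((Complex.continuous_ofReal.comp
      (h1.mul (continuous_deriv_edgeCutoff.comp h1))).mul
        (contDiff_cornerCutoff _ hd.contDiff_r m).continuous).mul hψ.continuous).add
      ((contDiff_cornerCutoff _ hd.contDiff_r m).continuous.mul hPc)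
  have hP0 : ∀ z ∉ tsupport ψ, P z = 0 := fun z hz => by
    simp [hP, hψ0 z hz, hvψ0 z hz]
  have hQ0 : ∀ m, ∀ z ∉ tsupport ψ, Q m z = 0 := fun m z hz => by
    simp [hQ, hψ0 z hz, hP0 z hz]
  -- The cut off function has compact support inside `W`, so there is no boundary term.
  have hzero : ∀ m, ∫ z in W ∩ tsupport ψ, h z * ((G z : ℂ) * Q m z) = 0 := by
    intro m
    set q : Cn n → ℂ := fun z => (G z : ℂ) * r j z * ψ z with hq
    have hqs : ContDiff ℝ ∞ q := (hGc.mul hrj).mul hψ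
    obtain ⟨h1, h2, h3⟩ := hd.contDiff_indicator hqs
      (closure_mono (Function.support_mul_subset_right _ ψ)) hψc hψU m
    have h4 := integral_mul_vecDiv_eq_zero (hW.inter hO) hh (hd.contDiff_a j) h1 h2
      (h3.trans (inter_subset_inter_right W hψO))
    have h5 : ∀ z, z ∉ W ∩ tsupport ψ → h z * vecDiv (a j)
        (W.indicator fun z => cornerCutoff S r m z * q z) z = 0 := fun z hz => by
      rw [vecDiv_eq_zero_of_notMem_tsupport fun h => hz (h3 h), mul_zero]
    rw [← setIntegral_eq_integral_of_forall_compl_eq_zero h5] at h4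
    rw [← h4]
    refine setIntegral_congr_fun (hW.measurableSet.inter hK.measurableSet) fun z hz => ?_
    have hzU := hψU hz.2
    have h6 : (W.indicator fun z => cornerCutoff S r m z * q z) =ᶠ[𝓝 z]
        fun y => (cornerCutoff S r m y * ((G y : ℂ) * r j y)) * ψ y := by
      filter_upwards [hW.mem_nhds hz.1] with y hy
      rw [Set.indicator_of_mem hy, hq]
      ring
    have hχd := (contDiff_cornerCutoff S hd.contDiff_r m).differentiable (by simp) z
    have hGd := hGc.differentiable (by simp) z
    have hrd := hrj.differentiable (by simp) z
    rw [vecDiv_congr h6, vecDiv_mul (hd.contDiff_a j) (hχd.fun_mul (hGd.fun_mul hrd))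
      (hψ.differentiable (by simp) z), dbar_mul hχd (hGd.fun_mul hrd), dbar_mul hGd hrd,
      hd.dbar_cornerCutoff hzU hj, hd.dual z hzU j hj j hj, if_pos rfl]
    simp only [hQ, hP]
    push_cast
    linear_combination (-(h z) * cornerCutoff S r m z * ψ z) * hGk z hzU
  obtain ⟨C1, hC1⟩ := exists_abs_mul_deriv_edgeCutoff_le
  obtain ⟨C2, hC2⟩ := hK.exists_bound_of_continuousOn hψ.continuous.continuousOn
  obtain ⟨C3, hC3⟩ := hK.exists_bound_of_continuousOn hPc.continuousOn
  have hmeas : MeasurableSet (W ∩ tsupport ψ) := hW.measurableSet.inter hK.measurableSet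
  have hfin : volume (W ∩ tsupport ψ) ≠ ⊤ :=
    ((measure_mono inter_subset_right).trans_lt hK.measure_lt_top).ne
  have hcont : ∀ R : Cn n → ℂ, Continuous R →
      AEStronglyMeasurable (fun z => h z * ((G z : ℂ) * R z))
        (volume.restrict (W ∩ tsupport ψ)) := fun R hR =>
    (((hh.continuousOn.mono (inter_subset_inter_right W hψO)).mul
      (hGc.continuous.mul hR).continuousOn).aestronglyMeasurable hmeas)
  -- Dominated convergence: `h G` is bounded by hypothesis and `t η'(t)` is bounded. At a fixed
  -- point of `W` the cutoff is eventually `1` and its derivative eventually `0`.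
  have hlim : Tendsto (fun m => ∫ z in W ∩ tsupport ψ, h z * ((G z : ℂ) * Q m z)) atTop
      (𝓝 (∫ z in W ∩ tsupport ψ, h z * ((G z : ℂ) * P z))) := by
    refine tendsto_integral_of_dominated_convergence
      (fun _ => C * (C1 * C2 + C3)) (fun m => hcont _ (hQc m))
      (integrableOn_const hfin) (fun m => (ae_restrict_iff' hmeas).2
        (Eventually.of_forall fun z hz => ?_))
      ((ae_restrict_iff' hmeas).2 (Eventually.of_forall fun z hz => ?_))
    · rw [← mul_assoc, norm_mul]
      have hC0 : 0 ≤ C := (norm_nonneg _).trans (hC z hz)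
      have hC10 : 0 ≤ C1 := (abs_nonneg _).trans (hC1 0)
      refine mul_le_mul (hC z hz) ((norm_add_le _ _).trans (add_le_add ?_ ?_)) (norm_nonneg _) hC0
      · rw [norm_mul, norm_mul, Complex.norm_real]
        refine mul_le_mul ?_ (hC2 z hz.2) (norm_nonneg _) hC10
        calc _ ≤ C1 * 1 := mul_le_mul (hC1 _) (norm_cornerCutoff_le_one _ _ _ _)
              (norm_nonneg _) hC10
          _ = C1 := mul_one _
      · rw [norm_mul]
        calc _ ≤ 1 * C3 := mul_le_mul (norm_cornerCutoff_le_one _ _ _ _) (hC3 z hz.2)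
              (norm_nonneg _) zero_le_one
          _ = C3 := one_mul _
    · have hneg := (hd.mem_iff z (hψU hz.2)).1 hz.1
      refine tendsto_const_nhds.congr' ?_
      filter_upwards [eventually_cornerCutoff_eq_one hneg,
        eventually_mul_le_neg_two (hneg j hj)] with m hm hm'
      simp [hQ, hm, deriv_edgeCutoff_eq_zero_of_lt hm']
  have hfinal : ∫ z in W ∩ tsupport ψ, h z * ((G z : ℂ) * P z) = 0 := by
    refine tendsto_nhds_unique hlim ?_
    simp only [hzero]
    exact tendsto_const_nhds
  have hi : ∀ R : Cn n → ℂ, Continuous R →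
      IntegrableOn (fun z => h z * ((G z : ℂ) * R z)) (W ∩ tsupport ψ) := fun R hR => by
    obtain ⟨C4, hC4⟩ := hK.exists_bound_of_continuousOn hR.continuousOn
    refine integrableOn_mul_of_bound (C := C * C4) hW hh.continuousOn hK hψO
      (hGc.continuous.mul hR) fun z hz => ?_
    rw [← mul_assoc, norm_mul]
    exact mul_le_mul (hC z hz) (hC4 z hz.2) (norm_nonneg _) ((norm_nonneg _).trans (hC z hz))
  rw [setIntegral_eq_inter_tsupport (ψ := ψ) (Q := fun z => (G z : ℂ) * r j z * vecDiv (a j) ψ z) hW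
      fun z hz => by simp [hvψ0 z hz],
    setIntegral_eq_inter_tsupport (ψ := ψ) (Q := fun z => (G z : ℂ) * ψ z) hW
      fun z hz => by simp [hψ0 z hz]]
  have hsplit : ∀ z, h z * ((G z : ℂ) * P z) = (k + 1 : ℂ) * (h z * ((G z : ℂ) * ψ z)) +
      h z * ((G z : ℂ) * (r j z * vecDiv (a j) ψ z)) := fun z => by
    simp only [hP]
    ring
  simp_rw [hsplit] at hfinal
  rw [integral_add ((hi ψ hψ.continuous).const_mul _) (hi (fun z => r j z * vecDiv (a j) ψ z)
      (hrj.continuous.mul hvψ.continuous)),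
    integral_const_mul] at hfinal
  simp_rw [mul_assoc] at hfinal ⊢
  linear_combination hfinal

end Corner

/-! ### Iteration over the faces of the corner, and independence of the order of regularization -/

section BellOperator

variable {n N : ℕ} {U W : Set (Cn n)} {S : Finset (Fin N)} {r : Fin N → Cn n → ℝ}
  {a : Fin N → Cn n → Cn n}

/-- The product of the defining functions `r j`, `j ∈ T`. -/
def cornerWeight (T : Finset (Fin N)) (r : Fin N → Cn n → ℝ) (z : Cn n) : ℝ := ∏ j ∈ T, r j z

theorem contDiff_cornerWeight (T : Finset (Fin N)) (hr : ∀ j, ContDiff ℝ ∞ (r j)) :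
    ContDiff ℝ ∞ (cornerWeight T r) :=
  contDiff_prod fun i _ => hr i

/-- The composition of the divergence operators along the fields `a j`, `j ∈ l`. -/
def cornerOp (a : Fin N → Cn n → Cn n) (l : List (Fin N)) (ψ : Cn n → ℂ) : Cn n → ℂ :=
  l.foldr (fun j φ => vecDiv (a j) φ) ψ

theorem contDiff_cornerOp (ha : ∀ j, ContDiff ℝ ∞ (a j)) (l : List (Fin N)) {ψ : Cn n → ℂ}
    (hψ : ContDiff ℝ ∞ ψ) : ContDiff ℝ ∞ (cornerOp a l ψ) := by
  induction l with
  | nil => exact hψ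
  | cons j l ih => exact contDiff_vecDiv (ha j) ih

theorem tsupport_cornerOp_subset (a : Fin N → Cn n → Cn n) (l : List (Fin N)) (ψ : Cn n → ℂ) :
    tsupport (cornerOp a l ψ) ⊆ tsupport ψ := by
  induction l with
  | nil => exact Subset.rfl
  | cons j l ih => exact (tsupport_vecDiv_subset _ _).trans ih

theorem contDiff_iterate_cornerOp (ha : ∀ j, ContDiff ℝ ∞ (a j)) (l : List (Fin N)) (k : ℕ)
    {ψ : Cn n → ℂ} (hψ : ContDiff ℝ ∞ ψ) : ContDiff ℝ ∞ ((cornerOp a l)^[k] ψ) := by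
  induction k with
  | zero => exact hψ
  | succ k ih =>
    rw [Function.iterate_succ_apply']
    exact contDiff_cornerOp ha l ih

theorem tsupport_iterate_cornerOp_subset (a : Fin N → Cn n → Cn n) (l : List (Fin N)) (k : ℕ)
    (ψ : Cn n → ℂ) : tsupport ((cornerOp a l)^[k] ψ) ⊆ tsupport ψ := by
  induction k with
  | zero => exact Subset.rfl
  | succ k ih =>
    rw [Function.iterate_succ_apply']
    exact (tsupport_cornerOp_subset a l _).trans ih

theorem IsCornerFrame.dbar_cornerWeight_of_notMem (hd : IsCornerFrame U W S r a) {z : Cn n}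
    (hz : z ∈ U) {j : Fin N} (hj : j ∈ S) {T : Finset (Fin N)} (hT : T ⊆ S) (hjT : j ∉ T) :
    dbar (fun y => (cornerWeight T r y : ℂ)) z (a j z) = 0 := by
  have h1 : (fun y => (cornerWeight T r y : ℂ)) = fun y => ∏ i ∈ T, (r i y : ℂ) := by
    funext y
    simp [cornerWeight]
  rw [h1]
  refine dbar_prod_eq_zero T
    (fun i _ => (contDiff_ofReal_comp (hd.contDiff_r i)).differentiable (by simp) z) fun i hi => ?_
  rw [hd.dual z hz i (hT hi) j hj, if_neg (ne_of_mem_of_not_mem hi hjT)]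

/-- Euler's identity: along `a j` the weight is homogeneous of degree `k` in `r j`, since `T` omits
`j`. This is the hypothesis on `G` in `IsCornerFrame.integral_mul_vecDiv`. -/
theorem IsCornerFrame.mul_dbar_pow_cornerWeight (hd : IsCornerFrame U W S r a) {z : Cn n}
    (hz : z ∈ U) {j : Fin N} (hj : j ∈ S) {T : Finset (Fin N)} (hT : T ⊆ S) (hjT : j ∉ T) (k : ℕ) :
    (r j z : ℂ) * dbar (fun y => ((cornerWeight S r y ^ k * cornerWeight T r y : ℝ) : ℂ)) z (a j z) =
      k * ((cornerWeight S r z ^ k * cornerWeight T r z : ℝ) : ℂ) := by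
  have hsm : ∀ T : Finset (Fin N), Differentiable ℝ fun y => (cornerWeight T r y : ℂ) := fun T =>
    (contDiff_ofReal_comp (contDiff_cornerWeight T hd.contDiff_r)).differentiable (by simp)
  have hrd : DifferentiableAt ℝ (fun y => (r j y : ℂ)) z :=
    (contDiff_ofReal_comp (hd.contDiff_r j)).differentiable (by simp) z
  have hS : ∀ y, cornerWeight S r y = r j y * cornerWeight (S.erase j) r y := fun y =>
    (Finset.mul_prod_erase S (fun i => r i y) hj).symm
  have h1 : dbar (fun y => (cornerWeight S r y : ℂ)) z (a j z) = cornerWeight (S.erase j) r z := by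
    have : (fun y => (cornerWeight S r y : ℂ)) =
        fun y => (r j y : ℂ) * (cornerWeight (S.erase j) r y : ℂ) := by
      funext y
      rw [hS y]
      push_cast
      rfl
    rw [this, dbar_mul hrd (hsm _ z), hd.dbar_cornerWeight_of_notMem hz hj (Finset.erase_subset j S)
      (Finset.notMem_erase j S), hd.dual z hz j hj j hj]
    simp
  have h2 : dbar (fun y => ((cornerWeight S r y ^ k : ℝ) : ℂ)) z (a j z) =
      ((k * cornerWeight S r z ^ (k - 1) : ℝ) : ℂ) * cornerWeight (S.erase j) r z := by
    rw [dbar_ofReal_comp (η := fun t => t ^ k) (q := cornerWeight S r)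
      (differentiable_pow k _)
      ((contDiff_cornerWeight S hd.contDiff_r).differentiable (by simp) z), h1]
    simp
  have h3 : (fun y => ((cornerWeight S r y ^ k * cornerWeight T r y : ℝ) : ℂ)) =
      fun y => ((cornerWeight S r y ^ k : ℝ) : ℂ) * (cornerWeight T r y : ℂ) := by
    funext y
    push_cast
    rfl
  have h4 : DifferentiableAt ℝ (fun y => ((cornerWeight S r y ^ k : ℝ) : ℂ)) z :=
    (contDiff_ofReal_comp ((contDiff_cornerWeight S hd.contDiff_r).pow k)).differentiable (by simp) z
  rw [h3, dbar_mul h4 (hsm T z), hd.dbar_cornerWeight_of_notMem hz hj hT hjT, h2, mul_zero, add_zero]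
  rcases k with _ | k
  · simp
  · rw [hS z]
    push_cast
    ring

/-- One integration by parts for each index. The weight of the indices already treated does not
involve the next `r j`, so every step contributes the same factor `-(k + 1)`. -/
theorem IsCornerFrame.integral_mul_cornerOp (hd : IsCornerFrame U W S r a)
    {h ψ : Cn n → ℂ} {O : Set (Cn n)} (hO : IsOpen O) (hh : DifferentiableOn ℂ h (W ∩ O))
    (hψ : ContDiff ℝ ∞ ψ) (hψc : HasCompactSupport ψ) (hψU : tsupport ψ ⊆ U)
    (hψO : tsupport ψ ⊆ O) {k : ℕ} {C : ℝ}
    (hC : ∀ z ∈ W ∩ tsupport ψ, ‖h z‖ * |cornerWeight S r z| ^ k ≤ C)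
    (l : List (Fin N)) (hl : l.Nodup) (hlS : l.toFinset ⊆ S) :
    ∫ z in W, h z * (((cornerWeight S r z ^ k * cornerWeight l.toFinset r z : ℝ) : ℂ) *
        cornerOp a l ψ z) =
      (-(k + 1 : ℂ)) ^ l.length * ∫ z in W, h z * (((cornerWeight S r z ^ k : ℝ) : ℂ) * ψ z) := by
  induction l with
  | nil => simp [cornerWeight, cornerOp]
  | cons j l ih =>
    rw [List.nodup_cons] at hl
    rw [List.toFinset_cons] at hlS
    have hj : j ∈ S := hlS (Finset.mem_insert_self _ _)
    have hlS' : l.toFinset ⊆ S := (Finset.subset_insert _ _).trans hlS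
    have hjl : j ∉ l.toFinset := by simpa using hl.1
    have hts := tsupport_cornerOp_subset a l ψ
    obtain ⟨C', hC'⟩ := hψc.isCompact.exists_bound_of_continuousOn
      (contDiff_cornerWeight l.toFinset hd.contDiff_r).continuous.continuousOn
    -- The weight `G` is `R^k` times the product over the indices already treated; boundedness of `h
    -- G` follows from that of `h R^k`, because the extra factor is bounded on the compact support.
    have hstep := hd.integral_mul_vecDiv hj hO hh (contDiff_cornerOp hd.contDiff_a l hψ)
      (hψc.of_isClosed_subset (isClosed_tsupport _) hts) (hts.trans hψU) (hts.trans hψO)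
      (((contDiff_cornerWeight S hd.contDiff_r).pow k).mul
        (contDiff_cornerWeight l.toFinset hd.contDiff_r)) (k := k)
      (fun z hz => hd.mul_dbar_pow_cornerWeight hz hj hlS' hjl k) (C := C * C')
      (fun z hz => by
        rw [Complex.ofReal_mul, ← mul_assoc, norm_mul, norm_mul, Complex.norm_real,
          Complex.norm_real, norm_pow]
        exact mul_le_mul (hC z ⟨hz.1, hts hz.2⟩) (hC' z (hts hz.2)) (norm_nonneg _)
          ((by positivity : 0 ≤ ‖h z‖ * |cornerWeight S r z| ^ k).trans
            (hC z ⟨hz.1, hts hz.2⟩)))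
    rw [ih hl.2 hlS'] at hstep
    rw [List.length_cons, pow_succ', mul_assoc, ← hstep]
    refine setIntegral_congr_fun hd.isOpen_domain.measurableSet fun z _ => ?_
    have : cornerWeight (j :: l).toFinset r z = r j z * cornerWeight l.toFinset r z := by
      rw [List.toFinset_cons, cornerWeight, Finset.prod_insert hjl, cornerWeight]
    simp only [this, cornerOp, List.foldr_cons]
    push_cast
    ring

/-- The normalizing constants of Bell's operators. -/
def bellConst (s k : ℕ) : ℂ := ∏ m ∈ Finset.range k, (-(m + 1 : ℂ)) ^ s

theorem bellConst_ne_zero (s k : ℕ) : bellConst s k ≠ 0 :=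
  Finset.prod_ne_zero_iff.2 fun m _ => pow_ne_zero _ (neg_ne_zero.2 (Nat.cast_add_one_ne_zero m))

/-- The pairing of `h` with `ψ` over the corner `W`, regularized by `k` applications of Bell's
operator. For bounded holomorphic `h` it is `∫_W h ψ`. -/
def bellPairing (W : Set (Cn n)) (S : Finset (Fin N)) (r : Fin N → Cn n → ℝ)
    (a : Fin N → Cn n → Cn n) (k : ℕ) (h ψ : Cn n → ℂ) : ℂ :=
  (bellConst S.card k)⁻¹ *
    ∫ z in W, h z * (((cornerWeight S r z ^ k : ℝ) : ℂ) * (cornerOp a S.toList)^[k] ψ z)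

theorem bellPairing_zero (W : Set (Cn n)) (S : Finset (Fin N)) (r : Fin N → Cn n → ℝ)
    (a : Fin N → Cn n → Cn n) (h ψ : Cn n → ℂ) :
    bellPairing W S r a 0 h ψ = ∫ z in W, h z * ψ z := by
  simp [bellPairing, bellConst]

/-- The integration by parts over all of `S`, applied to the `k`-th iterate; the new normalizing
factor cancels the powers of `-(k + 1)`. Only `h R^k` has to be bounded, so the identity is
available as soon as the order `k` integral converges for reasons of size. -/
theorem IsCornerFrame.bellPairing_succ (hd : IsCornerFrame U W S r a)
    {h ψ : Cn n → ℂ} {O : Set (Cn n)} (hO : IsOpen O) (hh : DifferentiableOn ℂ h (W ∩ O))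
    (hψ : ContDiff ℝ ∞ ψ) (hψc : HasCompactSupport ψ) (hψU : tsupport ψ ⊆ U)
    (hψO : tsupport ψ ⊆ O) {k : ℕ} {C : ℝ}
    (hC : ∀ z ∈ W ∩ tsupport ψ, ‖h z‖ * |cornerWeight S r z| ^ k ≤ C) :
    bellPairing W S r a (k + 1) h ψ = bellPairing W S r a k h ψ := by
  have hts := tsupport_iterate_cornerOp_subset a S.toList k ψ
  have h1 := hd.integral_mul_cornerOp hO hh
    (contDiff_iterate_cornerOp hd.contDiff_a S.toList k hψ)
    (hψc.of_isClosed_subset (isClosed_tsupport _) hts) (hts.trans hψU) (hts.trans hψO) (k := k)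
    (C := C) (fun z hz => hC z ⟨hz.1, hts hz.2⟩) S.toList S.nodup_toList (by simp)
  simp only [Finset.toList_toFinset, Finset.length_toList, ← pow_succ,
    ← Function.iterate_succ_apply' (cornerOp a S.toList)] at h1
  rw [bellPairing, bellPairing, h1, bellConst, Finset.prod_range_succ, ← bellConst]
  have h2 : (-(k + 1 : ℂ)) ^ S.card ≠ 0 :=
    pow_ne_zero _ (neg_ne_zero.2 (Nat.cast_add_one_ne_zero k))
  field_simp [bellConst_ne_zero S.card k]

/-- This serves twice: the extension does not depend on the order used to define it, and for `k = 0`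
the regularized pairing of a bounded function is its integral. -/
theorem IsCornerFrame.bellPairing_eq (hd : IsCornerFrame U W S r a)
    {h ψ : Cn n → ℂ} {O : Set (Cn n)} (hO : IsOpen O) (hh : DifferentiableOn ℂ h (W ∩ O))
    (hψ : ContDiff ℝ ∞ ψ) (hψc : HasCompactSupport ψ) (hψU : tsupport ψ ⊆ U)
    (hψO : tsupport ψ ⊆ O) {k l : ℕ} (hkl : k ≤ l) {C : ℝ}
    (hC : ∀ z ∈ W ∩ tsupport ψ, ‖h z‖ * |cornerWeight S r z| ^ k ≤ C) :
    bellPairing W S r a l h ψ = bellPairing W S r a k h ψ := by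
  have hw : ∃ B, ∀ z ∈ tsupport ψ, |cornerWeight S r z| ≤ B :=
    hψc.isCompact.exists_bound_of_continuousOn
      (contDiff_cornerWeight S hd.contDiff_r).continuous.continuousOn
  obtain ⟨B, hB⟩ := hw
  have hb : ∀ l, k ≤ l → ∃ C, ∀ z ∈ W ∩ tsupport ψ, ‖h z‖ * |cornerWeight S r z| ^ l ≤ C := by
    intro l hl
    induction l, hl using Nat.le_induction with
    | base => exact ⟨C, hC⟩
    | succ l _ ih =>
      obtain ⟨C, hC⟩ := ih
      refine ⟨C * B, fun z hz => ?_⟩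
      rw [pow_succ, ← mul_assoc]
      exact mul_le_mul (hC z hz) (hB z hz.2) (abs_nonneg _)
        ((by positivity : 0 ≤ ‖h z‖ * |cornerWeight S r z| ^ l).trans (hC z hz))
  induction l, hkl using Nat.le_induction with
  | base => rfl
  | succ l hl ih =>
    obtain ⟨C', hC'⟩ := hb l hl
    rw [hd.bellPairing_succ hO hh hψ hψc hψU hψO hC', ih]

end BellOperator

/-! ### Construction of corner frames from linear independence at one point -/

section FrameExistence

variable {n N : ℕ}

theorem contDiffAt_matrix_det {ι : Type*} [Fintype ι] [DecidableEq ι] {A : Cn n → Matrix ι ι ℂ}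
    {p : Cn n} (hA : ∀ i j, ContDiffAt ℝ ∞ (fun z => A z i j) p) :
    ContDiffAt ℝ ∞ (fun z => (A z).det) p := by
  simp only [Matrix.det_apply, Units.smul_def, zsmul_eq_mul]
  exact ContDiffAt.sum fun σ _ => contDiffAt_const.mul (contDiffAt_prod fun i _ => hA _ _)

/-- Cramer's rule: the entries of the inverse are quotients of polynomials in the entries. -/
theorem contDiffAt_matrix_inv {ι : Type*} [Fintype ι] [DecidableEq ι] {A : Cn n → Matrix ι ι ℂ}
    {p : Cn n} (hA : ∀ i j, ContDiffAt ℝ ∞ (fun z => A z i j) p) (hp : (A p).det ≠ 0) (i j : ι) :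
    ContDiffAt ℝ ∞ (fun z => (A z)⁻¹ i j) p := by
  have h1 : ∀ z, (A z)⁻¹ i j = (A z).det⁻¹ * (A z).adjugate i j := fun z => by
    rw [Matrix.inv_def, Ring.inverse_eq_inv', Matrix.smul_apply, smul_eq_mul]
  simp only [h1]
  refine ((contDiffAt_matrix_det hA).inv hp).mul ?_
  simp only [Matrix.adjugate_apply]
  refine contDiffAt_matrix_det fun k l => ?_
  by_cases hk : k = j
  · subst hk
    simp only [Matrix.updateRow_self]
    exact contDiffAt_const
  · simp only [Matrix.updateRow_ne hk]
    exact hA k l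

/-- Multiplication by a bump function. Corner frames consist of globally smooth data whose relations
hold only on `U`. -/
theorem exists_contDiff_eventuallyEq {F : Type*} [NormedAddCommGroup F] [NormedSpace ℝ F]
    {f : Cn n → F} {O : Set (Cn n)} {p : Cn n} (hO : IsOpen O) (hp : p ∈ O)
    (hf : ContDiffOn ℝ ∞ f O) : ∃ g : Cn n → F, ContDiff ℝ ∞ g ∧ g =ᶠ[𝓝 p] f := by
  obtain ⟨δ, hδ, hδO⟩ := Metric.nhds_basis_closedBall.mem_iff.1 (hO.mem_nhds hp)
  let b : ContDiffBump p := ⟨δ / 2, δ, half_pos hδ, half_lt_self hδ⟩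
  refine ⟨fun z => b z • f z, contDiff_iff_contDiffAt.2 fun z => ?_, ?_⟩
  · by_cases hz : z ∈ Metric.closedBall p δ
    · exact b.contDiff.contDiffAt.smul (hf.contDiffAt (hO.mem_nhds (hδO hz)))
    · have : ∀ᶠ y in 𝓝 z, b y • f y = 0 := by
        filter_upwards [Metric.isClosed_closedBall.isOpen_compl.mem_nhds hz] with y hy
        rw [b.zero_of_le_dist (le_of_lt (not_le.1 hy)), zero_smul]
      exact contDiffAt_const.congr_of_eventuallyEq this
  · filter_upwards [b.eventuallyEq_one] with z hz
    rw [hz]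
    exact one_smul ℝ _

theorem dbar_ofReal_eq {q : Cn n → ℝ} {z : Cn n} (hq : DifferentiableAt ℝ q z) (w : Cn n) :
    dbar (fun y => (q y : ℂ)) z w =
      (fderiv ℝ q z w : ℂ) + Complex.I * (fderiv ℝ q z (Complex.I • w) : ℂ) := by
  have h2 : fderiv ℝ (fun y => (q y : ℂ)) z = Complex.ofRealCLM.comp (fderiv ℝ q z) :=
    (Complex.ofRealCLM.hasFDerivAt.comp z hq.hasFDerivAt).fderiv
  simp [dbar, h2]

/-- A family of real functions with vectors dual to their `∂̄`-differentials at `p` extends to a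
corner frame near `p`. -/
theorem exists_isCornerFrame {S : Finset (Fin N)} {ρ : Fin N → Cn n → ℝ} {O W : Set (Cn n)}
    {p : Cn n} (hO : IsOpen O) (hp : p ∈ O) (hW : IsOpen W)
    (hρ : ∀ j ∈ S, ContDiffOn ℝ ∞ (ρ j) O)
    (hmem : ∀ z ∈ O, (z ∈ W ↔ ∀ j ∈ S, ρ j z < 0))
    {B : Fin N → Cn n}
    (hB : ∀ i ∈ S, ∀ j ∈ S, dbar (fun y => (ρ i y : ℂ)) p (B j) = if i = j then 1 else 0) :
    ∃ (U : Set (Cn n)) (r : Fin N → Cn n → ℝ) (a : Fin N → Cn n → Cn n),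
      IsCornerFrame U W S r a ∧ p ∈ U ∧ U ⊆ O ∧ ∀ j ∈ S, EqOn (r j) (ρ j) U := by
  have hg : ∀ j, ∃ g : Cn n → ℝ, ContDiff ℝ ∞ g ∧ (j ∈ S → g =ᶠ[𝓝 p] ρ j) := fun j => by
    by_cases hj : j ∈ S
    · obtain ⟨g, h1, h2⟩ := exists_contDiff_eventuallyEq hO hp (hρ j hj)
      exact ⟨g, h1, fun _ => h2⟩
    · exact ⟨fun _ => 0, contDiff_const, fun h => absurd h hj⟩
  choose r hr hrρ using hg
  -- The constant fields `B j` are dual only at `p`. Their matrix against the `∂̄r_i` is the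
  -- identity at `p`, hence invertible nearby.
  let A : Cn n → Matrix S S ℂ := fun z i j => dbar (fun y => (r i y : ℂ)) z (B j)
  have hA : ∀ i j, ContDiff ℝ ∞ (fun z => A z i j) := fun i j =>
    contDiff_dbar (contDiff_ofReal_comp (hr i)) (B j)
  have hAp : A p = 1 := by
    ext i j
    have h1 : (fun y => (r i y : ℂ)) =ᶠ[𝓝 p] fun y => (ρ i y : ℂ) :=
      (hrρ i i.2).mono fun y hy => by simp only [hy]
    simp only [A]
    rw [dbar_congr h1, hB i i.2 j j.2, Matrix.one_apply]
    simp only [Subtype.ext_iff]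
  have hdet : ∀ᶠ z in 𝓝 p, (A z).det ≠ 0 :=
    ((contDiffAt_matrix_det fun i j => (hA i j).contDiffAt).continuousAt).eventually_ne
      (by simp [hAp])
  obtain ⟨V, hV, hVo, hpV⟩ := eventually_nhds_iff.1 hdet
  -- The dual fields are combinations of the `B k` with the columns of `A⁻¹` as coefficients,
  -- conjugated because `dbar` is antilinear in the vector.
  have ha : ∀ j : Fin N, ∃ a : Cn n → Cn n, ContDiff ℝ ∞ a ∧
      ∀ hj : j ∈ S, a =ᶠ[𝓝 p] fun z => ∑ k : S, (starRingEnd ℂ) ((A z)⁻¹ k ⟨j, hj⟩) • B k := by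
    intro j
    by_cases hj : j ∈ S
    · have : ContDiffOn ℝ ∞
          (fun z => ∑ k : S, (starRingEnd ℂ) ((A z)⁻¹ k ⟨j, hj⟩) • B k) V := fun z hz => by
        refine ContDiffAt.contDiffWithinAt (ContDiffAt.sum fun k _ => ?_)
        exact ((Complex.conjCLE : ℂ ≃L[ℝ] ℂ).contDiff.contDiffAt.comp z
          (contDiffAt_matrix_inv (fun i j => (hA i j).contDiffAt) (hV z hz) _ _)).smul
            contDiffAt_const
      obtain ⟨g, h1, h2⟩ := exists_contDiff_eventuallyEq hVo hpV this
      exact ⟨g, h1, fun _ => h2⟩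
    · exact ⟨fun _ => 0, contDiff_const, fun h => absurd h hj⟩
  choose a ha haA using ha
  have hev : ∀ᶠ z in 𝓝 p, z ∈ O ∧ z ∈ V ∧ (∀ j ∈ S, r j z = ρ j z) ∧
      ∀ j, ∀ hj : j ∈ S, a j z = ∑ k : S, (starRingEnd ℂ) ((A z)⁻¹ k ⟨j, hj⟩) • B k := by
    refine Eventually.and (hO.mem_nhds hp) (Eventually.and (hVo.mem_nhds hpV) (Eventually.and ?_ ?_))
    · exact (Finset.eventually_all S).2 fun j hj => hrρ j hj
    · refine eventually_all.2 fun j => ?_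
      by_cases hj : j ∈ S
      · exact (haA j hj).mono fun z hz _ => hz
      · exact Eventually.of_forall fun z h => absurd h hj
  obtain ⟨U, hU, hUo, hpU⟩ := eventually_nhds_iff.1 hev
  refine ⟨U, r, a, ⟨hUo, hW, hr, ha, ?_, ?_⟩, hpU, fun z hz => (hU z hz).1,
    fun j hj z hz => (hU z hz).2.2.1 j hj⟩
  · intro z hz i hi j hj
    obtain ⟨-, hzV, -, hza⟩ := hU z hz
    have hinv : A z * (A z)⁻¹ = 1 := Matrix.mul_nonsing_inv _ (Ne.isUnit (hV z hzV))
    have hsum : ∀ s : Finset S, dbar (fun y => (r i y : ℂ)) z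
        (∑ k ∈ s, (starRingEnd ℂ) ((A z)⁻¹ k ⟨j, hj⟩) • B k) =
        ∑ k ∈ s, A z ⟨i, hi⟩ k * (A z)⁻¹ k ⟨j, hj⟩ := by
      intro s
      induction s using Finset.induction_on with
      | empty => simp [dbar_zero_right]
      | insert k s hk ih =>
        rw [Finset.sum_insert hk, Finset.sum_insert hk, dbar_add_right, ih, dbar_smul_right,
          Complex.conj_conj, mul_comm]
    rw [hza j hj, hsum, ← Matrix.mul_apply, hinv, Matrix.one_apply]
    simp only [Subtype.mk.injEq]
  · intro z hz
    obtain ⟨hzO, -, hzr, -⟩ := hU z hz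
    rw [hmem z hzO]
    exact forall₂_congr fun j hj => by rw [hzr j hj]

/-- Real functionals whose largest common complex kernel has the minimal dimension admit a dual
family of vectors. -/
theorem exists_dual_vectors {S : Finset (Fin N)} (L : Fin N → Cn n →L[ℝ] ℝ) (V : Submodule ℂ (Cn n))
    (hV : ∀ w, (∀ j ∈ S, L j w = 0 ∧ L j (Complex.I • w) = 0) → w ∈ V)
    (hdim : Module.finrank ℂ V + S.card = n) :
    ∃ B : Fin N → Cn n, ∀ i ∈ S, ∀ j ∈ S,
      L i (B j) = (if i = j then 1 else 0) ∧ L i (Complex.I • B j) = 0 := by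
  -- Each real functional `L i` is the real part of the complex functional `w ↦ L i w - i L i (i
  -- w)`. The common kernel of these is the common complex kernel of the `L i`.
  let Λ : Cn n →ₗ[ℂ] (S → ℂ) :=
    LinearMap.pi fun i => Module.Dual.extendRCLike (𝕜 := ℂ) (L i : Cn n →ₗ[ℝ] ℝ)
  have hΛ : ∀ w i, Λ w i = (L i w : ℂ) - Complex.I * (L i (Complex.I • w) : ℂ) := fun w i => by
    simp [Λ, Module.Dual.extendRCLike_apply]
  have hker : LinearMap.ker Λ ≤ V := fun w hw => hV w fun j hj => by
    have h1 : Λ w ⟨j, hj⟩ = 0 := by rw [LinearMap.mem_ker.1 hw]; rfl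
    rw [hΛ] at h1
    have h2 := congrArg Complex.re h1
    have h3 := congrArg Complex.im h1
    simp at h2 h3
    exact ⟨h2, h3⟩
  have h4 := Submodule.finrank_mono hker
  have h5 := LinearMap.finrank_range_add_finrank_ker Λ
  have h6 : Module.finrank ℂ (LinearMap.range Λ) ≤ Module.finrank ℂ (S → ℂ) :=
    Submodule.finrank_le _
  have h7 : Module.finrank ℂ (S → ℂ) = S.card := by simp
  have h8 : Module.finrank ℂ (Cn n) = n := by simp
  -- The kernel has dimension at most `n - |S|`, so the rank is at least `|S|`, the dimension of the
  -- target.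
  have hsurj : Function.Surjective Λ := by
    rw [← LinearMap.range_eq_top]
    apply Submodule.eq_top_of_finrank_eq
    omega
  choose g hg using fun j : S => hsurj (Pi.single j 1)
  refine ⟨fun j => if hj : j ∈ S then g ⟨j, hj⟩ else 0, fun i hi j hj => ?_⟩
  have h9 := congrFun (hg ⟨j, hj⟩) ⟨i, hi⟩
  rw [hΛ, Pi.single_apply] at h9
  simp only [hj, dif_pos]
  have h10 := congrArg Complex.re h9
  have h11 := congrArg Complex.im h9
  simp only [Subtype.mk.injEq] at h10 h11
  constructor
  · by_cases hij : i = j <;> simpa [hij] using h10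
  · by_cases hij : i = j <;> simpa [hij] using h11

end FrameExistence

/-! ### Pointwise bounds for differential operators -/

section JetBound

variable {n N : ℕ}

/-- The sum of the norms at `z` of the derivatives of `ψ` of order less than `M`. -/
def jetNorm (M : ℕ) (ψ : Cn n → ℂ) (z : Cn n) : ℝ :=
  ∑ i ∈ Finset.range M, ‖iteratedFDeriv ℝ i ψ z‖

theorem norm_iteratedFDeriv_le_jetNorm {i M : ℕ} (h : i < M) (ψ : Cn n → ℂ) (z : Cn n) :
    ‖iteratedFDeriv ℝ i ψ z‖ ≤ jetNorm M ψ z :=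
  Finset.single_le_sum (f := fun i => ‖iteratedFDeriv ℝ i ψ z‖) (fun _ _ => norm_nonneg _)
    (Finset.mem_range.2 h)

theorem jetNorm_mono {M M' : ℕ} (h : M ≤ M') (ψ : Cn n → ℂ) (z : Cn n) :
    jetNorm M ψ z ≤ jetNorm M' ψ z :=
  Finset.sum_le_sum_of_subset_of_nonneg (Finset.range_mono h) fun _ _ _ => norm_nonneg _

/-- On the functions satisfying `A`, the derivatives of `Q ψ` at the points of `K` are controlled by
those of `ψ` at the same point. -/
def HasJetBound (K : Set (Cn n)) (A : (Cn n → ℂ) → Prop) (Q : (Cn n → ℂ) → Cn n → ℂ) : Prop :=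
  ∀ m, ∃ M C, 0 ≤ C ∧ ∀ ψ, A ψ → ∀ z ∈ K, ‖iteratedFDeriv ℝ m (Q ψ) z‖ ≤ C * jetNorm M ψ z

variable {K : Set (Cn n)} {A : (Cn n → ℂ) → Prop}

theorem HasJetBound.jetNorm_le {Q : (Cn n → ℂ) → Cn n → ℂ} (hQ : HasJetBound K A Q) (m : ℕ) :
    ∃ M C, 0 ≤ C ∧ ∀ ψ, A ψ → ∀ z ∈ K, jetNorm m (Q ψ) z ≤ C * jetNorm M ψ z := by
  choose M C hC h using hQ
  refine ⟨∑ i ∈ Finset.range m, M i, ∑ i ∈ Finset.range m, C i,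
    Finset.sum_nonneg fun i _ => hC i, fun ψ hψ z hz => ?_⟩
  rw [jetNorm, Finset.sum_mul]
  refine Finset.sum_le_sum fun i hi => (h i ψ hψ z hz).trans ?_
  exact mul_le_mul_of_nonneg_left (jetNorm_mono
    (Finset.single_le_sum (f := M) (fun _ _ => Nat.zero_le _) hi) ψ z) (hC i)

theorem HasJetBound.comp {Q R : (Cn n → ℂ) → Cn n → ℂ} {A' : (Cn n → ℂ) → Prop}
    (hR : HasJetBound K A' R) (hQ : HasJetBound K A Q) (hAA' : ∀ ψ, A ψ → A' (Q ψ)) :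
    HasJetBound K A fun ψ => R (Q ψ) := by
  intro m
  obtain ⟨M, C, hC, h⟩ := hR m
  obtain ⟨M', C', hC', h'⟩ := hQ.jetNorm_le M
  refine ⟨M', C * C', mul_nonneg hC hC', fun ψ hψ z hz => (h _ (hAA' ψ hψ) z hz).trans ?_⟩
  rw [mul_assoc]
  exact mul_le_mul_of_nonneg_left (h' ψ hψ z hz) hC

theorem HasJetBound.id : HasJetBound K A fun ψ => ψ := fun m =>
  ⟨m + 1, 1, zero_le_one, fun ψ _ z _ => by
    rw [one_mul]
    exact norm_iteratedFDeriv_le_jetNorm (Nat.lt_succ_self m) ψ z⟩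

theorem HasJetBound.sum {ι : Type*} (s : Finset ι) {Q : ι → (Cn n → ℂ) → Cn n → ℂ}
    (hQ : ∀ i ∈ s, HasJetBound K A (Q i))
    (hs : ∀ i ∈ s, ∀ ψ, A ψ → ContDiff ℝ ∞ (Q i ψ)) :
    HasJetBound K A fun ψ z => ∑ i ∈ s, Q i ψ z := by
  intro m
  have h1 : ∀ i : s, ∃ M C, 0 ≤ C ∧ ∀ ψ, A ψ → ∀ z ∈ K,
      ‖iteratedFDeriv ℝ m (Q i ψ) z‖ ≤ C * jetNorm M ψ z := fun i => hQ i i.2 m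
  choose M C hC h using h1
  refine ⟨∑ i, M i, ∑ i, C i, Finset.sum_nonneg fun i _ => hC i, fun ψ hψ z hz => ?_⟩
  have h2 : iteratedFDeriv ℝ m (fun z => ∑ i ∈ s, Q i ψ z) =
      ∑ i ∈ s, iteratedFDeriv ℝ m (Q i ψ) := by
    exact iteratedFDeriv_sum fun i hi => (hs i hi ψ hψ).of_le (mod_cast le_top)
  rw [h2, Finset.sum_apply, ← Finset.sum_coe_sort s, Finset.sum_mul]
  refine (norm_sum_le _ _).trans (Finset.sum_le_sum fun i hi => (h i ψ hψ z hz).trans ?_)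
  exact mul_le_mul_of_nonneg_left (jetNorm_mono
    (Finset.single_le_sum (f := M) (fun _ _ => Nat.zero_le _) hi) ψ z) (hC i)

theorem hasJetBound_mul {T : Set (Cn n)} (hT : IsOpen T) (hK : IsCompact K) (hKT : K ⊆ T)
    {α : Cn n → ℂ} (hα : ContDiff ℝ ∞ α) :
    HasJetBound K (fun ψ => ContDiffOn ℝ ∞ ψ T) fun ψ z => α z * ψ z := by
  intro m
  have hb : ∀ i, ∃ B, ∀ z ∈ K, ‖iteratedFDeriv ℝ i α z‖ ≤ B := fun i =>
    hK.exists_bound_of_continuousOn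
      (hα.continuous_iteratedFDeriv (m := i) (mod_cast le_top)).continuousOn
  choose B hB using hb
  refine ⟨m + 1, ∑ i ∈ Finset.range (m + 1), (m.choose i : ℝ) * |B i|,
    Finset.sum_nonneg fun _ _ => by positivity, fun ψ hψ z hz => ?_⟩
  have hzT := hKT hz
  have h1 := norm_iteratedFDerivWithin_mul_le (n := m) hα.contDiffOn hψ hT.uniqueDiffOn hzT
    (mod_cast le_top)
  simp only [iteratedFDerivWithin_of_isOpen _ hT hzT] at h1
  refine h1.trans ?_
  rw [Finset.sum_mul]
  refine Finset.sum_le_sum fun i _ => ?_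
  refine mul_le_mul (mul_le_mul_of_nonneg_left ((hB i z hz).trans (le_abs_self _))
    (Nat.cast_nonneg _)) (norm_iteratedFDeriv_le_jetNorm (by omega) ψ z) (norm_nonneg _)
    (by positivity)

/-- The expression is one fixed continuous linear functional applied to `fderiv ℝ ψ`, so it costs a
single derivative. -/
theorem exists_norm_iteratedFDeriv_fderiv_add_le {V : Type*} [NormedAddCommGroup V]
    [NormedSpace ℝ V] (w w' : V) :
    ∃ C : ℝ, 0 ≤ C ∧ ∀ ψ : V → ℂ, ContDiff ℝ ∞ ψ → ∀ (m : ℕ) (z : V),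
      ‖iteratedFDeriv ℝ m (fun z => fderiv ℝ ψ z w + Complex.I * fderiv ℝ ψ z w') z‖ ≤
        C * ‖iteratedFDeriv ℝ (m + 1) ψ z‖ := by
  let ℓ : (V →L[ℝ] ℂ) →L[ℝ] ℂ := ContinuousLinearMap.apply ℝ ℂ w +
    Complex.I • ContinuousLinearMap.apply ℝ ℂ w'
  refine ⟨‖ℓ‖, ℓ.opNorm_nonneg, fun ψ hψ m z => ?_⟩
  have h1 : (fun z => fderiv ℝ ψ z w + Complex.I * fderiv ℝ ψ z w') = ℓ ∘ fderiv ℝ ψ := by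
    funext z
    simp [ℓ]
  have h2 : ContDiff ℝ ∞ (fderiv ℝ ψ) := hψ.fderiv_right (by simp)
  rw [h1, ← norm_iteratedFDeriv_fderiv]
  exact ℓ.norm_iteratedFDeriv_comp_left h2.contDiffAt (mod_cast le_top)

theorem hasJetBound_dbar (w : Cn n) :
    HasJetBound K (fun ψ => ContDiff ℝ ∞ ψ) fun ψ z => dbar ψ z w := by
  intro m
  obtain ⟨C, hC, h⟩ := exists_norm_iteratedFDeriv_fderiv_add_le w (Complex.I • w)
  exact ⟨m + 2, C, hC, fun ψ hψ z _ => (h ψ hψ m z).trans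
    (mul_le_mul_of_nonneg_left (norm_iteratedFDeriv_le_jetNorm (by omega) ψ z) hC)⟩

theorem hasJetBound_vecDiv (hK : IsCompact K) {a : Cn n → Cn n} (ha : ContDiff ℝ ∞ a) :
    HasJetBound K (fun ψ => ContDiff ℝ ∞ ψ) (vecDiv a) := by
  refine HasJetBound.sum Finset.univ
    (Q := fun m ψ z => dbar (fun y => (starRingEnd ℂ) (a y m) * ψ y) z (Pi.single m 1))
    (fun m _ => ?_) fun m _ ψ hψ => contDiff_dbar ((contDiff_conj_coord ha m).mul hψ) _
  refine HasJetBound.comp (A := fun ψ => ContDiff ℝ ∞ ψ) (A' := fun ψ => ContDiff ℝ ∞ ψ)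
    (R := fun ψ z => dbar ψ z (Pi.single m 1)) (Q := fun ψ y => (starRingEnd ℂ) (a y m) * ψ y) (hasJetBound_dbar _) ?_
    fun ψ hψ => (contDiff_conj_coord ha m).mul hψ
  intro k
  obtain ⟨M, C, hC, h⟩ := hasJetBound_mul isOpen_univ hK (subset_univ K)
    (contDiff_conj_coord ha m) k
  exact ⟨M, C, hC, fun ψ hψ => h ψ hψ.contDiffOn⟩

theorem hasJetBound_cornerOp (hK : IsCompact K) {a : Fin N → Cn n → Cn n}
    (ha : ∀ j, ContDiff ℝ ∞ (a j)) (l : List (Fin N)) :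
    HasJetBound K (fun ψ => ContDiff ℝ ∞ ψ) (cornerOp a l) := by
  induction l with
  | nil => exact HasJetBound.id
  | cons j l ih =>
    exact HasJetBound.comp (Q := cornerOp a l) (R := vecDiv (a j))
      (A' := fun ψ => ContDiff ℝ ∞ ψ) (hasJetBound_vecDiv hK (ha j)) ih fun ψ hψ => contDiff_cornerOp ha l hψ

theorem hasJetBound_iterate_cornerOp (hK : IsCompact K) {a : Fin N → Cn n → Cn n}
    (ha : ∀ j, ContDiff ℝ ∞ (a j)) (l : List (Fin N)) (k : ℕ) :
    HasJetBound K (fun ψ => ContDiff ℝ ∞ ψ) (cornerOp a l)^[k] := by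
  induction k with
  | zero => exact HasJetBound.id
  | succ k ih =>
    rw [Function.iterate_succ']
    exact HasJetBound.comp (Q := (cornerOp a l)^[k]) (R := cornerOp a l)
      (A' := fun ψ => ContDiff ℝ ∞ ψ) (hasJetBound_cornerOp hK ha l) ih
      fun ψ hψ => contDiff_iterate_cornerOp ha l k hψ

/-- A function which is smooth on `T`, multiplied by a smooth function with support in `T`, is
smooth. -/
theorem contDiff_mul_of_tsupport_subset {T : Set (Cn n)} (hT : IsOpen T) {α ψ : Cn n → ℂ}
    (hα : ContDiff ℝ ∞ α) (hαT : tsupport α ⊆ T) (hψ : ContDiffOn ℝ ∞ ψ T) :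
    ContDiff ℝ ∞ fun z => α z * ψ z := by
  refine contDiff_iff_contDiffAt.2 fun z => ?_
  by_cases hz : z ∈ tsupport α
  · exact hα.contDiffAt.mul (hψ.contDiffAt (hT.mem_nhds (hαT hz)))
  · refine contDiffAt_const (c := (0 : ℂ)).congr_of_eventuallyEq ?_
    exact (notMem_tsupport_iff_eventuallyEq.1 hz).mono fun y hy => by simp [hy]

/-- The bound is pointwise and involves only the jet of `ψ` at the same point of `tsupport α`. The
topology on test forms controls exactly such jets, uniformly on compact subsets of a chart. -/
theorem exists_norm_iterate_cornerOp_mul_le {T : Set (Cn n)} (hT : IsOpen T) {α : Cn n → ℂ}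
    (hα : ContDiff ℝ ∞ α) (hαc : HasCompactSupport α) (hαT : tsupport α ⊆ T)
    {a : Fin N → Cn n → Cn n} (ha : ∀ j, ContDiff ℝ ∞ (a j)) (l : List (Fin N)) (k : ℕ) :
    ∃ M C, 0 ≤ C ∧ ∀ ψ, ContDiffOn ℝ ∞ ψ T → ∀ z ∈ tsupport α,
      ‖(cornerOp a l)^[k] (fun y => α y * ψ y) z‖ ≤ C * jetNorm M ψ z := by
  obtain ⟨M, C, hC, h⟩ := HasJetBound.comp (R := (cornerOp a l)^[k])
    (Q := fun ψ z => α z * ψ z) (hasJetBound_iterate_cornerOp hαc.isCompact ha l k)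
    (hasJetBound_mul hT hαc.isCompact hαT hα)
    (fun ψ hψ => contDiff_mul_of_tsupport_subset hT hα hαT hψ) 0
  refine ⟨M, C, hC, fun ψ hψ z hz => ?_⟩
  simpa using h ψ hψ z hz

end JetBound

/-! ### Defining functions in holomorphic charts -/

section DefiningFunctions

variable {n : ℕ}

/-- Two functions with comparable sublevel sets have proportional differentials. -/
theorem exists_fderiv_eq_smul {V : Type*} [NormedAddCommGroup V] [NormedSpace ℝ V]
    {g g' : V → ℝ} {y : V} (hg : DifferentiableAt ℝ g y)
    (hg' : DifferentiableAt ℝ g' y) (h0 : g y = 0) (h0' : g' y = 0)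
    (hlt : ∀ᶠ z in 𝓝 y, g z < 0 → g' z < 0) (hne : fderiv ℝ g y ≠ 0) :
    ∃ c : ℝ, 0 ≤ c ∧ fderiv ℝ g' y = c • fderiv ℝ g y := by
  -- Along a direction in which `g` decreases to first order, `g` becomes negative, hence so does
  -- `g'`, and its slope cannot be positive.
  have key : ∀ w, fderiv ℝ g y w < 0 → fderiv ℝ g' y w ≤ 0 := by
    intro w hw
    have hline : HasDerivAt (fun t : ℝ => y + t • w) w 0 := by
      simpa using ((hasDerivAt_id (0 : ℝ)).smul_const w).const_add y
    have hy : y + (0 : ℝ) • w = y := by simp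
    have hd : ∀ f : V → ℝ, DifferentiableAt ℝ f y →
        HasDerivAt (fun t : ℝ => f (y + t • w)) (fderiv ℝ f y w) 0 := fun f hf => by
      have h1 : HasFDerivAt f (fderiv ℝ f y) (y + (0 : ℝ) • w) := by
        rw [hy]
        exact hf.hasFDerivAt
      exact h1.comp_hasDerivAt (0 : ℝ) hline
    have h1 := (hasDerivAt_iff_tendsto_slope.1 (hd g hg)).mono_left
      (nhdsWithin_mono (0 : ℝ) (fun t (ht : 0 < t) => ne_of_gt ht) : 𝓝[>] (0 : ℝ) ≤ _)
    have h2 := (hasDerivAt_iff_tendsto_slope.1 (hd g' hg')).mono_left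
      (nhdsWithin_mono (0 : ℝ) (fun t (ht : 0 < t) => ne_of_gt ht) : 𝓝[>] (0 : ℝ) ≤ _)
    have hcont : Tendsto (fun t : ℝ => y + t • w) (𝓝[>] 0) (𝓝 y) := by
      have h3 := hline.continuousAt.tendsto
      rw [hy] at h3
      exact h3.mono_left nhdsWithin_le_nhds
    refine le_of_tendsto h2 ?_
    filter_upwards [h1.eventually (eventually_lt_nhds hw), hcont.eventually hlt,
      self_mem_nhdsWithin] with t ht1 ht2 ht3
    have ht3 : 0 < t := ht3
    simp only [slope_def_field, hy, h0, h0', sub_zero] at ht1 ⊢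
    have h4 : g (y + t • w) < 0 := by
      by_contra h
      exact absurd ht1 (not_lt.2 (div_nonneg (not_lt.1 h) ht3.le))
    exact div_nonpos_of_nonpos_of_nonneg (ht2 h4).le ht3.le
  obtain ⟨u₀, hu₀⟩ : ∃ u, fderiv ℝ g y u ≠ 0 := by
    by_contra h
    push Not at h
    exact hne (ContinuousLinearMap.ext h)
  set u := (fderiv ℝ g y u₀)⁻¹ • u₀ with hu
  have hu1 : fderiv ℝ g y u = 1 := by
    rw [hu, map_smul, smul_eq_mul, inv_mul_cancel₀ hu₀]
  have hc : 0 ≤ fderiv ℝ g' y u := by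
    have := key (-u) (by rw [map_neg, hu1]; norm_num)
    rw [map_neg] at this
    linarith
  refine ⟨fderiv ℝ g' y u, hc, ContinuousLinearMap.ext fun w => ?_⟩
  have hker : ∀ w₀, fderiv ℝ g y w₀ = 0 → fderiv ℝ g' y w₀ ≤ 0 := by
    intro w₀ hw₀
    by_contra h
    push Not at h
    -- On this vector the differential of `g` is `-1` while that of `g'` is `+1`.
    have h1 := key (((fderiv ℝ g' y u + 1) / fderiv ℝ g' y w₀) • w₀ - u)
      (by rw [map_sub, map_smul, hw₀, hu1]; norm_num)
    rw [map_sub, map_smul, smul_eq_mul, div_mul_cancel₀ _ h.ne'] at h1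
    linarith
  have hw0 : fderiv ℝ g y (w - fderiv ℝ g y w • u) = 0 := by
    rw [map_sub, map_smul, hu1]
    simp
  have h1 := hker _ hw0
  have h2 := hker (-(w - fderiv ℝ g y w • u)) (by rw [map_neg, hw0, neg_zero])
  rw [map_neg] at h2
  have h3 : fderiv ℝ g' y (w - fderiv ℝ g y w • u) = 0 := by linarith
  rw [map_sub, map_smul, smul_eq_mul] at h3
  rw [smul_apply, smul_eq_mul]
  linarith

/-- The image of a set in the chart `e`. -/
def chartImage {n : ℕ} {M : Type*} [TopologicalSpace M] (e : OpenPartialHomeomorph M (Cn n))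
    (D : Set M) : Set (Cn n) :=
  e.target ∩ e.symm ⁻¹' D

theorem isOpen_chartImage {n : ℕ} {M : Type*} [TopologicalSpace M]
    (e : OpenPartialHomeomorph M (Cn n)) {D : Set M} (hD : IsOpen D) : IsOpen (chartImage e D) :=
  e.isOpen_inter_preimage_symm hD

variable {M : Type*} [TopologicalSpace M] [ChartedSpace (Cn n) M]

theorem IsLocalDefiningFunction.mdifferentiableAt {D : Set M} {p : M} {r : M → ℝ}
    (hr : IsLocalDefiningFunction (n := n) D p r) : MDifferentiableAt 𝓘(ℝ, Cn n) 𝓘(ℝ, ℝ) r p := by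
  obtain ⟨⟨U, hU, hpU, hrU, hD⟩, -⟩ := hr
  exact (hrU.mdifferentiableOn (by simp)).mdifferentiableAt (hU.mem_nhds hpU)

theorem IsLocalDefiningFunction.apply_eq_zero {D : Set M} {p : M} {r : M → ℝ}
    (hr : IsLocalDefiningFunction (n := n) D p r) (hD : IsOpen D) (hp : p ∈ frontier D) :
    r p = 0 := by
  obtain ⟨⟨U, hU, hpU, hrU, hiff⟩, -⟩ := hr
  have hcont : ContinuousAt r p := (hrU.continuousOn).continuousAt (hU.mem_nhds hpU)
  refine le_antisymm ?_ ?_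
  · by_contra h
    push Not at h
    obtain ⟨z, ⟨hz1, hz2⟩, hz3⟩ := mem_closure_iff_nhds.1 hp.1 _
      (Filter.inter_mem (hcont.eventually (eventually_gt_nhds h)) (hU.mem_nhds hpU))
    exact absurd ((hiff z hz2).1 hz3) (not_lt.2 (le_of_lt hz1))
  · rw [hD.frontier_eq] at hp
    exact not_lt.1 fun h => hp.2 ((hiff p hpU).2 h)

theorem HasMFDerivAt.restrictScalars_real {n n' : ℕ} {M M' : Type*} [TopologicalSpace M]
    [ChartedSpace (Cn n) M] [TopologicalSpace M'] [ChartedSpace (Cn n') M'] {f : M → M'} {x : M}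
    {f' : Cn n →L[ℂ] Cn n'} (h : HasMFDerivAt 𝓘(ℂ, Cn n) 𝓘(ℂ, Cn n') f x f') :
    HasMFDerivAt 𝓘(ℝ, Cn n) 𝓘(ℝ, Cn n') f x (f'.restrictScalars ℝ) :=
  ⟨h.1, HasFDerivWithinAt.restrictScalars ℝ h.2⟩

theorem holCharts_subset_real {e : OpenPartialHomeomorph M (Cn n)} (he : e ∈ holCharts n M) :
    e ∈ IsManifold.maximalAtlas 𝓘(ℝ, Cn n) ω M := by
  rw [IsManifold.mem_maximalAtlas_iff, _root_.mem_maximalAtlas_iff] at he ⊢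
  intro e' he'
  obtain ⟨h1, h2⟩ := he e' he'
  rw [contDiffGroupoid, mem_groupoid_of_pregroupoid] at h1 h2 ⊢
  rw [mem_groupoid_of_pregroupoid]
  exact ⟨⟨(h1.1 : ContDiffOn ℂ ω _ _).restrict_scalars ℝ,
    (h1.2 : ContDiffOn ℂ ω _ _).restrict_scalars ℝ⟩,
    ⟨(h2.1 : ContDiffOn ℂ ω _ _).restrict_scalars ℝ,
    (h2.2 : ContDiffOn ℂ ω _ _).restrict_scalars ℝ⟩⟩

/-- The derivative of the inverse of a holomorphic chart is a complex linear bijection. -/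
theorem exists_complexLinear_deriv_symm {e : OpenPartialHomeomorph M (Cn n)}
    (he : e ∈ holCharts n M) {p : M} (hp : p ∈ e.source) :
    ∃ L L' : Cn n →L[ℂ] Cn n, (∀ w, L (L' w) = w) ∧ (∀ w, L' (L w) = w) ∧
      HasMFDerivAt 𝓘(ℝ, Cn n) 𝓘(ℝ, Cn n) e.symm (e p) (L.restrictScalars ℝ) := by
  have hy : e p ∈ e.target := e.map_source hp
  have h1 : MDifferentiableAt 𝓘(ℂ, Cn n) 𝓘(ℂ, Cn n) e p :=
    ((contMDiffOn_of_mem_maximalAtlas he).mdifferentiableOn (by simp)).mdifferentiableAt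
      (e.open_source.mem_nhds hp)
  have h2 : MDifferentiableAt 𝓘(ℂ, Cn n) 𝓘(ℂ, Cn n) e.symm (e p) :=
    ((contMDiffOn_symm_of_mem_maximalAtlas he).mdifferentiableOn (by simp)).mdifferentiableAt
      (e.open_target.mem_nhds hy)
  have h3 := h1.hasMFDerivAt
  have h4 := h2.hasMFDerivAt
  have hpp : e.symm (e p) = p := e.left_inv hp
  have h3' : HasMFDerivAt 𝓘(ℂ, Cn n) 𝓘(ℂ, Cn n) e (e.symm (e p))
      (mfderiv 𝓘(ℂ, Cn n) 𝓘(ℂ, Cn n) e p) := by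
    -- The type of the derivative depends on the base point, so `e.symm (e p) = p` is used by
    -- substituting a variable point.
    have aux : ∀ q, q = p → HasMFDerivAt 𝓘(ℂ, Cn n) 𝓘(ℂ, Cn n) e q
        (mfderiv 𝓘(ℂ, Cn n) 𝓘(ℂ, Cn n) e p) := by
      rintro q rfl
      exact h3
    exact aux _ hpp
  have h5 := h3'.comp (e p) h4
  have h6 : HasMFDerivAt 𝓘(ℂ, Cn n) 𝓘(ℂ, Cn n) (e ∘ e.symm) (e p)
      (ContinuousLinearMap.id ℂ (TangentSpace 𝓘(ℂ, Cn n) (e p))) :=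
    (hasMFDerivAt_id (e p)).congr_of_eventuallyEq
      ((e.open_target.mem_nhds hy |> fun h => Filter.mem_of_superset h
        fun z hz => e.right_inv hz))
  have h7 := h4.comp p h3
  have h8 : HasMFDerivAt 𝓘(ℂ, Cn n) 𝓘(ℂ, Cn n) (e.symm ∘ e) p
      (ContinuousLinearMap.id ℂ (TangentSpace 𝓘(ℂ, Cn n) p)) :=
    (hasMFDerivAt_id p).congr_of_eventuallyEq
      ((e.open_source.mem_nhds hp |> fun h => Filter.mem_of_superset h
        fun z hz => e.left_inv hz))
  refine ⟨mfderiv 𝓘(ℂ, Cn n) 𝓘(ℂ, Cn n) e.symm (e p), mfderiv 𝓘(ℂ, Cn n) 𝓘(ℂ, Cn n) e p,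
    fun w => ?_, fun w => ?_, h4.restrictScalars_real⟩
  · exact congrArg (fun T : Cn n →L[ℂ] Cn n => T w) (hasMFDerivAt_unique h7 h8)
  · exact congrArg (fun T : Cn n →L[ℂ] Cn n => T w) (hasMFDerivAt_unique h5 h6)

theorem fderiv_comp_symm {e : OpenPartialHomeomorph M (Cn n)} {p : M} (hp : p ∈ e.source)
    {L : Cn n →L[ℂ] Cn n}
    (hL : HasMFDerivAt 𝓘(ℝ, Cn n) 𝓘(ℝ, Cn n) e.symm (e p) (L.restrictScalars ℝ))
    {r : M → ℝ} (hr : MDifferentiableAt 𝓘(ℝ, Cn n) 𝓘(ℝ, ℝ) r p) (w : Cn n) :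
    fderiv ℝ (r ∘ e.symm) (e p) w = realDifferential n r p (L w) := by
  have hpp : e.symm (e p) = p := e.left_inv hp
  have h1 : HasMFDerivAt 𝓘(ℝ, Cn n) 𝓘(ℝ, ℝ) r (e.symm (e p))
      (mfderiv 𝓘(ℝ, Cn n) 𝓘(ℝ, ℝ) r p) := by
    have aux : ∀ q, q = p → HasMFDerivAt 𝓘(ℝ, Cn n) 𝓘(ℝ, ℝ) r q
        (mfderiv 𝓘(ℝ, Cn n) 𝓘(ℝ, ℝ) r p) := by
      rintro q rfl
      exact hr.hasMFDerivAt
    exact aux _ hpp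
  have h2 := (h1.comp (e p) hL).mfderiv
  rw [mfderiv_eq_fderiv] at h2
  rw [h2]
  rfl

theorem contDiffOn_comp_symm {e : OpenPartialHomeomorph M (Cn n)} (he : e ∈ holCharts n M)
    {F : Type*} [NormedAddCommGroup F] [NormedSpace ℝ F] {r : M → F} {U : Set M}
    (hr : ContMDiffOn 𝓘(ℝ, Cn n) 𝓘(ℝ, F) ∞ r U) :
    ContDiffOn ℝ ∞ (r ∘ e.symm) (chartImage e U) := by
  rw [← contMDiffOn_iff_contDiffOn]
  have h1 : ContMDiffOn 𝓘(ℝ, Cn n) 𝓘(ℝ, Cn n) ∞ e.symm e.target :=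
    (contMDiffOn_symm_of_mem_maximalAtlas (holCharts_subset_real he)).of_le le_top
  exact hr.comp (h1.mono inter_subset_left) fun z hz => hz.2

/-- Local defining functions, read in a chart. -/
theorem IsLocalDefiningFunction.exists_chart {D : Set M} {p : M} {r : M → ℝ}
    (hr : IsLocalDefiningFunction (n := n) D p r) {e : OpenPartialHomeomorph M (Cn n)}
    (he : e ∈ holCharts n M) (hp : p ∈ e.source) :
    ∃ O : Set (Cn n), IsOpen O ∧ e p ∈ O ∧ O ⊆ e.target ∧ ContDiffOn ℝ ∞ (r ∘ e.symm) O ∧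
      ∀ z ∈ O, (e.symm z ∈ D ↔ (r ∘ e.symm) z < 0) := by
  obtain ⟨⟨U, hU, hpU, hrU, hD⟩, -⟩ := hr
  exact ⟨chartImage e U, isOpen_chartImage e hU,
    ⟨e.map_source hp, by rwa [mem_preimage, e.left_inv hp]⟩, inter_subset_left,
    contDiffOn_comp_symm he hrU, fun z hz => hD _ hz.2⟩

theorem IsLocalDefiningFunction.fderiv_ne_zero {D : Set M} {p : M} {r : M → ℝ}
    (hr : IsLocalDefiningFunction (n := n) D p r) {e : OpenPartialHomeomorph M (Cn n)}
    (he : e ∈ holCharts n M) (hp : p ∈ e.source) : fderiv ℝ (r ∘ e.symm) (e p) ≠ 0 := by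
  obtain ⟨L, L', h1, h2, h3⟩ := exists_complexLinear_deriv_symm he hp
  intro h
  refine hr.2 (ContinuousLinearMap.ext fun w => ?_)
  have h4 := fderiv_comp_symm hp h3 hr.mdifferentiableAt (L' w)
  rw [h1, h] at h4
  exact h4.symm

theorem IsLocalDefiningFunction.exists_fderiv_eq_smul {D : Set M} {p : M} {r r' : M → ℝ}
    (hr : IsLocalDefiningFunction (n := n) D p r) (hr' : IsLocalDefiningFunction (n := n) D p r')
    (hD : IsOpen D) (hpD : p ∈ frontier D) {e : OpenPartialHomeomorph M (Cn n)}
    (he : e ∈ holCharts n M) (hp : p ∈ e.source) :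
    ∃ c : ℝ, 0 ≤ c ∧ fderiv ℝ (r' ∘ e.symm) (e p) = c • fderiv ℝ (r ∘ e.symm) (e p) := by
  obtain ⟨O, hO, hpO, -, h1, h2⟩ := hr.exists_chart he hp
  obtain ⟨O', hO', hpO', -, h1', h2'⟩ := hr'.exists_chart he hp
  refine _root_.exists_fderiv_eq_smul
    ((h1.contDiffAt (hO.mem_nhds hpO)).differentiableAt (by simp))
    ((h1'.contDiffAt (hO'.mem_nhds hpO')).differentiableAt (by simp))
    (by simpa [e.left_inv hp] using hr.apply_eq_zero hD hpD)
    (by simpa [e.left_inv hp] using hr'.apply_eq_zero hD hpD) ?_ (hr.fderiv_ne_zero he hp)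
  filter_upwards [hO.mem_nhds hpO, hO'.mem_nhds hpO'] with z hz hz' h
  exact (h2' z hz').1 ((h2 z hz).2 h)

/-- Two defining functions have proportional differentials with a nonnegative factor, which cannot
vanish because neither differential does. So being outward does not depend on the choice. -/
theorem PointsOutward.fderiv_pos {e : OpenPartialHomeomorph M (Cn n)} (he : e ∈ holCharts n M)
    {v : Cn n} {D : Set M} {p : M} (h : PointsOutward e v D p) (hp : p ∈ e.source) (hD : IsOpen D)
    (hpD : p ∈ frontier D) {r : M → ℝ} (hr : IsLocalDefiningFunction (n := n) D p r) :
    0 < fderiv ℝ (r ∘ e.symm) (e p) v := by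
  obtain ⟨r', hr', hv⟩ := h
  obtain ⟨c, hc, hcr⟩ := hr'.exists_fderiv_eq_smul hr hD hpD he hp
  rw [hcr, smul_apply, smul_eq_mul]
  refine mul_pos (lt_of_le_of_ne hc fun h0 => ?_) hv
  refine hr.fderiv_ne_zero he hp ?_
  rw [hcr, ← h0, zero_smul]

variable [IsManifold 𝓘(ℂ, Cn n) ω M]

theorem chartAt_mem_holCharts (x : M) : chartAt (Cn n) x ∈ holCharts n M :=
  IsManifold.chart_mem_maximalAtlas x

theorem IsLocalDefiningFunction.exists_realDifferential_eq_smul {D : Set M} {p : M} {r r' : M → ℝ}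
    (hr : IsLocalDefiningFunction (n := n) D p r) (hr' : IsLocalDefiningFunction (n := n) D p r')
    (hD : IsOpen D) (hpD : p ∈ frontier D) :
    ∃ c : ℝ, ∀ w, realDifferential n r' p w = c * realDifferential n r p w := by
  have he := chartAt_mem_holCharts (n := n) p
  have hp := mem_chart_source (Cn n) p
  obtain ⟨c, -, hc⟩ := hr.exists_fderiv_eq_smul hr' hD hpD he hp
  obtain ⟨L, L', h1, h2, h3⟩ := exists_complexLinear_deriv_symm he hp
  refine ⟨c, fun w => ?_⟩
  have h4 := fderiv_comp_symm hp h3 hr.mdifferentiableAt (L' w)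
  have h5 := fderiv_comp_symm hp h3 hr'.mdifferentiableAt (L' w)
  rw [h1] at h4 h5
  rw [← h4, ← h5, hc]
  rfl

variable {N : ℕ} {D : Fin N → Set M} {Ω : Set M}

/-- At a generic corner, the defining functions have dual vectors in every chart. -/
theorem IsDomainWithGenericCorners.exists_dual_vectors
    (hΩ : IsDomainWithGenericCorners (n := n) D Ω) {S : Finset (Fin N)} {p : M}
    (hpS : ∀ j ∈ S, p ∈ frontier (D j)) {ρ : Fin N → M → ℝ}
    (hρ : ∀ j ∈ S, IsLocalDefiningFunction (n := n) (D j) p (ρ j))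
    {e : OpenPartialHomeomorph M (Cn n)} (he : e ∈ holCharts n M) (hp : p ∈ e.source) :
    ∃ B : Fin N → Cn n, ∀ i ∈ S, ∀ j ∈ S,
      fderiv ℝ (ρ i ∘ e.symm) (e p) (B j) = (if i = j then 1 else 0) ∧
        fderiv ℝ (ρ i ∘ e.symm) (e p) (Complex.I • B j) = 0 := by
  obtain ⟨L, L', h1, h2, h3⟩ := exists_complexLinear_deriv_symm he hp
  obtain ⟨B, hB⟩ := _root_.exists_dual_vectors (fun j => realDifferential n (ρ j) p)
    (cornerComplexTangentSpace (n := n) D S p) (fun w hw c j hj r hr => by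
      obtain ⟨c', hc'⟩ := (hρ j hj).exists_realDifferential_eq_smul hr
        (hΩ.smoothlyBounded j).isOpen (hpS j hj)
      -- The complex tangent space tests all complex multiples of `w`; over the reals they are
      -- spanned by `w` and `i w`.
      have hcw : c • w = c.re • w + c.im • (Complex.I • w) := by
        ext m
        simp only [Pi.smul_apply, Pi.add_apply, smul_eq_mul, Complex.real_smul]
        conv_lhs => rw [← Complex.re_add_im c]
        ring
      rw [hc', hcw, map_add, map_smul, map_smul, (hw j hj).1, (hw j hj).2]
      simp) (hΩ.generic S p (by simpa using hpS))
  -- The dual vectors are moved to the chart by a complex linear map, which preserves the condition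
  -- on `i B_j`.
  refine ⟨fun j => L' (B j), fun i hi j hj => ?_⟩
  rw [fderiv_comp_symm hp h3 (hρ i hi).mdifferentiableAt,
    fderiv_comp_symm hp h3 (hρ i hi).mdifferentiableAt, map_smul, h1]
  exact hB i hi j hj

end DefiningFunctions

/-! ### Smooth functions with compact support are Lipschitz for the Riemannian distance -/

section Lipschitz

open scoped NNReal

variable {n : ℕ} {M : Type*} [TopologicalSpace M] [ChartedSpace (Cn n) M]
  [IsManifold 𝓘(ℝ, Cn n) 1 M]
  [Bundle.RiemannianBundle (fun x : M => TangentSpace 𝓘(ℝ, Cn n) x)]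
  [IsContinuousRiemannianBundle (Cn n) (fun x : M => TangentSpace 𝓘(ℝ, Cn n) x)]

attribute [local instance] normedAddCommGroupTangentSpaceVectorSpace
attribute [local instance] normedSpaceTangentSpaceVectorSpace

/-- Near `x` the derivative of the chart is bounded from the Riemannian norm to the coordinate norm,
and the coordinate differential of `g` is bounded by continuity. -/
theorem exists_enorm_realDifferential_le {g : M → ℝ}
    (hg : ContMDiff 𝓘(ℝ, Cn n) 𝓘(ℝ, ℝ) 1 g) (x : M) :
    ∃ C : ℝ≥0, ∀ᶠ y in 𝓝 x, ∀ ξ : TangentSpace 𝓘(ℝ, Cn n) y,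
      ‖realDifferential n g y ξ‖ₑ ≤ C * ‖ξ‖ₑ := by
  obtain ⟨C, -, hC⟩ := eventually_enorm_mfderiv_extChartAt_lt 𝓘(ℝ, Cn n) x
  set G : Cn n → ℝ := g ∘ (extChartAt 𝓘(ℝ, Cn n) x).symm with hG
  have hGs : ContDiffOn ℝ 1 G (extChartAt 𝓘(ℝ, Cn n) x).target := by
    rw [← contMDiffOn_iff_contDiffOn]
    exact hg.comp_contMDiffOn (contMDiffOn_extChartAt_symm x)
  have hopen : IsOpen (extChartAt 𝓘(ℝ, Cn n) x).target := isOpen_extChartAt_target x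
  have hx : extChartAt 𝓘(ℝ, Cn n) x x ∈ (extChartAt 𝓘(ℝ, Cn n) x).target :=
    mem_extChartAt_target x
  have hcont : ContinuousAt (fun z => ‖fderiv ℝ G z‖₊) (extChartAt 𝓘(ℝ, Cn n) x x) :=
    ((hGs.continuousOn_fderiv_of_isOpen hopen le_rfl).continuousAt (hopen.mem_nhds hx)).nnnorm
  set C' : ℝ≥0 := ‖fderiv ℝ G (extChartAt 𝓘(ℝ, Cn n) x x)‖₊ + 1 with hC'
  have h1 : ∀ᶠ y in 𝓝 x, ‖fderiv ℝ G (extChartAt 𝓘(ℝ, Cn n) x y)‖₊ < C' :=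
    (hcont.comp (f := extChartAt 𝓘(ℝ, Cn n) x) (continuousAt_extChartAt x)).eventually
      (eventually_lt_nhds (lt_add_one _))
  refine ⟨C' * C, ?_⟩
  filter_upwards [hC, h1, extChartAt_source_mem_nhds (I := 𝓘(ℝ, Cn n)) x,
    eventually_mem_nhds_iff.2 (extChartAt_source_mem_nhds (I := 𝓘(ℝ, Cn n)) x)] with y hy1 hy2 hy3 hy4 ξ
  have hy3' : y ∈ (chartAt (Cn n) x).source := by simpa using hy3
  have hyt := (extChartAt 𝓘(ℝ, Cn n) x).map_source hy3
  have h2 : g =ᶠ[𝓝 y] G ∘ extChartAt 𝓘(ℝ, Cn n) x := by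
    filter_upwards [hy4] with z hz
    simp only [hG, Function.comp_apply, (extChartAt 𝓘(ℝ, Cn n) x).left_inv hz]
  have h3 : HasMFDerivAt 𝓘(ℝ, Cn n) 𝓘(ℝ, ℝ) (G ∘ extChartAt 𝓘(ℝ, Cn n) x) y
      ((fderiv ℝ G (extChartAt 𝓘(ℝ, Cn n) x y)).comp
        (mfderiv 𝓘(ℝ, Cn n) 𝓘(ℝ, Cn n) (extChartAt 𝓘(ℝ, Cn n) x) y)) :=
    HasMFDerivAt.comp y
      ((hGs.contDiffAt (hopen.mem_nhds hyt)).differentiableAt one_ne_zero).hasFDerivAt.hasMFDerivAt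
      (mdifferentiableAt_extChartAt hy3').hasMFDerivAt
  have h4 : realDifferential n g y ξ = fderiv ℝ G (extChartAt 𝓘(ℝ, Cn n) x y)
      (mfderiv 𝓘(ℝ, Cn n) 𝓘(ℝ, Cn n) (extChartAt 𝓘(ℝ, Cn n) x) y ξ) := by
    rw [realDifferential, h2.mfderiv_eq, h3.mfderiv]
    rfl
  rw [h4]
  refine (ContinuousLinearMap.le_opENorm _ _).trans ?_
  rw [ENNReal.coe_mul, mul_assoc]
  refine mul_le_mul' ?_ ?_
  · exact_mod_cast hy2.le
  · refine (ContinuousLinearMap.le_opENorm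
      (mfderiv 𝓘(ℝ, Cn n) 𝓘(ℝ, Cn n) (extChartAt 𝓘(ℝ, Cn n) x) y) ξ).trans ?_
    exact mul_le_mul_left hy1.le _

/-- Compact support makes the local bounds on `dg` global; integrating along a path gives a bound by
its length, and paths nearly realize the distance. -/
theorem exists_edist_le_riemannianEDist {g : M → ℝ}
    (hg : ContMDiff 𝓘(ℝ, Cn n) 𝓘(ℝ, ℝ) 1 g) (hc : HasCompactSupport g) :
    ∃ C : ℝ≥0, ∀ z w, ‖g w - g z‖ₑ ≤ C * riemannianEDist 𝓘(ℝ, Cn n) z w := by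
  choose C hC using exists_enorm_realDifferential_le hg
  obtain ⟨t, -, ht⟩ := hc.isCompact.elim_nhds_subcover
    (fun x => {y | ∀ ξ : TangentSpace 𝓘(ℝ, Cn n) y, ‖realDifferential n g y ξ‖ₑ ≤ C x * ‖ξ‖ₑ})
    fun x _ => hC x
  set B : ℝ≥0 := ∑ x ∈ t, C x with hB
  have hbound : ∀ y, ∀ ξ : TangentSpace 𝓘(ℝ, Cn n) y, ‖realDifferential n g y ξ‖ₑ ≤ B * ‖ξ‖ₑ := by
    intro y ξ
    by_cases hy : y ∈ tsupport g
    · obtain ⟨x, hx, hxy⟩ := mem_iUnion₂.1 (ht hy)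
      refine (hxy ξ).trans ?_
      have : C x ≤ B := Finset.single_le_sum (f := C) (fun _ _ => zero_le) hx
      gcongr
    · have h1 : g =ᶠ[𝓝 y] fun _ => 0 := notMem_tsupport_iff_eventuallyEq.1 hy
      have h2 : realDifferential n g y ξ = 0 := by
        rw [realDifferential, h1.mfderiv_eq, mfderiv_const]
        rfl
      simp [h2]
  -- `B` may be zero, and the approximation by path lengths below divides by the constant.
  refine ⟨B + 1, fun z w => ?_⟩
  have hmain : ∀ r, riemannianEDist 𝓘(ℝ, Cn n) z w < r → ‖g w - g z‖ₑ ≤ B * r := by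
    intro r hr
    obtain ⟨γ, h0, h1, hγ, hlen⟩ := exists_lt_of_riemannianEDist_lt hr
    have hgγ : ContMDiffOn 𝓘(ℝ, ℝ) 𝓘(ℝ, ℝ) 1 (g ∘ γ) (Icc 0 1) := hg.comp_contMDiffOn hγ
    calc ‖g w - g z‖ₑ = ‖(g ∘ γ) 1 - (g ∘ γ) 0‖ₑ := by simp [h0, h1]
      _ ≤ ∫⁻ t in Icc 0 1, ‖derivWithin (g ∘ γ) (Icc 0 1) t‖ₑ :=
        enorm_sub_le_lintegral_derivWithin_Icc_of_contDiffOn_Icc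
          (contMDiffOn_iff_contDiffOn.1 hgγ) zero_le_one
      _ ≤ ∫⁻ t in Icc 0 1, B * ‖mfderivWithin 𝓘(ℝ, ℝ) 𝓘(ℝ, Cn n) γ (Icc 0 1) t 1‖ₑ := by
        refine setLIntegral_mono' measurableSet_Icc fun t ht => ?_
        have h2 : mfderivWithin 𝓘(ℝ, ℝ) 𝓘(ℝ, ℝ) (g ∘ γ) (Icc 0 1) t =
            (mfderiv 𝓘(ℝ, Cn n) 𝓘(ℝ, ℝ) g (γ t)).comp
              (mfderivWithin 𝓘(ℝ, ℝ) 𝓘(ℝ, Cn n) γ (Icc 0 1) t) := by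
          apply mfderiv_comp_mfderivWithin
          · exact hg.mdifferentiable one_ne_zero _
          · exact hγ.mdifferentiableOn one_ne_zero _ ht
          · rw [uniqueMDiffWithinAt_iff_uniqueDiffWithinAt]
            exact uniqueDiffOn_Icc zero_lt_one _ ht
        have h3 : derivWithin (g ∘ γ) (Icc 0 1) t = realDifferential n g (γ t)
            (mfderivWithin 𝓘(ℝ, ℝ) 𝓘(ℝ, Cn n) γ (Icc 0 1) t 1) := by
          rw [← fderivWithin_derivWithin, ← mfderivWithin_eq_fderivWithin, h2]
          rfl
        rw [h3]
        exact hbound _ _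
      _ = B * pathELength 𝓘(ℝ, Cn n) γ 0 1 := by
        rw [lintegral_const_mul' _ _ ENNReal.coe_ne_top,
          pathELength_eq_lintegral_mfderivWithin_Icc]
      _ ≤ B * r := mul_le_mul_right hlen.le _
  by_contra hlt
  rw [not_le, mul_comm, ← ENNReal.lt_div_iff_mul_lt (Or.inl (by simp)) (Or.inl ENNReal.coe_ne_top)]
    at hlt
  obtain ⟨r, hr1, hr2⟩ := exists_between hlt
  rw [ENNReal.lt_div_iff_mul_lt (Or.inl (by simp)) (Or.inl ENNReal.coe_ne_top), mul_comm] at hr2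
  refine absurd (hmain r hr1) (not_le.2 (lt_of_le_of_lt ?_ hr2))
  gcongr
  exact le_self_add

end Lipschitz

/-! ### Hypersurfaces are null sets -/

section NullSets

variable {n : ℕ}

/-- In a small ball the derivative along some `v` does not vanish, so by Rolle each line in
direction `v` meets the zero set at most once. Its translates by multiples of `v` are then disjoint,
and infinitely many disjoint translates by bounded vectors force measure zero. -/
theorem exists_mem_nhds_volume_inter_eq_zero {g : Cn n → ℝ} {O : Set (Cn n)} {y : Cn n}
    (hO : IsOpen O) (hy : y ∈ O) (hg : ContDiffOn ℝ ∞ g O) (hne : fderiv ℝ g y ≠ 0) :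
    ∃ V ∈ 𝓝 y, volume (V ∩ {z | g z = 0}) = 0 := by
  obtain ⟨v, hv⟩ : ∃ v, fderiv ℝ g y v ≠ 0 := by
    by_contra h
    push Not at h
    exact hne (ContinuousLinearMap.ext h)
  have hcont : ContinuousOn (fun z => fderiv ℝ g z v) O :=
    (hg.continuousOn_fderiv_of_isOpen hO (by simp)).clm_apply continuousOn_const
  have hev : ∀ᶠ z in 𝓝 y, z ∈ O ∧ fderiv ℝ g z v ≠ 0 :=
    Eventually.and (hO.mem_nhds hy) ((hcont.continuousAt (hO.mem_nhds hy)).eventually_ne hv)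
  obtain ⟨δ, hδ, hball⟩ := Metric.eventually_nhds_iff_ball.1 hev
  refine ⟨Metric.ball y δ, Metric.ball_mem_nhds y hδ, ?_⟩
  have hgb : ContinuousOn g (Metric.ball y δ) := hg.continuousOn.mono fun z hz => (hball z hz).1
  have hmeas : MeasurableSet (Metric.ball y δ ∩ {z | g z = 0}) := by
    have h1 : Metric.ball y δ ∩ {z | g z = 0} =
        Metric.ball y δ \ (Metric.ball y δ ∩ g ⁻¹' {0}ᶜ) := by
      ext z
      simp only [mem_inter_iff, Set.mem_sdiff, mem_preimage, mem_compl_iff, mem_singleton_iff,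
        mem_ofPred_eq]
      tauto
    rw [h1]
    exact Metric.isOpen_ball.measurableSet.diff
      (hgb.isOpen_inter_preimage Metric.isOpen_ball isOpen_compl_singleton).measurableSet
  have hline : ∀ s ∈ Metric.ball y δ, ∀ t : ℝ, t ≠ 0 → s + t • v ∈ Metric.ball y δ →
      g s = 0 → g (s + t • v) ≠ 0 := by
    intro s hs t ht hst hgs hgst
    have hseg : ∀ u ∈ Icc (0 : ℝ) 1, s + u • (t • v) ∈ Metric.ball y δ := fun u hu => by
      have := (convex_ball y δ).add_smul_sub_mem hs hst hu
      rwa [add_sub_cancel_left] at this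
    have hder : ∀ u ∈ Icc (0 : ℝ) 1, HasDerivAt (fun u : ℝ => g (s + u • (t • v)))
        (fderiv ℝ g (s + u • (t • v)) (t • v)) u := fun u hu => by
      have h1 : HasDerivAt (fun u : ℝ => s + u • (t • v)) (t • v) u := by
        simpa using ((hasDerivAt_id u).smul_const (t • v)).const_add s
      have h2 := hball _ (hseg u hu)
      exact (((hg.contDiffAt (hO.mem_nhds h2.1)).differentiableAt
        (by simp)).hasFDerivAt).comp_hasDerivAt u h1
    obtain ⟨u, hu, hu0⟩ := exists_hasDerivAt_eq_zero (f := fun u : ℝ => g (s + u • (t • v)))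
      zero_lt_one (fun u hu => (hder u hu).continuousAt.continuousWithinAt)
      (by simp [hgs, hgst]) fun u hu => hder u ⟨hu.1.le, hu.2.le⟩
    rw [map_smul, smul_eq_mul] at hu0
    rcases mul_eq_zero.1 hu0 with h | h
    · exact ht h
    · exact (hball _ (hseg u ⟨hu.1.le, hu.2.le⟩)).2 h
  refine Measure.addHaar_eq_zero_of_disjoint_translates volume
    (fun m : ℕ => ((m : ℝ) + 1)⁻¹ • v) ?_ ?_ hmeas
  · refine (Metric.isBounded_closedBall (x := (0 : Cn n)) (r := ‖v‖)).subset ?_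
    rintro _ ⟨m, rfl⟩
    rw [mem_closedBall_zero_iff, norm_smul, norm_inv, Real.norm_of_nonneg (by positivity)]
    exact mul_le_of_le_one_left (norm_nonneg v)
      (inv_le_one_of_one_le₀ (by linarith [Nat.cast_nonneg (α := ℝ) m]))
  · intro m m' hmm'
    refine Set.disjoint_left.2 ?_
    simp only [singleton_add, image_add_left, mem_preimage]
    rintro z ⟨hz1, hz2⟩ ⟨hz1', hz2'⟩
    have ht : ((m : ℝ) + 1)⁻¹ - ((m' : ℝ) + 1)⁻¹ ≠ 0 := fun h => hmm' (by
      have := inv_injective (sub_eq_zero.1 h)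
      exact_mod_cast (add_right_cancel this))
    have hz : -(((m' : ℝ) + 1)⁻¹ • v) + z = (-(((m : ℝ) + 1)⁻¹ • v) + z) +
        (((m : ℝ) + 1)⁻¹ - ((m' : ℝ) + 1)⁻¹) • v := by
      rw [sub_smul]
      abel
    rw [hz] at hz1' hz2'
    exact hline _ hz1 _ ht hz1' hz2 hz2'

variable {M : Type*} [TopologicalSpace M] [ChartedSpace (Cn n) M]
variable {N : ℕ} {D : Fin N → Set M} {Ω : Set M}

theorem nonpos_of_symm_mem_closure {M : Type*} [TopologicalSpace M]
    {e : OpenPartialHomeomorph M (Cn n)} {D : Set M} {O : Set (Cn n)}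
    {g : Cn n → ℝ} (hO : IsOpen O) (hOt : O ⊆ e.target) (hg : ContinuousOn g O)
    (hD : ∀ z ∈ O, e.symm z ∈ D → g z < 0) {z : Cn n} (hz : z ∈ O)
    (hzD : e.symm z ∈ closure D) : g z ≤ 0 := by
  by_contra h
  push Not at h
  have h1 : ∀ᶠ y in 𝓝 z, y ∈ O ∧ 0 < g y :=
    Eventually.and (hO.mem_nhds hz)
      ((hg.continuousAt (hO.mem_nhds hz)).eventually (eventually_gt_nhds h))
  have hsrc := e.map_target (hOt hz)
  have h2 : ∀ᶠ p in 𝓝 (e.symm z), e p ∈ O ∧ 0 < g (e p) := by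
    have := e.continuousAt hsrc
    rw [ContinuousAt, e.right_inv (hOt hz)] at this
    exact this.eventually h1
  obtain ⟨p, ⟨⟨hp1, hp2⟩, hp3⟩, hpD⟩ := mem_closure_iff_nhds.1 hzD _
    (Filter.inter_mem h2 (e.open_source.mem_nhds hsrc))
  exact absurd (hD (e p) hp1 (by rwa [e.left_inv hp3])) (not_lt.2 hp2.le)

/-- Locally the boundary lies in the zero set of a defining function with nonvanishing differential,
and null sets can be detected locally. -/
theorem IsSmoothlyBoundedDomain.volume_chartImage_frontier {D : Set M}
    (hD : IsSmoothlyBoundedDomain (n := n) D) {e : OpenPartialHomeomorph M (Cn n)}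
    (he : e ∈ holCharts n M) : volume (chartImage e (frontier D)) = 0 := by
  refine measure_null_of_locally_null _ fun y hy => ?_
  obtain ⟨r, hr⟩ := hD.exists_defining _ hy.2
  have hp : e.symm y ∈ e.source := e.map_target hy.1
  obtain ⟨O, hO, hyO, hOt, hrO, hiff⟩ := hr.exists_chart he hp
  have hne := hr.fderiv_ne_zero he hp
  rw [e.right_inv hy.1] at hyO hne
  obtain ⟨V, hV, hV0⟩ := exists_mem_nhds_volume_inter_eq_zero hO hyO hrO hne
  refine ⟨V ∩ O ∩ chartImage e (frontier D), ?_, measure_mono_null ?_ hV0⟩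
  · exact Filter.inter_mem (mem_nhdsWithin_of_mem_nhds (Filter.inter_mem hV (hO.mem_nhds hyO)))
      self_mem_nhdsWithin
  · rintro z ⟨⟨hzV, hzO⟩, hz⟩
    refine ⟨hzV, le_antisymm (nonpos_of_symm_mem_closure hO hOt hrO.continuousOn
      (fun z hz h => (hiff z hz).1 h) hzO hz.2.1) (not_lt.1 fun h => ?_)⟩
    have h1 := hz.2
    rw [hD.isOpen.frontier_eq] at h1
    exact h1.2 ((hiff z hzO).2 h)

theorem IsDomainWithGenericCorners.frontier_subset
    (hΩ : IsDomainWithGenericCorners (n := n) D Ω) : frontier Ω ⊆ ⋃ j, frontier (D j) := by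
  intro p hp
  rw [hΩ.isOpen.frontier_eq, hΩ.eq_iInter] at hp
  obtain ⟨j, hj⟩ : ∃ j, p ∉ D j := by
    by_contra h
    push Not at h
    exact hp.2 (mem_iInter.2 h)
  refine mem_iUnion.2 ⟨j, ?_⟩
  rw [(hΩ.smoothlyBounded j).isOpen.frontier_eq]
  exact ⟨closure_mono (iInter_subset D j) hp.1, hj⟩

theorem IsDomainWithGenericCorners.volume_chartImage_frontier
    (hΩ : IsDomainWithGenericCorners (n := n) D Ω) {e : OpenPartialHomeomorph M (Cn n)}
    (he : e ∈ holCharts n M) : volume (chartImage e (frontier Ω)) = 0 := by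
  refine measure_mono_null (t := ⋃ j, chartImage e (frontier (D j))) (fun z hz => ?_)
    (measure_iUnion_null fun j => (hΩ.smoothlyBounded j).volume_chartImage_frontier he)
  obtain ⟨j, hj⟩ := mem_iUnion.1 (hΩ.frontier_subset hz.2)
  exact mem_iUnion.2 ⟨j, hz.1, hj⟩

end NullSets

/-! ### Corner frames and outward vectors on the manifold -/

section LocalGeometry

variable {n : ℕ} {M : Type*} [TopologicalSpace M] [ChartedSpace (Cn n) M]
variable {N : ℕ} {D : Fin N → Set M} {Ω : Set M}

theorem isLocalDefiningFunction_of_fderiv_ne_zero {D U : Set M} {p : M} {r : M → ℝ}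
    (hU : IsOpen U) (hpU : p ∈ U) (hr : ContMDiffOn 𝓘(ℝ, Cn n) 𝓘(ℝ, ℝ) ∞ r U)
    (hD : ∀ z ∈ U, (z ∈ D ↔ r z < 0)) {e : OpenPartialHomeomorph M (Cn n)}
    (he : e ∈ holCharts n M) (hp : p ∈ e.source) (hne : fderiv ℝ (r ∘ e.symm) (e p) ≠ 0) :
    IsLocalDefiningFunction (n := n) D p r := by
  refine ⟨⟨U, hU, hpU, hr, hD⟩, fun h => hne ?_⟩
  obtain ⟨L, L', h1, h2, h3⟩ := exists_complexLinear_deriv_symm he hp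
  refine ContinuousLinearMap.ext fun w => ?_
  rw [fderiv_comp_symm hp h3 ((hr.mdifferentiableOn (by simp)).mdifferentiableAt
    (hU.mem_nhds hpU)), h]
  rfl

theorem IsDomainWithGenericCorners.exists_definingFunctions
    (hΩ : IsDomainWithGenericCorners (n := n) D Ω) (p : M) :
    ∃ (S : Finset (Fin N)) (ρ : Fin N → M → ℝ), (∀ j, j ∈ S ↔ p ∈ frontier (D j)) ∧
      ∀ j ∈ S, IsLocalDefiningFunction (n := n) (D j) p (ρ j) := by
  classical
  have h : ∀ j, ∃ r : M → ℝ, p ∈ frontier (D j) → IsLocalDefiningFunction (n := n) (D j) p r :=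
    fun j => by
      by_cases hj : p ∈ frontier (D j)
      · obtain ⟨r, hr⟩ := (hΩ.smoothlyBounded j).exists_defining p hj
        exact ⟨r, fun _ => hr⟩
      · exact ⟨0, fun h => absurd h hj⟩
  choose ρ hρ using h
  exact ⟨Finset.univ.filter fun j => p ∈ frontier (D j), ρ, fun j => by simp,
    fun j hj => hρ j (by simpa using hj)⟩

variable [IsManifold 𝓘(ℂ, Cn n) ω M]

/-- Near every point of the closure of a domain with generic corners there is a corner frame, in any
chart. -/
theorem IsDomainWithGenericCorners.exists_isCornerFrame
    (hΩ : IsDomainWithGenericCorners (n := n) D Ω) {p : M} (hpΩ : p ∈ closure Ω)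
    {e : OpenPartialHomeomorph M (Cn n)} (he : e ∈ holCharts n M) (hp : p ∈ e.source) :
    ∃ (U : Set (Cn n)) (S : Finset (Fin N)) (r : Fin N → Cn n → ℝ) (a : Fin N → Cn n → Cn n),
      IsCornerFrame U (chartImage e Ω) S r a ∧ e p ∈ U ∧ U ⊆ e.target ∧
        ∀ j ∈ S, ∀ z ∈ U, (e.symm z ∈ D j ↔ r j z < 0) := by
  obtain ⟨S, ρ, hS, hρ⟩ := hΩ.exists_definingFunctions p
  obtain ⟨B, hB⟩ := hΩ.exists_dual_vectors (fun j hj => (hS j).1 hj) hρ he hp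
  -- If `p` is not on the boundary of `D j`, it lies in `D j`, because it lies in the closure. Near
  -- `p` that condition is then automatic, and only the indices in `S` matter.
  have hO : ∀ j, ∃ O : Set (Cn n), IsOpen O ∧ e p ∈ O ∧ O ⊆ e.target ∧
      (j ∈ S → ContDiffOn ℝ ∞ (ρ j ∘ e.symm) O ∧
        ∀ z ∈ O, (e.symm z ∈ D j ↔ (ρ j ∘ e.symm) z < 0)) ∧
      (j ∉ S → ∀ z ∈ O, e.symm z ∈ D j) := fun j => by
    by_cases hj : j ∈ S
    · obtain ⟨O, h1, h2, h3, h4, h5⟩ := (hρ j hj).exists_chart he hp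
      exact ⟨O, h1, h2, h3, fun _ => ⟨h4, h5⟩, fun h => absurd hj h⟩
    · have hpD : p ∈ D j := by
        by_contra h
        refine hj ((hS j).2 ?_)
        rw [(hΩ.smoothlyBounded j).isOpen.frontier_eq]
        rw [hΩ.eq_iInter] at hpΩ
        exact ⟨closure_mono (iInter_subset D j) hpΩ, h⟩
      exact ⟨chartImage e (D j), isOpen_chartImage e (hΩ.smoothlyBounded j).isOpen,
        ⟨e.map_source hp, by rwa [mem_preimage, e.left_inv hp]⟩, inter_subset_left,
        fun h => absurd h hj, fun _ z hz => hz.2⟩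
  choose O hOo hOp hOt hO1 hO2 using hO
  have hOI : IsOpen (e.target ∩ ⋂ j, O j) := e.open_target.inter (isOpen_iInter_of_finite hOo)
  obtain ⟨U, r, a, h1, h2, h3, h4⟩ := _root_.exists_isCornerFrame (S := S)
    (ρ := fun j => ρ j ∘ e.symm) (W := chartImage e Ω) hOI
    (p := e p) ⟨e.map_source hp, mem_iInter.2 hOp⟩ (isOpen_chartImage e hΩ.isOpen)
    (fun j hj => (hO1 j hj).1.mono fun z hz => mem_iInter.1 hz.2 j)
    (fun z hz => by
      have hz2 := mem_iInter.1 hz.2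
      constructor
      · intro h j hj
        refine ((hO1 j hj).2 z (hz2 j)).1 ?_
        have h5 := h.2
        rw [hΩ.eq_iInter] at h5
        exact mem_iInter.1 h5 j
      · intro h
        refine ⟨hz.1, ?_⟩
        rw [mem_preimage, hΩ.eq_iInter]
        refine mem_iInter.2 fun j => ?_
        by_cases hj : j ∈ S
        · exact ((hO1 j hj).2 z (hz2 j)).2 (h j hj)
        · exact hO2 j hj z (hz2 j))
    (B := B) (fun i hi j hj => by
      rw [dbar_ofReal_eq (((hO1 i hi).1.contDiffAt ((hOo i).mem_nhds (hOp i))).differentiableAt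
        (by simp)), (hB i hi j hj).1, (hB i hi j hj).2]
      split_ifs <;> simp)
  refine ⟨U, S, r, a, h1, h2, h3.trans inter_subset_left, fun j hj z hz => ?_⟩
  rw [h4 j hj hz]
  exact (hO1 j hj).2 z (mem_iInter.1 (h3 hz).2 j)

/-- Near every point there is a vector pointing outward from all the `D j`. -/
theorem IsDomainWithGenericCorners.exists_pointsOutward
    (hΩ : IsDomainWithGenericCorners (n := n) D Ω) (p : M) :
    ∃ (O : Set M) (v : Cn n), IsOpen O ∧ p ∈ O ∧ O ⊆ (chartAt (Cn n) p).source ∧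
      ∀ j, ∀ q ∈ frontier (D j) ∩ O, PointsOutward (chartAt (Cn n) p) v (D j) q := by
  set e := chartAt (Cn n) p with he'
  have he : e ∈ holCharts n M := chartAt_mem_holCharts p
  have hp : p ∈ e.source := mem_chart_source (Cn n) p
  obtain ⟨S, ρ, hS, hρ⟩ := hΩ.exists_definingFunctions p
  obtain ⟨B, hB⟩ := hΩ.exists_dual_vectors (fun j hj => (hS j).1 hj) hρ he hp
  -- By duality every `dρ_j`, `j ∈ S`, takes the value `1` on this sum at `p`, and it stays positive
  -- nearby.
  set v := ∑ j ∈ S, B j with hv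
  have hO : ∀ j, ∃ O : Set M, IsOpen O ∧ p ∈ O ∧
      ∀ q ∈ frontier (D j) ∩ (O ∩ e.source), PointsOutward e v (D j) q := fun j => by
    by_cases hj : j ∈ S
    · obtain ⟨⟨U, hU, hpU, hrU, hiff⟩, -⟩ := hρ j hj
      have hsm : ContDiffOn ℝ ∞ (ρ j ∘ e.symm) (chartImage e U) := contDiffOn_comp_symm he hrU
      have hUo := isOpen_chartImage e hU
      have hep : e p ∈ chartImage e U :=
        ⟨e.map_source hp, by rwa [mem_preimage, e.left_inv hp]⟩
      have hpos : 0 < fderiv ℝ (ρ j ∘ e.symm) (e p) v := by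
        rw [hv, map_sum, Finset.sum_eq_single j]
        · simp [(hB j hj j hj).1]
        · intro i hi hij
          simp [(hB j hj i hi).1, Ne.symm hij]
        · exact fun h => absurd hj h
      have hcont : ContinuousOn (fun z => fderiv ℝ (ρ j ∘ e.symm) z v) (chartImage e U) :=
        (hsm.continuousOn_fderiv_of_isOpen hUo (by simp)).clm_apply continuousOn_const
      have hev : ∀ᶠ q in 𝓝 p, q ∈ U ∧ 0 < fderiv ℝ (ρ j ∘ e.symm) (e q) v :=
        Eventually.and (hU.mem_nhds hpU) ((ContinuousAt.comp (f := e)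
          (hcont.continuousAt (hUo.mem_nhds hep)) (e.continuousAt hp)).eventually
            (eventually_gt_nhds hpos))
      obtain ⟨O, h1, h2, h3⟩ := eventually_nhds_iff.1 hev
      refine ⟨O, h2, h3, fun q hq => ⟨ρ j, ?_, (h1 q hq.2.1).2⟩⟩
      refine isLocalDefiningFunction_of_fderiv_ne_zero hU (h1 q hq.2.1).1 hrU hiff he hq.2.2
        fun h => ?_
      have h4 := (h1 q hq.2.1).2
      rw [h] at h4
      exact lt_irrefl _ h4
    · exact ⟨(frontier (D j))ᶜ, isClosed_frontier.isOpen_compl, fun h => hj ((hS j).2 h),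
        fun q hq => absurd hq.1 hq.2.1⟩
  choose O hOo hOp hO using hO
  exact ⟨(⋂ j, O j) ∩ e.source, v, (isOpen_iInter_of_finite hOo).inter e.open_source,
    ⟨mem_iInter.2 hOp, hp⟩, inter_subset_right,
    fun j q hq => hO j q ⟨hq.1, mem_iInter.1 hq.2.1 j, hq.2.2⟩⟩

/-! ### The distance to the boundary -/

variable [T2Space M] [Bundle.RiemannianBundle (fun x : M => TangentSpace 𝓘(ℝ, Cn n) x)]
  [IsContinuousRiemannianBundle (Cn n) (fun x : M => TangentSpace 𝓘(ℝ, Cn n) x)]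

/-- A smooth function with compact support in the target of a chart, transported to `M`. -/
theorem contMDiff_extend_chart {M : Type*} [TopologicalSpace M] [ChartedSpace (Cn n) M] [T2Space M]
    {e : OpenPartialHomeomorph M (Cn n)} (he : e ∈ holCharts n M)
    {F : Type*} [NormedAddCommGroup F] [NormedSpace ℝ F] {q : Cn n → F}
    (hq : ContDiff ℝ ∞ q) (hqc : HasCompactSupport q) (hqt : tsupport q ⊆ e.target) :
    ContMDiff 𝓘(ℝ, Cn n) 𝓘(ℝ, F) ∞ (e.source.indicator (q ∘ e)) ∧
      HasCompactSupport (e.source.indicator (q ∘ e)) := by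
  set K := e.symm '' tsupport q with hK
  have hKc : IsCompact K := hqc.isCompact.image_of_continuousOn (e.continuousOn_symm.mono hqt)
  have hout : ∀ m ∉ K, e.source.indicator (q ∘ e) m = 0 := fun m hm => by
    by_cases hs : m ∈ e.source
    · rw [Set.indicator_of_mem hs, Function.comp_apply]
      exact image_eq_zero_of_notMem_tsupport fun h => hm ⟨e m, h, e.left_inv hs⟩
    · exact Set.indicator_of_notMem hs _
  refine ⟨fun m => ?_, HasCompactSupport.intro hKc hout⟩
  by_cases hm : m ∈ e.source
  · have h1 : ContMDiffAt 𝓘(ℝ, Cn n) 𝓘(ℝ, F) ∞ (q ∘ e) m :=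
      hq.contMDiff.contMDiffAt.comp m
        (((contMDiffOn_of_mem_maximalAtlas (holCharts_subset_real he)).of_le
          le_top).contMDiffAt (e.open_source.mem_nhds hm))
    refine h1.congr_of_eventuallyEq ?_
    filter_upwards [e.open_source.mem_nhds hm] with y hy
    exact Set.indicator_of_mem hy _
  · have hmK : m ∉ K := by
      rintro ⟨z, hz, rfl⟩
      exact hm (e.map_target (hqt hz))
    refine contMDiffAt_const (c := (0 : F)).congr_of_eventuallyEq ?_
    filter_upwards [hKc.isClosed.isOpen_compl.mem_nhds hmK] with y hy
    exact hout y hy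

theorem exists_contDiff_one_on_compact {K U : Set (Cn n)} (hK : IsCompact K) (hU : IsOpen U)
    (hKU : K ⊆ U) : ∃ β : Cn n → ℝ, ContDiff ℝ ∞ β ∧ HasCompactSupport β ∧ tsupport β ⊆ U ∧
      ∀ z ∈ K, β z = 1 := by
  obtain ⟨L, hL, hKL, hLU⟩ := exists_compact_between hK hU hKU
  obtain ⟨f, h1, h2, -⟩ := exists_contMDiffMap_one_nhds_of_subset_interior 𝓘(ℝ, Cn n) (n := ⊤)
    hK.isClosed hKL
  have hts : tsupport f ⊆ L := closure_minimal (fun z hz => by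
    by_contra h
    exact hz (h2 z h)) hL.isClosed
  exact ⟨f, f.contMDiff.contDiff, hL.of_isClosed_subset (isClosed_tsupport _) hts, hts.trans hLU,
    fun z hz => h1.self_of_nhdsSet z hz⟩

/-- The weight times a cutoff, extended by zero to `M`, vanishes on `∂Ω` and is Lipschitz for the
Riemannian distance. This turns the growth condition into boundedness of `f R^k`. -/
theorem IsCornerFrame.exists_cornerWeight_le {e : OpenPartialHomeomorph M (Cn n)}
    (he : e ∈ holCharts n M) {U : Set (Cn n)} {S : Finset (Fin N)} {r : Fin N → Cn n → ℝ}
    {a : Fin N → Cn n → Cn n} (hd : IsCornerFrame U (chartImage e Ω) S r a) (hΩ : IsOpen Ω)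
    (hUt : U ⊆ e.target) {K : Set (Cn n)} (hK : IsCompact K) (hKU : K ⊆ U) :
    ∃ C, 0 ≤ C ∧ ∀ z ∈ K, |cornerWeight S r z| ≤ C * boundaryDist n Ω (e.symm z) := by
  obtain ⟨β, hβ, hβc, hβU, hβK⟩ := exists_contDiff_one_on_compact hK hd.isOpen hKU
  have hR := contDiff_cornerWeight S hd.contDiff_r
  have hts : tsupport (fun z => β z * cornerWeight S r z) ⊆ tsupport β :=
    closure_mono (Function.support_mul_subset_left β _)
  obtain ⟨hg1, hg2⟩ := contMDiff_extend_chart he (hβ.mul hR)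
    (hβc.of_isClosed_subset (isClosed_tsupport _) hts) ((hts.trans hβU).trans hUt)
  set g := e.source.indicator ((fun z => β z * cornerWeight S r z) ∘ e) with hg
  obtain ⟨C, hC⟩ := exists_edist_le_riemannianEDist (hg1.of_le (by simp)) hg2
  obtain ⟨B, hB⟩ := hK.exists_bound_of_continuousOn hR.continuous.continuousOn
  -- A boundary point in the frame is not in `Ω`, so some `r j ≥ 0`; it is in the closure, so also
  -- `r j ≤ 0`. One factor of the weight vanishes.
  have hfr : ∀ w ∈ frontier Ω, g w = 0 := fun w hw => by
    by_cases hws : w ∈ e.source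
    · rw [hg, Set.indicator_of_mem hws, Function.comp_apply]
      by_cases hwU : e w ∈ U
      · have hew : e.symm (e w) = w := e.left_inv hws
        rw [hΩ.frontier_eq] at hw
        have h1 : e w ∉ chartImage e Ω := fun h => hw.2 (by
          have := h.2
          rwa [mem_preimage, hew] at this)
        rw [hd.mem_iff _ hwU] at h1
        push Not at h1
        obtain ⟨j, hj, hj0⟩ := h1
        have h2 : r j (e w) ≤ 0 := nonpos_of_symm_mem_closure (e := e) (D := Ω) hd.isOpen hUt
          (hd.contDiff_r j).continuous.continuousOn
          (fun z hz h => (hd.mem_iff z hz).1 ⟨hUt hz, h⟩ j hj) hwU (by rw [hew]; exact hw.1)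
        have h3 : cornerWeight S r (e w) = 0 := Finset.prod_eq_zero hj (le_antisymm h2 hj0)
        simp [h3]
      · have : β (e w) = 0 := image_eq_zero_of_notMem_tsupport fun h => hwU (hβU h)
        simp [this]
    · exact Set.indicator_of_notMem hws _
  -- `C` is the Lipschitz constant, `B` takes care of the truncation of the distance at `1`, and the
  -- summand `1` makes the constant positive for the division.
  set C' : NNReal := C + Real.toNNReal B + 1 with hC'
  refine ⟨C', C'.2, fun z hz => ?_⟩
  have hgz : g (e.symm z) = cornerWeight S r z := by
    have hzt := hUt (hKU hz)
    rw [hg, Set.indicator_of_mem (e.map_target hzt), Function.comp_apply, e.right_inv hzt,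
      hβK z hz, one_mul]
  have hle : ‖cornerWeight S r z‖ₑ / C' ≤
      min 1 (⨅ w ∈ frontier Ω, riemannianEDist 𝓘(ℝ, Cn n) (e.symm z) w) := by
    refine le_min ?_ (le_iInf₂ fun w hw => ?_)
    · refine ENNReal.div_le_of_le_mul ?_
      rw [one_mul, ← ofReal_norm, ← ENNReal.ofReal_coe_nnreal]
      refine ENNReal.ofReal_le_ofReal ((hB z hz).trans ?_)
      rw [hC']
      push_cast
      have := Real.le_coe_toNNReal B
      have := C.2
      linarith
    · refine ENNReal.div_le_of_le_mul ?_
      have h1 := hC (e.symm z) w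
      rw [hgz, hfr w hw, zero_sub, enorm_neg] at h1
      refine h1.trans ?_
      rw [mul_comm]
      gcongr
      rw [hC', add_assoc]
      exact le_self_add
  have htop : min 1 (⨅ w ∈ frontier Ω, riemannianEDist 𝓘(ℝ, Cn n) (e.symm z) w) ≠ ⊤ :=
    ne_top_of_le_ne_top ENNReal.one_ne_top (min_le_left _ _)
  have h2 := ENNReal.toReal_mono htop hle
  rw [ENNReal.toReal_div, toReal_enorm, ENNReal.coe_toReal, Real.norm_eq_abs] at h2
  have hpos : (0 : ℝ) < C' := by
    have : (0 : NNReal) < C' := lt_of_lt_of_le zero_lt_one le_add_self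
    exact_mod_cast this
  rw [div_le_iff₀ hpos] at h2
  rw [mul_comm]
  exact h2

end LocalGeometry

/-! ### Localization of integrals of forms -/

section Localization

variable {n N : ℕ}

theorem IsCornerFrame.mono {U U' W : Set (Cn n)} {S : Finset (Fin N)} {r : Fin N → Cn n → ℝ}
    {a : Fin N → Cn n → Cn n} (hd : IsCornerFrame U W S r a) (hU' : IsOpen U') (h : U' ⊆ U) :
    IsCornerFrame U' W S r a :=
  ⟨hU', hd.isOpen_domain, hd.contDiff_r, hd.contDiff_a, fun z hz => hd.dual z (h hz),
    fun z hz => hd.mem_iff z (h hz)⟩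

variable {M : Type*} [TopologicalSpace M] [ChartedSpace (Cn n) M]

/-- A smooth function `α` with compact support in a coordinate chart, with a corner frame for `Ω`
near its support. -/
structure CornerPiece (n : ℕ) {M : Type*} [TopologicalSpace M] [ChartedSpace (Cn n) M] {N : ℕ}
    (D : Fin N → Set M) (Ω : Set M) where
  /-- The center of the chart. -/
  x : M
  /-- The domain of the corner frame. -/
  U : Set (Cn n)
  /-- The indices of the hypersurfaces in the corner. -/
  S : Finset (Fin N)
  /-- The defining functions. -/
  r : Fin N → Cn n → ℝ
  /-- The dual vector fields. -/
  a : Fin N → Cn n → Cn n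
  /-- The cutoff function. -/
  α : Cn n → ℂ
  frame : IsCornerFrame U (chartImage (chartAt (Cn n) x) Ω) S r a
  U_subset : U ⊆ (chartAt (Cn n) x).target
  mem_iff : ∀ j ∈ S, ∀ z ∈ U, ((chartAt (Cn n) x).symm z ∈ D j ↔ r j z < 0)
  contDiff : ContDiff ℝ ∞ α
  hasCompactSupport : HasCompactSupport α
  tsupport_subset : tsupport α ⊆ U

variable {D : Fin N → Set M} {Ω : Set M}

namespace CornerPiece

/-- The chart of a corner piece. -/
abbrev e (P : CornerPiece n D Ω) : OpenPartialHomeomorph M (Cn n) := chartAt (Cn n) P.x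

/-- The image of the domain in the chart of a corner piece. -/
abbrev W (P : CornerPiece n D Ω) : Set (Cn n) := chartImage P.e Ω

/-- The coefficient of a form, cut off by `α`. -/
def coeff (P : CornerPiece n D Ω) (φ : TopForm n M) (y : Cn n) : ℂ := P.α y * formCoeff P.e φ y

end CornerPiece

theorem isClosed_inter_symm_preimage {M : Type*} [TopologicalSpace M]
    {e : OpenPartialHomeomorph M (Cn n)} {L : Set (Cn n)}
    (hL : IsClosed L) (hLe : L ⊆ e.target) {A : Set M} (hA : IsClosed A) :
    IsClosed (L ∩ e.symm ⁻¹' A) :=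
  (e.continuousOn_symm.mono hLe).preimage_isClosed_of_isClosed hL hA

theorem TestForm.contDiffOn_formCoeff (φ : TestForm n M) {e : OpenPartialHomeomorph M (Cn n)}
    (he : e ∈ holCharts n M) : ContDiffOn ℝ ∞ (formCoeff e φ.form) e.target :=
  (φ : testFormSubmodule n M).2.1 e he

theorem TestForm.isCompact_supp (φ : TestForm n M) : IsCompact φ.supp :=
  (φ : testFormSubmodule n M).2.2

theorem TestForm.isClosed_supp (φ : TestForm n M) : IsClosed φ.supp := isClosed_tsupport _

theorem TestForm.formCoeff_eq_zero (φ : TestForm n M) (e : OpenPartialHomeomorph M (Cn n))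
    {y : Cn n} (hy : e.symm y ∉ φ.supp) : formCoeff e φ.form y = 0 := by
  rw [formCoeff, image_eq_zero_of_notMem_tsupport hy]
  rfl

namespace CornerPiece

theorem tsupport_coeff_subset (P : CornerPiece n D Ω) (φ : TestForm n M) :
    tsupport (P.coeff φ.form) ⊆ tsupport P.α ∩ P.e.symm ⁻¹' φ.supp := by
  refine closure_minimal (fun y hy => ?_) (isClosed_inter_symm_preimage (isClosed_tsupport _)
    (P.tsupport_subset.trans P.U_subset) φ.isClosed_supp)
  refine ⟨subset_tsupport _ fun h => hy ?_, ?_⟩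
  · rw [coeff, h, zero_mul]
  · by_contra h
    exact hy (by rw [coeff, φ.formCoeff_eq_zero _ h, mul_zero])

theorem hasCompactSupport_coeff (P : CornerPiece n D Ω) (φ : TestForm n M) :
    HasCompactSupport (P.coeff φ.form) :=
  P.hasCompactSupport.of_isClosed_subset (isClosed_tsupport _)
    ((P.tsupport_coeff_subset φ).trans inter_subset_left)

theorem tsupport_coeff_subset_U (P : CornerPiece n D Ω) (φ : TestForm n M) :
    tsupport (P.coeff φ.form) ⊆ P.U :=
  ((P.tsupport_coeff_subset φ).trans inter_subset_left).trans P.tsupport_subset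

variable [IsManifold 𝓘(ℂ, Cn n) ω M]

theorem contDiff_coeff (P : CornerPiece n D Ω) (φ : TestForm n M) :
    ContDiff ℝ ∞ (P.coeff φ.form) :=
  contDiff_mul_of_tsupport_subset P.e.open_target P.contDiff
    (P.tsupport_subset.trans P.U_subset) (φ.contDiffOn_formCoeff (chartAt_mem_holCharts P.x))

end CornerPiece

theorem differentiableOn_comp_symm {e : OpenPartialHomeomorph M (Cn n)} (he : e ∈ holCharts n M)
    {u : M → ℂ} {O : Set M} (hu : MDifferentiableOn 𝓘(ℂ, Cn n) 𝓘(ℂ, ℂ) u (Ω ∩ O)) :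
    DifferentiableOn ℂ (u ∘ e.symm) (chartImage e Ω ∩ chartImage e O) := by
  rw [← mdifferentiableOn_iff_differentiableOn]
  have h1 : MDifferentiableOn 𝓘(ℂ, Cn n) 𝓘(ℂ, Cn n) e.symm e.target :=
    (contMDiffOn_symm_of_mem_maximalAtlas he).mdifferentiableOn (by simp)
  exact hu.comp (h1.mono fun _ hz => hz.1.1) fun _ hz => ⟨hz.1.2, hz.2.2⟩

theorem continuousOn_comp_symm {M : Type*} [TopologicalSpace M]
    {e : OpenPartialHomeomorph M (Cn n)} {Ω : Set M} {u : M → ℂ} {O : Set M} (hu : ContinuousOn u (Ω ∩ O)) :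
    ContinuousOn (u ∘ e.symm) (chartImage e Ω ∩ chartImage e O) :=
  hu.comp (e.continuousOn_symm.mono fun _ hz => hz.1.1) fun _ hz => ⟨hz.1.2, hz.2.2⟩

/-- The function `u` vanishes outside `Ω`, is continuous on `Ω` near the support of `φ`, and is
bounded on that support. -/
structure IsTameOn (Ω : Set M) (u : M → ℂ) (φ : TestForm n M) : Prop where
  eq_zero : ∀ z ∉ Ω, u z = 0
  continuousOn : ∃ O, IsOpen O ∧ φ.supp ⊆ O ∧ ContinuousOn u (Ω ∩ O)
  bounded : ∃ C, ∀ z ∈ Ω ∩ φ.supp, ‖u z‖ ≤ C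

theorem CornerPiece.integrableOn_mul_coeff [IsManifold 𝓘(ℂ, Cn n) ω M] (P : CornerPiece n D Ω)
    {u : M → ℂ} {φ : TestForm n M} (hu : IsTameOn Ω u φ) :
    IntegrableOn (fun y => u (P.e.symm y) * P.coeff φ.form y) P.W := by
  obtain ⟨O, hO, hφO, huO⟩ := hu.continuousOn
  obtain ⟨C, hC⟩ := hu.bounded
  have hts := P.tsupport_coeff_subset φ
  have hK : IsCompact (tsupport (P.coeff φ.form)) := P.hasCompactSupport_coeff φ
  obtain ⟨B, hB⟩ := hK.exists_bound_of_continuousOn (P.contDiff_coeff φ).continuous.continuousOn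
  have h1 := integrableOn_mul_of_bound (W := P.W) (O := chartImage P.e O) (C := C * B)
    P.frame.isOpen_domain (continuousOn_comp_symm (e := P.e) huO) hK
    (fun z hz => ⟨P.U_subset (P.tsupport_coeff_subset_U φ hz), hφO (hts hz).2⟩)
    (P.contDiff_coeff φ).continuous fun z hz => by
      rw [norm_mul]
      have h2 := hC _ ⟨hz.1.2, (hts hz.2).2⟩
      exact mul_le_mul h2 (hB z hz.2) (norm_nonneg _) ((norm_nonneg _).trans h2)
  refine h1.of_forall_sdiff_eq_zero P.frame.isOpen_domain.measurableSet fun z hz => ?_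
  rw [image_eq_zero_of_notMem_tsupport fun h => hz.2 ⟨hz.1, h⟩, mul_zero]

variable [IsManifold 𝓘(ℂ, Cn n) ω M] [T2Space M] [SigmaCompactSpace M]

theorem tsupport_chartPartition_subset (x : M) :
    tsupport (chartPartition n M x) ⊆ (chartAt (Cn n) x).source :=
  (SmoothPartitionOfUnity.exists_isSubordinate_chartAt_source 𝓘(ℝ, Cn n) M).choose_spec x

/-- The part of the partition of unity belonging to one chart, cut into corner pieces. -/
theorem IsDomainWithGenericCorners.exists_cornerPieces_chart
    (hΩ : IsDomainWithGenericCorners (n := n) D Ω) (x : M) :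
    ∃ (T : Finset (Cn n)) (P : T → CornerPiece n D Ω), (∀ i, (P i).x = x) ∧
      ∀ y ∈ chartImage (chartAt (Cn n) x) Ω, ∑ i, (P i).α y =
        (chartPartition n M x ((chartAt (Cn n) x).symm y) : ℂ) := by
  set e := chartAt (Cn n) x with he'
  have he : e ∈ holCharts n M := chartAt_mem_holCharts x
  -- Only the part of the chart that meets `closure Ω` has to be covered, and that part is compact.
  set A : Set M := tsupport (chartPartition n M x) ∩ closure Ω with hA
  have hAc : IsCompact A := hΩ.isCompact_closure.inter_left (isClosed_tsupport _)
  have hAs : A ⊆ e.source := inter_subset_left.trans (tsupport_chartPartition_subset x)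
  set K := e '' A with hK
  have hKc : IsCompact K := hAc.image_of_continuousOn (e.continuousOn.mono hAs)
  have hKt : K ⊆ e.target := by
    rintro _ ⟨p, hp, rfl⟩
    exact e.map_source (hAs hp)
  have hfr : ∀ z : K, ∃ (U : Set (Cn n)) (S : Finset (Fin N)) (r : Fin N → Cn n → ℝ)
      (a : Fin N → Cn n → Cn n), IsCornerFrame U (chartImage e Ω) S r a ∧ (z : Cn n) ∈ U ∧
        U ⊆ e.target ∧ Bornology.IsBounded U ∧
        ∀ j ∈ S, ∀ z ∈ U, (e.symm z ∈ D j ↔ r j z < 0) := by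
    rintro ⟨_, p, hp, rfl⟩
    obtain ⟨U, S, r, a, h1, h2, h3, h4⟩ := hΩ.exists_isCornerFrame hp.2 he (hAs hp)
    -- The frames are shrunk to bounded sets so that the cutoff functions get compact support.
    exact ⟨U ∩ Metric.ball (e p) 1, S, r, a,
      h1.mono (h1.isOpen.inter Metric.isOpen_ball) inter_subset_left,
      ⟨h2, Metric.mem_ball_self one_pos⟩, inter_subset_left.trans h3,
      Metric.isBounded_ball.subset inter_subset_right, fun j hj z hz => h4 j hj z hz.1⟩
  choose U S r a hframe hzU hUt hUb hmem using hfr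
  obtain ⟨τ, hτ⟩ := SmoothPartitionOfUnity.exists_isSubordinate 𝓘(ℝ, Cn n) hKc.isClosed U
    (fun z => (hframe z).isOpen) fun z hz => mem_iUnion.2 ⟨⟨z, hz⟩, hzU ⟨z, hz⟩⟩
  have hfin : {z : K | (Function.support (τ z) ∩ K).Nonempty}.Finite :=
    τ.locallyFinite.finite_nonempty_inter_compact hKc
  have hρ : ContDiffOn ℝ ∞ (fun y => (chartPartition n M x (e.symm y) : ℂ)) e.target := by
    have h1 : ContDiffOn ℝ ∞ (chartPartition n M x ∘ e.symm) (chartImage e univ) :=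
      contDiffOn_comp_symm he (chartPartition n M x).contMDiff.contMDiffOn
    have h2 : chartImage e univ = e.target := by simp [chartImage]
    rw [h2] at h1
    exact Complex.ofRealCLM.contDiff.comp_contDiffOn h1
  have hτs : ∀ z, ContDiff ℝ ∞ fun y => (τ z y : ℂ) := fun z =>
    contDiff_ofReal_comp (τ z).contMDiff.contDiff
  have hτt : ∀ z, tsupport (fun y => (τ z y : ℂ)) ⊆ U z := fun z => by
    refine (closure_mono fun y hy => ?_).trans (hτ z)
    intro h
    exact hy (by simp [h])
  have hmul : ∀ z, tsupport (fun y => (τ z y : ℂ) * (chartPartition n M x (e.symm y) : ℂ)) ⊆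
      tsupport (fun y => (τ z y : ℂ)) := fun z => closure_mono (Function.support_mul_subset_left _ _)
  let P : K → CornerPiece n D Ω := fun z =>
    { x := x
      U := U z
      S := S z
      r := r z
      a := a z
      α := fun y => (τ z y : ℂ) * (chartPartition n M x (e.symm y) : ℂ)
      frame := hframe z
      U_subset := hUt z
      mem_iff := hmem z
      contDiff := contDiff_mul_of_tsupport_subset e.open_target (hτs z)
        ((hτt z).trans (hUt z)) hρ
      hasCompactSupport := Metric.isCompact_of_isClosed_isBounded (isClosed_tsupport _)
        ((hUb z).subset ((hmul z).trans (hτt z)))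
      tsupport_subset := (hmul z).trans (hτt z) }
  classical
  set T : Finset (Cn n) := hfin.toFinset.map ⟨Subtype.val, Subtype.val_injective⟩ with hT
  have hTK : ∀ z ∈ T, z ∈ K := fun z hz => by
    obtain ⟨w, -, rfl⟩ := Finset.mem_map.1 hz
    exact w.2
  refine ⟨T, fun i => P ⟨i, hTK i i.2⟩, fun i => rfl, fun y hy => ?_⟩
  -- The functions `τ z` sum to one only on `K`. Points of the image of `Ω` outside `K` are
  -- harmless, because `chartPartition` vanishes there.
  by_cases h0 : chartPartition n M x (e.symm y) = 0
  · simp [P, h0]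
  · have hyK : y ∈ K := ⟨e.symm y, ⟨subset_tsupport _ h0, subset_closure hy.2⟩, e.right_inv hy.1⟩
    have h1 := τ.sum_eq_one hyK
    have h2 : ∑ᶠ z, τ z y = ∑ z ∈ hfin.toFinset, τ z y := by
      refine finsum_eq_sum_of_support_subset _ fun z hz => ?_
      simp only [Finite.coe_toFinset, mem_ofPred_eq]
      exact ⟨y, hz, hyK⟩
    rw [h2] at h1
    have h3 : ∑ i : T, τ ⟨i, hTK i i.2⟩ y = 1 := by
      rw [← h1]
      refine Finset.sum_bij' (fun i _ => ⟨i, hTK i i.2⟩) (fun z hz => ⟨z.1, ?_⟩) ?_ ?_ ?_ ?_ ?_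
      · exact Finset.mem_map.2 ⟨z, hz, rfl⟩
      · intro i _
        obtain ⟨w, hw, hwi⟩ := Finset.mem_map.1 i.2
        have : (⟨i, hTK i i.2⟩ : K) = w := Subtype.ext hwi.symm
        rw [this]
        exact hw
      · intro _ _
        exact Finset.mem_univ _
      · intro _ _
        rfl
      · intro _ _
        rfl
      · intro _ _
        rfl
    simp only [P]
    rw [← Finset.sum_mul, ← Complex.ofReal_sum, h3, Complex.ofReal_one, one_mul]

/-- Integrals of forms over a domain with generic corners are sums of integrals over finitely many
corner pieces. -/
theorem IsDomainWithGenericCorners.exists_cornerPieces {M : Type*} [TopologicalSpace M]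
    [ChartedSpace (Cn n) M] [IsManifold 𝓘(ℂ, Cn n) ω M] [T2Space M] [SigmaCompactSpace M]
    {D : Fin N → Set M} {Ω : Set M} (hΩ : IsDomainWithGenericCorners (n := n) D Ω) :
    ∃ (m : ℕ) (P : Fin m → CornerPiece n D Ω), ∀ (u : M → ℂ) (φ : TestForm n M), IsTameOn Ω u φ →
      formIntegral u φ =
        ∑ i, ∫ y in (P i).W, u ((P i).e.symm y) * (P i).coeff φ.form y := by
  choose T P hPx hPα using fun x => hΩ.exists_cornerPieces_chart x
  have hfin : {x : M | (Function.support (chartPartition n M x) ∩ closure Ω).Nonempty}.Finite :=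
    (chartPartition n M).locallyFinite.finite_nonempty_inter_compact hΩ.isCompact_closure
  let s := Fintype.equivFin (Σ x : hfin.toFinset, T x)
  refine ⟨_, fun i => P (s.symm i).1 (s.symm i).2, fun u φ hu => ?_⟩
  -- As `u` vanishes outside `Ω`, only the finitely many charts whose partition function is not zero
  -- on `closure Ω` contribute.
  have h1 : formIntegral u φ = ∑ x ∈ hfin.toFinset, chartIntegral (chartAt (Cn n) x)
      (fun z => (chartPartition n M x z : ℂ) * u z) φ.form := by
    refine finsum_eq_sum_of_support_subset _ fun x hx => ?_
    simp only [Finite.coe_toFinset, mem_ofPred_eq]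
    by_contra hne
    refine hx ?_
    have h2 : ∀ z, (chartPartition n M x z : ℂ) * u z = 0 := fun z => by
      by_cases hz : z ∈ Ω
      · have : chartPartition n M x z = 0 := by
          by_contra h
          exact hne ⟨z, h, subset_closure hz⟩
        simp [this]
      · rw [hu.eq_zero z hz, mul_zero]
    simp [chartIntegral, h2]
  have h3 : ∀ x, chartIntegral (chartAt (Cn n) x)
      (fun z => (chartPartition n M x z : ℂ) * u z) φ.form =
        ∑ i, ∫ y in (P x i).W, u ((P x i).e.symm y) * (P x i).coeff φ.form y := by
    intro x
    set e := chartAt (Cn n) x with he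
    have hW : ∀ i, (P x i).W = chartImage e Ω := fun i => by
      simp only [CornerPiece.W, CornerPiece.e, hPx, he]
    have hf : ∀ i, (fun y => u ((P x i).e.symm y) * (P x i).coeff φ.form y) =
        fun y => u (e.symm y) * ((P x i).α y * formCoeff e φ.form y) := fun i => by
      funext y
      simp only [CornerPiece.coeff, CornerPiece.e, hPx, he]
    have hint : ∀ i, IntegrableOn
        (fun y => u (e.symm y) * ((P x i).α y * formCoeff e φ.form y)) (chartImage e Ω) :=
      fun i => by
        have := (P x i).integrableOn_mul_coeff hu
        rwa [hf i, hW i] at this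
    simp only [hf, hW]
    rw [← integral_finsetSum _ fun i _ => hint i, chartIntegral]
    have hsub : ∀ y ∈ e.target \ chartImage e Ω,
        (chartPartition n M x (e.symm y) : ℂ) * u (e.symm y) * formCoeff e φ.form y = 0 := by
      intro y hy
      rw [hu.eq_zero _ fun h => hy.2 ⟨hy.1, h⟩]
      simp
    have hmeas := e.open_target.measurableSet
    rw [setIntegral_eq_of_subset_of_forall_sdiff_eq_zero hmeas inter_subset_left hsub]
    refine setIntegral_congr_fun (isOpen_chartImage e hΩ.isOpen).measurableSet fun y hy => ?_
    rw [← Finset.mul_sum, ← Finset.sum_mul, hPα x y hy]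
    ring
  rw [h1, s.symm.sum_comp fun q : (Σ x : hfin.toFinset, T x) => ∫ y in (P q.1 q.2).W,
    u ((P q.1 q.2).e.symm y) * (P q.1 q.2).coeff φ.form y, Fintype.sum_sigma, ← Finset.sum_coe_sort]
  exact Finset.sum_congr rfl fun x _ => h3 x

end Localization

/-! ### Linear maps out of inductive limits -/

/-- The topology pulled back from `E` by `L` is one of the locally convex topologies in the infimum,
so the inductive limit topology is finer. -/
theorem continuous_of_lcInductiveTopology {ι F E : Type*} [AddCommGroup F] [Module ℂ F]
    {G : ι → Type*} (t : ∀ i, TopologicalSpace (G i)) (incl : ∀ i, G i → F) [AddCommGroup E]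
    [Module ℂ E] [tE : TopologicalSpace E] [IsTopologicalAddGroup E] [ContinuousSMul ℂ E]
    [LocallyConvexSpace ℝ E] (L : F →ₗ[ℂ] E) (h : ∀ i, Continuous fun g => L (incl i g)) :
    @Continuous _ _ (lcInductiveTopology t incl) _ L := by
  refine continuous_sInf_dom (t := TopologicalSpace.induced L tE) ⟨fun i => ?_, ?_, ?_, ?_⟩
    continuous_induced_dom
  · exact continuous_induced_rng.2 (h i)
  · exact topologicalAddGroup_induced L
  · exact continuousSMul_induced L
  · exact LocallyConvexSpace.induced (L.restrictScalars ℝ)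

/-! ### Linearity of Bell's operator -/

section Linear

variable {n N : ℕ}

theorem vecDiv_add {a : Cn n → Cn n} (ha : ContDiff ℝ ∞ a) {F G : Cn n → ℂ}
    (hF : ContDiff ℝ ∞ F) (hG : ContDiff ℝ ∞ G) :
    vecDiv a (F + G) = vecDiv a F + vecDiv a G := by
  funext z
  have h : ∀ {H : Cn n → ℂ}, ContDiff ℝ ∞ H → ∀ m,
      DifferentiableAt ℝ (fun y => (starRingEnd ℂ) (a y m) * H y) z := fun hH m =>
    (((contDiff_conj_coord ha m).mul hH).differentiable (by simp)).differentiableAt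
  simp only [vecDiv, Pi.add_apply, mul_add]
  rw [← Finset.sum_add_distrib]
  exact Finset.sum_congr rfl fun m _ => dbar_add (h hF m) (h hG m) _

theorem vecDiv_smul {a : Cn n → Cn n} (ha : ContDiff ℝ ∞ a) (c : ℂ) {F : Cn n → ℂ}
    (hF : ContDiff ℝ ∞ F) : vecDiv a (c • F) = c • vecDiv a F := by
  funext z
  have h := vecDiv_mul (z := z) ha (differentiableAt_const c)
    (hF.differentiable (by simp)).differentiableAt
  rw [dbar_const, zero_mul, zero_add] at h
  exact h

variable {a : Fin N → Cn n → Cn n}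

theorem cornerOp_add (ha : ∀ j, ContDiff ℝ ∞ (a j)) (l : List (Fin N)) {F G : Cn n → ℂ}
    (hF : ContDiff ℝ ∞ F) (hG : ContDiff ℝ ∞ G) :
    cornerOp a l (F + G) = cornerOp a l F + cornerOp a l G := by
  induction l with
  | nil => rfl
  | cons j l ih =>
    change vecDiv (a j) (cornerOp a l (F + G)) = _
    rw [ih, vecDiv_add (ha j) (contDiff_cornerOp ha l hF) (contDiff_cornerOp ha l hG)]
    rfl

theorem cornerOp_smul (ha : ∀ j, ContDiff ℝ ∞ (a j)) (l : List (Fin N)) (c : ℂ) {F : Cn n → ℂ}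
    (hF : ContDiff ℝ ∞ F) : cornerOp a l (c • F) = c • cornerOp a l F := by
  induction l with
  | nil => rfl
  | cons j l ih =>
    change vecDiv (a j) (cornerOp a l (c • F)) = _
    rw [ih, vecDiv_smul (ha j) c (contDiff_cornerOp ha l hF)]
    rfl

theorem iterate_cornerOp_add (ha : ∀ j, ContDiff ℝ ∞ (a j)) (l : List (Fin N)) (k : ℕ)
    {F G : Cn n → ℂ} (hF : ContDiff ℝ ∞ F) (hG : ContDiff ℝ ∞ G) :
    (cornerOp a l)^[k] (F + G) = (cornerOp a l)^[k] F + (cornerOp a l)^[k] G := by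
  induction k with
  | zero => rfl
  | succ k ih =>
    simp only [Function.iterate_succ_apply']
    rw [ih, cornerOp_add ha l (contDiff_iterate_cornerOp ha l k hF)
      (contDiff_iterate_cornerOp ha l k hG)]

theorem iterate_cornerOp_smul (ha : ∀ j, ContDiff ℝ ∞ (a j)) (l : List (Fin N)) (k : ℕ) (c : ℂ)
    {F : Cn n → ℂ} (hF : ContDiff ℝ ∞ F) :
    (cornerOp a l)^[k] (c • F) = c • (cornerOp a l)^[k] F := by
  induction k with
  | zero => rfl
  | succ k ih =>
    simp only [Function.iterate_succ_apply']
    rw [ih, cornerOp_smul ha l c (contDiff_iterate_cornerOp ha l k hF)]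

end Linear

/-! ### Bell's operator on test forms -/

section BellMap

variable {n N : ℕ} {M : Type*} [TopologicalSpace M] [ChartedSpace (Cn n) M]
  {D : Fin N → Set M} {Ω : Set M}

theorem CornerPiece.coeff_add (P : CornerPiece n D Ω) (φ ψ : TestForm n M) :
    P.coeff (φ + ψ).form = P.coeff φ.form + P.coeff ψ.form := by
  funext y
  change P.α y * (formCoeff P.e φ.form y + formCoeff P.e ψ.form y) = _
  rw [mul_add]
  rfl

theorem CornerPiece.coeff_smul (P : CornerPiece n D Ω) (c : ℂ) (φ : TestForm n M) :
    P.coeff (c • φ).form = c • P.coeff φ.form := by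
  funext y
  change P.α y * (c * formCoeff P.e φ.form y) = c * (P.α y * formCoeff P.e φ.form y)
  ring

namespace CornerPiece

/-- Bell's operator, iterated `k` times, on the coefficient of a form in a corner piece. -/
def bellCoeff (P : CornerPiece n D Ω) (k : ℕ) (φ : TestForm n M) : Cn n → ℂ :=
  (cornerOp P.a P.S.toList)^[k] (P.coeff φ.form)

theorem tsupport_bellCoeff_subset (P : CornerPiece n D Ω) (k : ℕ) (φ : TestForm n M) :
    tsupport (P.bellCoeff k φ) ⊆ tsupport (P.coeff φ.form) :=
  tsupport_iterate_cornerOp_subset _ _ k _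

theorem bellCoeff_eq_zero (P : CornerPiece n D Ω) (k : ℕ) (φ : TestForm n M) {z : Cn n}
    (hz : z ∉ tsupport P.α) : P.bellCoeff k φ z = 0 :=
  image_eq_zero_of_notMem_tsupport fun h => hz
    (P.tsupport_coeff_subset φ (P.tsupport_bellCoeff_subset k φ h)).1

theorem tendstoUniformlyOn_iteratedFDeriv_formCoeff {K : TopologicalSpace.Compacts M}
    (φ₀ : TestFormOn n K) {e : OpenPartialHomeomorph M (Cn n)} (he : e ∈ holCharts n M)
    {L : Set (Cn n)} (hL : IsCompact L) (hLe : L ⊆ e.target) (m : ℕ) :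
    TendstoUniformlyOn (fun φ : TestFormOn n K => iteratedFDeriv ℝ m (formCoeff e φ.1.form))
      (iteratedFDeriv ℝ m (formCoeff e φ₀.1.form)) (𝓝 φ₀) L := by
  have h : Continuous fun φ : TestFormOn n K =>
      UniformOnFun.ofFun {L : Set (Cn n) | IsCompact L ∧ L ⊆ e.target}
        (iteratedFDeriv ℝ m (formCoeff e φ.1.form)) :=
    continuous_iInf_dom (i := ⟨e, he⟩) (continuous_iInf_dom (i := m) continuous_induced_dom)
  exact (UniformOnFun.tendsto_iff_tendstoUniformlyOn.1 (h.tendsto φ₀)) L ⟨hL, hLe⟩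

variable [IsManifold 𝓘(ℂ, Cn n) ω M]

theorem contDiff_bellCoeff (P : CornerPiece n D Ω) (k : ℕ) (φ : TestForm n M) :
    ContDiff ℝ ∞ (P.bellCoeff k φ) :=
  contDiff_iterate_cornerOp P.frame.contDiff_a _ k (P.contDiff_coeff φ)

theorem exists_norm_bellCoeff_le (P : CornerPiece n D Ω) (k : ℕ) :
    ∃ m C, 0 ≤ C ∧ ∀ φ : TestForm n M, ∀ z ∈ tsupport P.α,
      ‖P.bellCoeff k φ z‖ ≤ C * jetNorm m (formCoeff P.e φ.form) z := by
  obtain ⟨m, C, hC, h⟩ := exists_norm_iterate_cornerOp_mul_le P.e.open_target P.contDiff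
    P.hasCompactSupport (P.tsupport_subset.trans P.U_subset) P.frame.contDiff_a P.S.toList k
  exact ⟨m, C, hC, fun φ z hz =>
    h _ (φ.contDiffOn_formCoeff (chartAt_mem_holCharts P.x)) z hz⟩

theorem bellCoeff_add (P : CornerPiece n D Ω) (k : ℕ) (φ ψ : TestForm n M) :
    P.bellCoeff k (φ + ψ) = P.bellCoeff k φ + P.bellCoeff k ψ := by
  rw [bellCoeff, coeff_add, iterate_cornerOp_add P.frame.contDiff_a _ k (P.contDiff_coeff φ)
    (P.contDiff_coeff ψ)]
  rfl

theorem bellCoeff_smul (P : CornerPiece n D Ω) (k : ℕ) (c : ℂ) (φ : TestForm n M) :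
    P.bellCoeff k (c • φ) = c • P.bellCoeff k φ := by
  rw [bellCoeff, coeff_smul, iterate_cornerOp_smul P.frame.contDiff_a _ k c (P.contDiff_coeff φ)]
  rfl

theorem exists_forall_norm_bellCoeff_le (P : CornerPiece n D Ω) (k : ℕ) (φ : TestForm n M) :
    ∃ C, ∀ z, ‖P.bellCoeff k φ z‖ ≤ C := by
  have hc : HasCompactSupport (P.bellCoeff k φ) :=
    (P.hasCompactSupport_coeff φ).of_isClosed_subset (isClosed_tsupport _)
      (P.tsupport_bellCoeff_subset k φ)
  obtain ⟨C, hC⟩ := hc.isCompact.exists_bound_of_continuousOn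
    (P.contDiff_bellCoeff k φ).continuous.continuousOn
  refine ⟨max C 0, fun z => ?_⟩
  by_cases hz : z ∈ tsupport (P.bellCoeff k φ)
  · exact (hC z hz).trans (le_max_left _ _)
  · rw [image_eq_zero_of_notMem_tsupport hz, norm_zero]
    exact le_max_right _ _

open BoundedContinuousFunction in
/-- `P.bellCoeff k` as a linear map to the bounded continuous functions. -/
def bellLinear (P : CornerPiece n D Ω) (k : ℕ) : TestForm n M →ₗ[ℂ] (Cn n →ᵇ ℂ) where
  toFun φ := BoundedContinuousFunction.ofNormedAddCommGroup (P.bellCoeff k φ)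
    (P.contDiff_bellCoeff k φ).continuous _ (P.exists_forall_norm_bellCoeff_le k φ).choose_spec
  map_add' φ ψ := by
    ext z
    exact congrFun (P.bellCoeff_add k φ ψ) z
  map_smul' c φ := by
    ext z
    exact congrFun (P.bellCoeff_smul k c φ) z

theorem bellLinear_apply (P : CornerPiece n D Ω) (k : ℕ) (φ : TestForm n M) (z : Cn n) :
    P.bellLinear k φ z = P.bellCoeff k φ z := rfl

/-- On forms with support in a fixed `K`, Bell's operator is controlled by finitely many derivatives
of the coefficient on the compact set `tsupport α`, and these depend continuously on the form. -/
theorem continuous_bellLinear (P : CornerPiece n D Ω) (k : ℕ) : Continuous (P.bellLinear k) := by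
  refine continuous_of_lcInductiveTopology _ _ _ fun K => continuous_iff_continuousAt.2 fun φ₀ => ?_
  obtain ⟨m, C, hC, hb⟩ := P.exists_norm_bellCoeff_le k
  have he := chartAt_mem_holCharts (n := n) P.x
  have hsub := P.tsupport_subset.trans P.U_subset
  rw [ContinuousAt, Metric.tendsto_nhds]
  intro ε hε
  -- The jet norm is a sum of `m` terms, each less than `δ`.
  obtain ⟨δ, hδ, hδε⟩ : ∃ δ : ℝ, 0 < δ ∧ C * (m * δ) < ε := by
    refine ⟨ε / (2 * (C * m + 1)), by positivity, ?_⟩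
    have : 0 ≤ C * m := by positivity
    rw [show C * (m * (ε / (2 * (C * m + 1)))) = (C * m) * ε / (2 * (C * m + 1)) by ring,
      div_lt_iff₀ (by positivity)]
    nlinarith
  have hev : ∀ᶠ φ : TestFormOn n K in 𝓝 φ₀, ∀ i ∈ Finset.range m, ∀ z ∈ tsupport P.α,
      dist (iteratedFDeriv ℝ i (formCoeff P.e φ₀.1.form) z)
        (iteratedFDeriv ℝ i (formCoeff P.e φ.1.form) z) < δ :=
    (Finset.eventually_all _).2 fun i _ => Metric.tendstoUniformlyOn_iff.1
      (tendstoUniformlyOn_iteratedFDeriv_formCoeff φ₀ he P.hasCompactSupport hsub i) δ hδ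
  filter_upwards [hev] with φ hφ
  refine lt_of_le_of_lt ?_ hδε
  rw [dist_eq_norm, ← map_sub, BoundedContinuousFunction.norm_le (by positivity)]
  intro z
  rw [bellLinear_apply]
  by_cases hz : z ∈ tsupport P.α
  · refine (hb _ z hz).trans (mul_le_mul_of_nonneg_left ?_ hC)
    refine (Finset.sum_le_card_nsmul _ _ δ fun i hi => ?_).trans (by simp)
    have hzt : P.e.target ∈ 𝓝 z := P.e.open_target.mem_nhds (hsub hz)
    have h1 : formCoeff P.e (φ.1 - φ₀.1).form = formCoeff P.e φ.1.form - formCoeff P.e φ₀.1.form :=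
      rfl
    have hcd : ∀ ψ : TestForm n M, ContDiffAt ℝ i (formCoeff P.e ψ.form) z := fun ψ =>
      ((ψ.contDiffOn_formCoeff he).contDiffAt hzt).of_le (by exact_mod_cast le_top)
    rw [h1, iteratedFDeriv_sub_apply (hcd _) (hcd _), ← dist_eq_norm, dist_comm]
    exact (hφ i hi z hz).le
  · rw [P.bellCoeff_eq_zero k _ hz, norm_zero]
    positivity

end CornerPiece

end BellMap

/-! ### Canonical extensions as distributions -/

section CanonicalExtension

variable {n N : ℕ} {M : Type*} [TopologicalSpace M] [ChartedSpace (Cn n) M]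
  {D : Fin N → Set M} {Ω : Set M}

theorem isContinuousRiemannianBundle_of_contMDiff
    [Bundle.RiemannianBundle (fun x : M => TangentSpace 𝓘(ℝ, Cn n) x)]
    [IsManifold 𝓘(ℝ, Cn n) 1 M]
    [h : IsContMDiffRiemannianBundle 𝓘(ℝ, Cn n) ∞ (Cn n)
      (fun x : M => TangentSpace 𝓘(ℝ, Cn n) x)] :
    IsContinuousRiemannianBundle (Cn n) (fun x : M => TangentSpace 𝓘(ℝ, Cn n) x) := by
  obtain ⟨g, hg, hgi⟩ := h.exists_contMDiff
  exact ⟨g, hg.continuous, hgi⟩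

theorem MDifferentiableOn.continuousOn_comp_symm_chartImage {u : M → ℂ}
    {e : OpenPartialHomeomorph M (Cn n)} (hu : MDifferentiableOn 𝓘(ℂ, Cn n) 𝓘(ℂ, ℂ) u Ω) :
    ContinuousOn (fun z => u (e.symm z)) (chartImage e Ω) :=
  hu.continuousOn.comp (e.continuousOn_symm.mono inter_subset_left) fun _ hz => hz.2

theorem GrowthSpace.norm_mul_le [Bundle.RiemannianBundle (fun x : M => TangentSpace 𝓘(ℝ, Cn n) x)]
    {k : ℕ} (f : GrowthSpace n Ω k) {z : M} (hz : z ∈ Ω) :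
    ‖f.fn z‖ * boundaryDist n Ω z ^ k ≤ ‖f‖ :=
  le_ciSup f.bddAbove ⟨z, hz⟩

theorem GrowthSpace.fn_mem [Bundle.RiemannianBundle (fun x : M => TangentSpace 𝓘(ℝ, Cn n) x)]
    {k : ℕ} (f : GrowthSpace n Ω k) : f.fn ∈ growthSubmodule n Ω k :=
  (f : growthSubmodule n Ω k).2

/-- An element of `𝒜^{-k}(Ω)` from the function it represents. -/
def GrowthSpace.ofMem [Bundle.RiemannianBundle (fun x : M => TangentSpace 𝓘(ℝ, Cn n) x)]
    {k : ℕ} {u : M → ℂ} (hu : u ∈ growthSubmodule n Ω k) : GrowthSpace n Ω k :=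
  (⟨u, hu⟩ : growthSubmodule n Ω k)

theorem PolyGrowth.add_fn [Bundle.RiemannianBundle (fun x : M => TangentSpace 𝓘(ℝ, Cn n) x)]
    (f g : PolyGrowth n Ω) : (f + g).fn = f.fn + g.fn := rfl

theorem PolyGrowth.smul_fn [Bundle.RiemannianBundle (fun x : M => TangentSpace 𝓘(ℝ, Cn n) x)]
    (c : ℂ) (f : PolyGrowth n Ω) : (c • f).fn = c • f.fn := rfl

theorem PolyGrowth.exists_mem_growthSubmodule
    [Bundle.RiemannianBundle (fun x : M => TangentSpace 𝓘(ℝ, Cn n) x)] (f : PolyGrowth n Ω) :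
    ∃ k, f.fn ∈ growthSubmodule n Ω k :=
  mem_iUnion.1 (f : polyGrowthSubmodule n Ω).2

namespace CornerPiece

/-- The pairing of a function on `Ω` with a bounded continuous function in a corner piece, with the
`k`-th power of the corner weight. -/
def weightedPairing (P : CornerPiece n D Ω) (k : ℕ) (u : M → ℂ) (b : Cn n → ℂ) : ℂ :=
  (bellConst P.S.card k)⁻¹ * ∫ z in P.W ∩ tsupport P.α,
    u (P.e.symm z) * (((cornerWeight P.S P.r z ^ k : ℝ) : ℂ) * b z)

theorem weightedPairing_bellCoeff (P : CornerPiece n D Ω) (k : ℕ) (u : M → ℂ) (φ : TestForm n M) :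
    P.weightedPairing k u (P.bellCoeff k φ) =
      bellPairing P.W P.S P.r P.a k (fun z => u (P.e.symm z)) (P.coeff φ.form) := by
  rw [weightedPairing, bellPairing, setIntegral_eq_inter_tsupport (ψ := P.α) P.frame.isOpen_domain]
  · rfl
  · intro z hz
    have := P.bellCoeff_eq_zero k φ hz
    rw [bellCoeff] at this
    rw [this, mul_zero]

variable [IsManifold 𝓘(ℂ, Cn n) ω M]

variable [T2Space M] [Bundle.RiemannianBundle (fun x : M => TangentSpace 𝓘(ℝ, Cn n) x)]
  [IsContinuousRiemannianBundle (Cn n) (fun x : M => TangentSpace 𝓘(ℝ, Cn n) x)]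

/-- The `k`-th power of `|R| ≤ C dist(·, ∂Ω)`. The constant does not depend on `u`, as continuity in
`f` requires. -/
theorem exists_norm_mul_cornerWeight_le (P : CornerPiece n D Ω) (hΩ : IsOpen Ω) (k : ℕ) :
    ∃ C, 0 ≤ C ∧ ∀ (u : M → ℂ) (B : ℝ), (∀ z ∈ Ω, ‖u z‖ * boundaryDist n Ω z ^ k ≤ B) →
      ∀ z ∈ P.W ∩ tsupport P.α, ‖u (P.e.symm z)‖ * |cornerWeight P.S P.r z| ^ k ≤ C * B := by
  obtain ⟨C, hC, h⟩ := P.frame.exists_cornerWeight_le (chartAt_mem_holCharts P.x) hΩ P.U_subset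
    P.hasCompactSupport P.tsupport_subset
  refine ⟨C ^ k, pow_nonneg hC k, fun u B hu z hz => ?_⟩
  calc ‖u (P.e.symm z)‖ * |cornerWeight P.S P.r z| ^ k
      ≤ ‖u (P.e.symm z)‖ * (C * boundaryDist n Ω (P.e.symm z)) ^ k := by
        gcongr
        exact h z hz.2
    _ = C ^ k * (‖u (P.e.symm z)‖ * boundaryDist n Ω (P.e.symm z) ^ k) := by ring
    _ ≤ C ^ k * B := by
        gcongr
        exact hu _ hz.1.2

theorem norm_mul_le_of_bound {x y : ℂ} {r A B : ℝ} {k : ℕ} (hx : ‖x‖ * |r| ^ k ≤ A)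
    (hy : ‖y‖ ≤ B) : ‖x * (((r ^ k : ℝ) : ℂ) * y)‖ ≤ A * B := by
  rw [← mul_assoc, norm_mul, norm_mul, Complex.norm_real, Real.norm_eq_abs, abs_pow]
  exact mul_le_mul hx hy (norm_nonneg _) ((by positivity : (0 : ℝ) ≤ ‖x‖ * |r| ^ k).trans hx)

theorem integrableOn_weighted (P : CornerPiece n D Ω) (hΩ : IsOpen Ω) {k : ℕ} {u : M → ℂ}
    (hu : u ∈ growthSubmodule n Ω k) (b : BoundedContinuousFunction (Cn n) ℂ) :
    IntegrableOn (fun z => u (P.e.symm z) * (((cornerWeight P.S P.r z ^ k : ℝ) : ℂ) * b z))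
      (P.W ∩ tsupport P.α) := by
  obtain ⟨-, h1, B, hB⟩ := hu
  obtain ⟨C, -, hC⟩ := P.exists_norm_mul_cornerWeight_le hΩ k
  refine integrableOn_mul_of_bound (O := univ) (C := C * B * ‖b‖) P.frame.isOpen_domain
    (by rw [inter_univ]; exact h1.continuousOn_comp_symm_chartImage) P.hasCompactSupport
    (subset_univ _) ?_ fun z hz => norm_mul_le_of_bound (hC u B hB z hz) (b.norm_coe_le_norm z)
  exact (Complex.continuous_ofReal.comp
    ((contDiff_cornerWeight P.S P.frame.contDiff_r).continuous.pow k)).mul b.continuous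

/-- The integrand is bounded by `C ‖f‖ ‖b‖` on a set of finite volume. -/
theorem exists_norm_weightedPairing_le (P : CornerPiece n D Ω) (hΩ : IsOpen Ω) (k : ℕ) :
    ∃ C, 0 ≤ C ∧ ∀ (f : GrowthSpace n Ω k) (b : BoundedContinuousFunction (Cn n) ℂ),
      ‖P.weightedPairing k f.fn b‖ ≤ C * ‖f‖ * ‖b‖ := by
  obtain ⟨C, hC0, hC⟩ := P.exists_norm_mul_cornerWeight_le hΩ k
  set V := volume.real (P.W ∩ tsupport P.α) with hV
  have hVtop : volume (P.W ∩ tsupport P.α) < ⊤ :=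
    (measure_mono inter_subset_right).trans_lt P.hasCompactSupport.isCompact.measure_lt_top
  refine ⟨‖(bellConst P.S.card k)⁻¹‖ * C * V, by positivity, fun f b => ?_⟩
  rw [weightedPairing, norm_mul]
  have h1 : ‖∫ z in P.W ∩ tsupport P.α,
      f.fn (P.e.symm z) * (((cornerWeight P.S P.r z ^ k : ℝ) : ℂ) * b z)‖ ≤ C * ‖f‖ * ‖b‖ * V :=
    norm_setIntegral_le_of_norm_le_const hVtop fun z hz =>
      norm_mul_le_of_bound (hC f.fn ‖f‖ (fun z hz => f.norm_mul_le hz) z hz) (b.norm_coe_le_norm z)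
  calc _ ≤ ‖(bellConst P.S.card k)⁻¹‖ * (C * ‖f‖ * ‖b‖ * V) := by gcongr
    _ = _ := by ring

/-- The pairing with an element of `𝒜^{-k}(Ω)` in a corner piece, as a functional on the bounded
continuous functions. -/
def weightedPairingCLM (P : CornerPiece n D Ω) (hΩ : IsOpen Ω) (k : ℕ) (f : GrowthSpace n Ω k) :
    BoundedContinuousFunction (Cn n) ℂ →L[ℂ] ℂ :=
  LinearMap.mkContinuousOfExistsBound
    { toFun := fun b => P.weightedPairing k f.fn b
      map_add' := fun b b' => by
        simp only [weightedPairing, BoundedContinuousFunction.coe_add, Pi.add_apply, mul_add]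
        rw [integral_add (P.integrableOn_weighted hΩ f.fn_mem b)
          (P.integrableOn_weighted hΩ f.fn_mem b'), mul_add]
      map_smul' := fun c b => by
        simp only [weightedPairing, BoundedContinuousFunction.coe_smul, smul_eq_mul,
          RingHom.id_apply]
        rw [mul_left_comm, ← integral_const_mul c]
        refine congrArg _ (congrArg _ (funext fun z => ?_))
        ring }
    ((P.exists_norm_weightedPairing_le hΩ k).elim fun C hC => ⟨C * ‖f‖, hC.2 f⟩)

theorem weightedPairingCLM_apply (P : CornerPiece n D Ω) (hΩ : IsOpen Ω) (k : ℕ)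
    (f : GrowthSpace n Ω k) (b : BoundedContinuousFunction (Cn n) ℂ) :
    P.weightedPairingCLM hΩ k f b = P.weightedPairing k f.fn b := rfl

theorem weightedPairingCLM_add (P : CornerPiece n D Ω) (hΩ : IsOpen Ω) (k : ℕ)
    (f g : GrowthSpace n Ω k) :
    P.weightedPairingCLM hΩ k (f + g) =
      P.weightedPairingCLM hΩ k f + P.weightedPairingCLM hΩ k g := by
  ext b
  simp only [weightedPairingCLM_apply, weightedPairing, add_apply]
  rw [← mul_add, ← integral_add (P.integrableOn_weighted hΩ f.fn_mem b)
    (P.integrableOn_weighted hΩ g.fn_mem b)]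
  refine congrArg _ (congrArg _ (funext fun z => ?_))
  rw [← add_mul]
  rfl

theorem continuous_weightedPairingCLM (P : CornerPiece n D Ω) (hΩ : IsOpen Ω) (k : ℕ) :
    Continuous (P.weightedPairingCLM hΩ k) := by
  obtain ⟨C, hC0, hC⟩ := P.exists_norm_weightedPairing_le hΩ k
  exact AddMonoidHomClass.continuous_of_bound
    (AddMonoidHom.mk' (P.weightedPairingCLM hΩ k) (P.weightedPairingCLM_add hΩ k)) C
    fun f => ContinuousLinearMap.opNorm_le_bound _ (by positivity) (hC f)

/-- `P.bellCoeff k` as a continuous linear map. -/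
def bellCLM {M : Type*} [TopologicalSpace M] [ChartedSpace (Cn n) M] [IsManifold 𝓘(ℂ, Cn n) ω M]
    {D : Fin N → Set M} {Ω : Set M} (P : CornerPiece n D Ω) (k : ℕ) :
    TestForm n M →L[ℂ] BoundedContinuousFunction (Cn n) ℂ :=
  ⟨P.bellLinear k, P.continuous_bellLinear k⟩

end CornerPiece

variable [IsManifold 𝓘(ℂ, Cn n) ω M] [T2Space M]
  [Bundle.RiemannianBundle (fun x : M => TangentSpace 𝓘(ℝ, Cn n) x)]
  [IsContinuousRiemannianBundle (Cn n) (fun x : M => TangentSpace 𝓘(ℝ, Cn n) x)] {m : ℕ}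

/-- The sum of Bell's regularized pairings over a family of corner pieces, on `𝒜^{-k}(Ω)`. -/
def bellExtension (P : Fin m → CornerPiece n D Ω) (hΩ : IsOpen Ω) (k : ℕ)
    (f : GrowthSpace n Ω k) : DistributionSpace n M :=
  ∑ i, ((P i).weightedPairingCLM hΩ k f).comp ((P i).bellCLM k)

theorem bellExtension_apply (P : Fin m → CornerPiece n D Ω) (hΩ : IsOpen Ω) (k : ℕ)
    (f : GrowthSpace n Ω k) (φ : TestForm n M) :
    bellExtension P hΩ k f φ = ∑ i, bellPairing (P i).W (P i).S (P i).r (P i).a k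
      (fun z => f.fn ((P i).e.symm z)) ((P i).coeff φ.form) := by
  rw [bellExtension, sum_apply]
  exact Finset.sum_congr rfl fun i _ => (P i).weightedPairing_bellCoeff k f.fn φ

theorem bellExtension_add (P : Fin m → CornerPiece n D Ω) (hΩ : IsOpen Ω) (k : ℕ)
    (f g : GrowthSpace n Ω k) :
    bellExtension P hΩ k (f + g) = bellExtension P hΩ k f + bellExtension P hΩ k g := by
  simp only [bellExtension, CornerPiece.weightedPairingCLM_add, ContinuousLinearMap.add_comp]
  exact Finset.sum_add_distrib

/-- The dependence on `f` factors through the normed dual of the bounded continuous functions.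
Precomposition with the fixed map `bellCLM` is continuous from there to the strong dual of the test
forms. -/
theorem continuous_bellExtension (P : Fin m → CornerPiece n D Ω) (hΩ : IsOpen Ω) (k : ℕ) :
    Continuous (bellExtension P hΩ k) :=
  continuous_finsetSum _ fun i _ => (ContinuousLinearMap.precomp ℂ ((P i).bellCLM k)).continuous.comp
    ((P i).continuous_weightedPairingCLM hΩ k)

theorem sum_bellPairing_eq_of_mem_growthSubmodule (P : Fin m → CornerPiece n D Ω) (hΩ : IsOpen Ω)
    {u : M → ℂ} {k l : ℕ} (hu : u ∈ growthSubmodule n Ω k) (hkl : k ≤ l) (φ : TestForm n M) :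
    ∑ i, bellPairing (P i).W (P i).S (P i).r (P i).a l
      (fun z => u ((P i).e.symm z)) ((P i).coeff φ.form) =
    ∑ i, bellPairing (P i).W (P i).S (P i).r (P i).a k
      (fun z => u ((P i).e.symm z)) ((P i).coeff φ.form) := by
  refine Finset.sum_congr rfl fun i _ => ?_
  obtain ⟨-, h1, B, hB⟩ := hu
  obtain ⟨C, -, hC⟩ := (P i).exists_norm_mul_cornerWeight_le hΩ k
  have h2 := differentiableOn_comp_symm (Ω := Ω) (O := univ)
    (chartAt_mem_holCharts (n := n) (P i).x) (h1.mono inter_subset_left)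
  refine (P i).frame.bellPairing_eq (isOpen_chartImage _ isOpen_univ) h2 ((P i).contDiff_coeff φ)
    ((P i).hasCompactSupport_coeff φ) ((P i).tsupport_coeff_subset_U φ)
    (fun z hz => ⟨(P i).U_subset ((P i).tsupport_coeff_subset_U φ hz), mem_univ _⟩) hkl
    fun z hz => hC u B hB z ⟨hz.1, ((P i).tsupport_coeff_subset φ hz.2).1⟩

/-- If `u` has growth of both orders, the pairing of the larger order reduces to that of the smaller
one. -/
theorem bellExtension_eq (P : Fin m → CornerPiece n D Ω) (hΩ : IsOpen Ω) {u : M → ℂ} {k l : ℕ}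
    (hk : u ∈ growthSubmodule n Ω k) (hl : u ∈ growthSubmodule n Ω l) :
    bellExtension P hΩ k (.ofMem hk) = bellExtension P hΩ l (.ofMem hl) := by
  ext φ
  rw [bellExtension_apply, bellExtension_apply]
  rcases le_total k l with h | h
  · exact (sum_bellPairing_eq_of_mem_growthSubmodule P hΩ hk h φ).symm
  · exact sum_bellPairing_eq_of_mem_growthSubmodule P hΩ hl h φ

theorem bellExtension_ofMem_apply (P : Fin m → CornerPiece n D Ω) (hΩ : IsOpen Ω) {u : M → ℂ}
    {k : ℕ} (hu : u ∈ growthSubmodule n Ω k) (φ : TestForm n M) :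
    bellExtension P hΩ k (.ofMem hu) φ = ∑ i, bellPairing (P i).W (P i).S (P i).r (P i).a k
      (fun z => u ((P i).e.symm z)) ((P i).coeff φ.form) :=
  bellExtension_apply P hΩ k (.ofMem hu) φ

theorem bellExtension_ofMem_add (P : Fin m → CornerPiece n D Ω) (hΩ : IsOpen Ω) {u v : M → ℂ}
    {k : ℕ} (hu : u ∈ growthSubmodule n Ω k) (hv : v ∈ growthSubmodule n Ω k) :
    bellExtension P hΩ k (.ofMem (add_mem hu hv)) =
      bellExtension P hΩ k (.ofMem hu) + bellExtension P hΩ k (.ofMem hv) :=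
  bellExtension_add P hΩ k (.ofMem hu) (.ofMem hv)

theorem bellExtension_ofMem_smul (P : Fin m → CornerPiece n D Ω) (hΩ : IsOpen Ω) (c : ℂ) {u : M → ℂ}
    {k : ℕ} (hu : u ∈ growthSubmodule n Ω k) :
    bellExtension P hΩ k (.ofMem (Submodule.smul_mem _ c hu)) =
      c • bellExtension P hΩ k (.ofMem hu) := by
  ext φ
  rw [smul_apply, bellExtension_ofMem_apply, bellExtension_ofMem_apply, smul_eq_mul,
    Finset.mul_sum]
  refine Finset.sum_congr rfl fun i _ => ?_
  rw [bellPairing, bellPairing, mul_left_comm, ← integral_const_mul c]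
  refine congrArg _ (congrArg _ (funext fun z => ?_))
  exact mul_assoc c _ _

/-- The canonical extension of an element of `𝒜^{-∞}(Ω)`. -/
def canonicalExtensionFun (P : Fin m → CornerPiece n D Ω) (hΩ : IsOpen Ω) (f : PolyGrowth n Ω) :
    DistributionSpace n M :=
  bellExtension P hΩ _ (.ofMem f.exists_mem_growthSubmodule.choose_spec)

/-- The order chosen in the definition may be replaced by any other admissible one. The function is
a variable `u` so that the lemma also applies to sums and multiples with their own membership
proofs. -/
theorem canonicalExtensionFun_eq (P : Fin m → CornerPiece n D Ω) (hΩ : IsOpen Ω)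
    (f : PolyGrowth n Ω) {u : M → ℂ} (hu : f.fn = u) {k : ℕ} (hk : u ∈ growthSubmodule n Ω k) :
    canonicalExtensionFun P hΩ f = bellExtension P hΩ k (.ofMem hk) := by
  subst hu
  exact bellExtension_eq P hΩ _ hk

/-- The canonical extension on `𝒜^{-∞}(Ω)`, as a linear map. -/
def canonicalExtensionLinear (P : Fin m → CornerPiece n D Ω) (hΩ : IsOpen Ω) :
    PolyGrowth n Ω →ₗ[ℂ] DistributionSpace n M where
  toFun f := canonicalExtensionFun P hΩ f
  map_add' f g := by
    obtain ⟨k, hk⟩ := f.exists_mem_growthSubmodule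
    obtain ⟨l, hl⟩ := g.exists_mem_growthSubmodule
    have hk' := growthSubmodule_mono Ω (le_max_left k l) hk
    have hl' := growthSubmodule_mono Ω (le_max_right k l) hl
    rw [canonicalExtensionFun_eq P hΩ f rfl hk', canonicalExtensionFun_eq P hΩ g rfl hl',
      canonicalExtensionFun_eq P hΩ _ (PolyGrowth.add_fn f g) (add_mem hk' hl'),
      bellExtension_ofMem_add]
  map_smul' c f := by
    obtain ⟨k, hk⟩ := f.exists_mem_growthSubmodule
    rw [canonicalExtensionFun_eq P hΩ f rfl hk, canonicalExtensionFun_eq P hΩ _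
      (PolyGrowth.smul_fn c f) (Submodule.smul_mem _ c hk), bellExtension_ofMem_smul,
      RingHom.id_apply]

theorem continuous_canonicalExtensionLinear (P : Fin m → CornerPiece n D Ω) (hΩ : IsOpen Ω) :
    Continuous (canonicalExtensionLinear P hΩ) := by
  refine continuous_of_lcInductiveTopology _ _ _ fun k => ?_
  have h : (fun f : GrowthSpace n Ω k => canonicalExtensionLinear P hΩ f.toPolyGrowth) =
      bellExtension P hΩ k :=
    funext fun f => canonicalExtensionFun_eq P hΩ f.toPolyGrowth rfl f.fn_mem
  rw [h]
  exact continuous_bellExtension P hΩ k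

/-- The canonical extension on `𝒜^{-∞}(Ω)`. -/
def canonicalExtension (P : Fin m → CornerPiece n D Ω) (hΩ : IsOpen Ω) :
    PolyGrowth n Ω →L[ℂ] DistributionSpace n M :=
  ⟨canonicalExtensionLinear P hΩ, continuous_canonicalExtensionLinear P hΩ⟩

theorem canonicalExtension_apply (P : Fin m → CornerPiece n D Ω) (hΩ : IsOpen Ω)
    (f : PolyGrowth n Ω) {k : ℕ} (hk : f.fn ∈ growthSubmodule n Ω k) (φ : TestForm n M) :
    canonicalExtension P hΩ f φ = ∑ i, bellPairing (P i).W (P i).S (P i).r (P i).a k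
      (fun z => f.fn ((P i).e.symm z)) ((P i).coeff φ.form) :=
  (congrArg (fun T : DistributionSpace n M => T φ) (canonicalExtensionFun_eq P hΩ f rfl hk)).trans
    (bellExtension_ofMem_apply P hΩ hk φ)

end CanonicalExtension

/-! ### Canonical extensions of bounded functions -/

section Bounded

variable {n N : ℕ} {M : Type*} [TopologicalSpace M] [ChartedSpace (Cn n) M]
  [IsManifold 𝓘(ℂ, Cn n) ω M] [T2Space M] [SigmaCompactSpace M] {D : Fin N → Set M} {Ω : Set M}

/-- The integral of `u φ` for tame `u` is the sum of the integrals over the corner pieces `P i`. -/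
def ComputesIntegral {m : ℕ} (P : Fin m → CornerPiece n D Ω) : Prop :=
  ∀ (u : M → ℂ) (φ : TestForm n M), IsTameOn Ω u φ →
    formIntegral u φ = ∑ i, ∫ y in (P i).W, u ((P i).e.symm y) * (P i).coeff φ.form y

variable {m : ℕ} {P : Fin m → CornerPiece n D Ω}

/-- On the support of `φ` a tame function has growth of order zero, and pairings of all orders agree
with that of order `0`. Holomorphy is needed only near the support, which is what shifted functions
offer. -/
theorem ComputesIntegral.formIntegral_eq_sum_bellPairing (hP : ComputesIntegral P) {u : M → ℂ}
    {φ : TestForm n M} (hu : IsTameOn Ω u φ) {O : Set M} (hO : IsOpen O) (hφO : φ.supp ⊆ O)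
    (huO : MDifferentiableOn 𝓘(ℂ, Cn n) 𝓘(ℂ, ℂ) u (Ω ∩ O)) (k : ℕ) :
    formIntegral u φ = ∑ i, bellPairing (P i).W (P i).S (P i).r (P i).a k
      (fun z => u ((P i).e.symm z)) ((P i).coeff φ.form) := by
  rw [hP u φ hu]
  refine Finset.sum_congr rfl fun i _ => ?_
  obtain ⟨C, hC⟩ := hu.bounded
  have hts := (P i).tsupport_coeff_subset φ
  have h1 := (P i).frame.bellPairing_eq (h := fun z => u ((P i).e.symm z)) (C := C)
    (isOpen_chartImage _ hO)
    (differentiableOn_comp_symm (chartAt_mem_holCharts (n := n) (P i).x) huO)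
    ((P i).contDiff_coeff φ) ((P i).hasCompactSupport_coeff φ) ((P i).tsupport_coeff_subset_U φ)
    (fun z hz => ⟨(P i).U_subset ((P i).tsupport_coeff_subset_U φ hz), hφO (hts hz).2⟩)
    (Nat.zero_le k) fun z hz => by
      rw [pow_zero, mul_one]
      exact hC _ ⟨hz.1.2, (hts hz.2).2⟩
  rw [h1, bellPairing_zero]

/-- The two functions differ only on `∂Ω`, a null set in every chart. -/
theorem formIntegral_indicator_closure (hΩ : IsDomainWithGenericCorners (n := n) D Ω)
    {u g : M → ℂ} (hu : ∀ z ∉ Ω, u z = 0) (hg : EqOn g u Ω) (φ : TestForm n M) :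
    formIntegral ((closure Ω).indicator g) φ = formIntegral u φ := by
  refine finsum_congr fun x => ?_
  have hnull := hΩ.volume_chartImage_frontier (chartAt_mem_holCharts (n := n) x)
  refine setIntegral_congr_ae (chartAt (Cn n) x).open_target.measurableSet ?_
  filter_upwards [compl_mem_ae_iff.2 hnull] with y hy hyt
  have h : (closure Ω).indicator g ((chartAt (Cn n) x).symm y) =
      u ((chartAt (Cn n) x).symm y) := by
    by_cases h1 : (chartAt (Cn n) x).symm y ∈ Ω
    · rw [indicator_of_mem (subset_closure h1), hg h1]
    · rw [hu _ h1, indicator_of_notMem]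
      intro h2
      exact hy ⟨hyt, by rw [hΩ.isOpen.frontier_eq]; exact ⟨h2, h1⟩⟩
  rw [h]

variable [Bundle.RiemannianBundle (fun x : M => TangentSpace 𝓘(ℝ, Cn n) x)]
  [IsContinuousRiemannianBundle (Cn n) (fun x : M => TangentSpace 𝓘(ℝ, Cn n) x)]

/-- Boundedness on the support is the common reason for the restriction property and for the
extension by zero of continuous boundary values. -/
theorem canonicalExtension_eq_formIntegral (hP : ComputesIntegral P) (hΩ : IsOpen Ω)
    (f : PolyGrowth n Ω) {φ : TestForm n M} {C : ℝ} (hC : ∀ z ∈ Ω ∩ φ.supp, ‖f.fn z‖ ≤ C) :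
    canonicalExtension P hΩ f φ = formIntegral f.fn φ := by
  obtain ⟨k, hk⟩ := f.exists_mem_growthSubmodule
  have hd : MDifferentiableOn 𝓘(ℂ, Cn n) 𝓘(ℂ, ℂ) f.fn (Ω ∩ univ) := hk.2.1.mono inter_subset_left
  rw [canonicalExtension_apply P hΩ f hk, hP.formIntegral_eq_sum_bellPairing
    ⟨hk.1, ⟨univ, isOpen_univ, subset_univ _, hd.continuousOn⟩, C, hC⟩ isOpen_univ (subset_univ _)
    hd k]

theorem canonicalExtension_of_supp_subset (hP : ComputesIntegral P) (hΩ : IsOpen Ω)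
    (f : PolyGrowth n Ω) {φ : TestForm n M} (hφ : φ.supp ⊆ Ω) :
    canonicalExtension P hΩ f φ = formIntegral f.fn φ := by
  obtain ⟨k, hk⟩ := f.exists_mem_growthSubmodule
  obtain ⟨C, hC⟩ := φ.isCompact_supp.exists_bound_of_continuousOn (hk.2.1.continuousOn.mono hφ)
  exact canonicalExtension_eq_formIntegral hP hΩ f fun z hz => hC z hz.2

theorem canonicalExtension_of_continuousOn (hP : ComputesIntegral P)
    (hΩ : IsDomainWithGenericCorners (n := n) D Ω) (f : PolyGrowth n Ω) {g : M → ℂ}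
    (hg : ContinuousOn g (closure Ω)) (hgf : EqOn g f.fn Ω) (φ : TestForm n M) :
    canonicalExtension P hΩ.isOpen f φ = formIntegral ((closure Ω).indicator g) φ := by
  obtain ⟨k, hk⟩ := f.exists_mem_growthSubmodule
  obtain ⟨C, hC⟩ := hΩ.isCompact_closure.exists_bound_of_continuousOn hg
  rw [formIntegral_indicator_closure hΩ hk.1 hgf]
  refine canonicalExtension_eq_formIntegral hP hΩ.isOpen f (C := C) fun z hz => ?_
  rw [← hgf hz.1]
  exact hC z (subset_closure hz.1)

end Bounded

/-! ### Inward shifts -/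

section Shift

variable {n N : ℕ}

theorem tendsto_sub_smul (y v : Cn n) :
    Tendsto (fun p : Cn n × ℝ => p.1 - (p.2 : ℂ) • v) (𝓝 y ×ˢ 𝓝[>] 0) (𝓝 y) := by
  have h : Tendsto (fun p : Cn n × ℝ => p.1 - (p.2 : ℂ) • v) (𝓝 (y, 0)) (𝓝 (y - ((0 : ℝ) : ℂ) • v)) :=
    Continuous.tendsto (by fun_prop) (y, (0 : ℝ))
  rw [Complex.ofReal_zero, zero_smul, sub_zero, nhds_prod_eq] at h
  exact h.mono_left (prod_mono le_rfl nhdsWithin_le_nhds)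

/-- Near `y` the derivative along `v` stays positive, so `g` decreases strictly along the whole
segment. The base point and `ε` vary together in the product filter, so that compactness later gives
uniformity. -/
theorem eventually_lt_of_fderiv_pos {g : Cn n → ℝ} {O : Set (Cn n)} (hO : IsOpen O)
    (hg : ContDiffOn ℝ ∞ g O) {y v : Cn n} (hy : y ∈ O) (hv : 0 < fderiv ℝ g y v) :
    ∀ᶠ p : Cn n × ℝ in 𝓝 y ×ˢ 𝓝[>] 0, g (p.1 - (p.2 : ℂ) • v) < g p.1 := by
  have hcont : ContinuousOn (fun z => fderiv ℝ g z v) O :=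
    (hg.continuousOn_fderiv_of_isOpen hO (by simp)).clm_apply continuousOn_const
  have h1 : ∀ᶠ z in 𝓝 y, z ∈ O ∧ 0 < fderiv ℝ g z v :=
    Eventually.and (hO.mem_nhds hy) ((hcont.continuousAt (hO.mem_nhds hy)).eventually (lt_mem_nhds hv))
  obtain ⟨δ, hδ, hball⟩ := Metric.eventually_nhds_iff_ball.1 h1
  have hb : Metric.ball y δ ∈ 𝓝 y := Metric.ball_mem_nhds y hδ
  have h3 : ∀ᶠ p : Cn n × ℝ in 𝓝 y ×ˢ 𝓝[>] 0, p.1 ∈ Metric.ball y δ := tendsto_fst.eventually hb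
  have h4 : ∀ᶠ p : Cn n × ℝ in 𝓝 y ×ˢ 𝓝[>] 0, p.2 ∈ Ioi (0 : ℝ) :=
    tendsto_snd.eventually self_mem_nhdsWithin
  filter_upwards [(tendsto_sub_smul y v).eventually hb, h3, h4] with p hp1 hp2 hp3
  have hseg : ∀ t ∈ Icc 0 p.2, p.1 - t • v ∈ Metric.ball y δ := by
    intro t ht
    have h5 := (convex_ball y δ).add_smul_sub_mem hp2 hp1
      (t := t / p.2) ⟨div_nonneg ht.1 hp3.le, div_le_one_of_le₀ ht.2 hp3.le⟩
    convert h5 using 1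
    rw [sub_sub_cancel_left, smul_neg, ← sub_eq_add_neg, Complex.coe_smul, smul_smul,
      div_mul_cancel₀ _ (ne_of_gt hp3)]
  have hder : ∀ t ∈ Icc 0 p.2, HasDerivAt (fun t : ℝ => g (p.1 - t • v))
      (fderiv ℝ g (p.1 - t • v) (-v)) t := by
    intro t ht
    have h6 : DifferentiableAt ℝ g (p.1 - t • v) :=
      ((hg.differentiableOn (by simp)).differentiableAt
        (hO.mem_nhds (hball _ (hseg t ht)).1))
    have h7 : HasDerivAt (fun t : ℝ => p.1 - t • v) (-v) t := by
      simpa using ((hasDerivAt_id t).smul_const v).const_sub p.1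
    exact h6.hasFDerivAt.comp_hasDerivAt t h7
  have hanti : StrictAntiOn (fun t : ℝ => g (p.1 - t • v)) (Icc 0 p.2) := by
    refine strictAntiOn_of_deriv_neg (convex_Icc _ _)
      (fun t ht => (hder t ht).continuousAt.continuousWithinAt) fun t ht => ?_
    rw [interior_Icc] at ht
    have ht' := Ioo_subset_Icc_self ht
    rw [(hder t ht').deriv, map_neg, neg_lt_zero]
    exact (hball _ (hseg t ht')).2
  have h8 := hanti (left_mem_Icc.2 hp3.le) (right_mem_Icc.2 hp3.le) hp3
  simpa [Complex.coe_smul] using h8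

variable {M : Type*} [TopologicalSpace M]

/-- The shift by `-ε v` in the coordinates `e`. -/
def chartShift (e : OpenPartialHomeomorph M (Cn n)) (v : Cn n) (ε : ℝ) (z : M) : M :=
  e.symm (e z - (ε : ℂ) • v)

theorem tendsto_chart_sub_smul {e : OpenPartialHomeomorph M (Cn n)} (v : Cn n) {q : M}
    (hq : q ∈ e.source) :
    Tendsto (fun p : M × ℝ => e p.1 - (p.2 : ℂ) • v) (𝓝 q ×ˢ 𝓝[>] 0) (𝓝 (e q)) :=
  (tendsto_sub_smul (e q) v).comp ((e.continuousAt hq).tendsto.prodMap tendsto_id)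

theorem tendsto_chartShift {e : OpenPartialHomeomorph M (Cn n)} (v : Cn n) {q : M}
    (hq : q ∈ e.source) :
    Tendsto (fun p : M × ℝ => chartShift e v p.2 p.1) (𝓝 q ×ˢ 𝓝[>] 0) (𝓝 q) := by
  have h := (e.symm.continuousAt (e.map_source hq)).tendsto
  rw [e.left_inv hq] at h
  exact h.comp (tendsto_chart_sub_smul v hq)

theorem IsCornerFrame.fderiv_ne_zero {U W : Set (Cn n)} {S : Finset (Fin N)} {r : Fin N → Cn n → ℝ}
    {a : Fin N → Cn n → Cn n} (hd : IsCornerFrame U W S r a) {y : Cn n} (hy : y ∈ U) {j : Fin N}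
    (hj : j ∈ S) : fderiv ℝ (r j) y ≠ 0 := by
  intro h
  have h1 := hd.dual y hy j hj j hj
  have h2 : fderiv ℝ (fun z => (r j z : ℂ)) y = 0 := by
    have h3 := (Complex.ofRealCLM.hasFDerivAt.comp y
      ((hd.contDiff_r j).differentiable (by simp) y).hasFDerivAt).fderiv
    rw [h, ContinuousLinearMap.comp_zero] at h3
    exact h3
  rw [dbar, h2] at h1
  simp at h1

variable [ChartedSpace (Cn n) M] {D : Fin N → Set M} {Ω : Set M}

/-- Near a boundary point, an inward shift decreases the defining functions of a corner frame, up to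
a factor. -/
theorem IsCornerFrame.eventually_shift {e e' : OpenPartialHomeomorph M (Cn n)}
    (he : e ∈ holCharts n M) (he' : e' ∈ holCharts n M) {U : Set (Cn n)} {S : Finset (Fin N)}
    {r : Fin N → Cn n → ℝ} {a : Fin N → Cn n → Cn n}
    (hd : IsCornerFrame U (chartImage e' Ω) S r a)
    (hmem : ∀ j ∈ S, ∀ z ∈ U, (e'.symm z ∈ D j ↔ r j z < 0)) (hD : ∀ j, IsOpen (D j))
    (hΩD : ∀ j, Ω ⊆ D j) (hUt : U ⊆ e'.target) {q : M} (hq : q ∈ e.source) (hq' : q ∈ e'.source)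
    (hqU : e' q ∈ U) (hqΩ : q ∈ closure Ω) {v : Cn n}
    (hv : ∀ j, q ∈ frontier (D j) → PointsOutward e v (D j) q) {j : Fin N} (hj : j ∈ S) :
    ∀ᶠ p : M × ℝ in 𝓝 q ×ˢ 𝓝[>] 0, p.1 ∈ closure Ω →
      r j (e' (chartShift e v p.2 p.1)) < 0 ∧
        r j (e' (chartShift e v p.2 p.1)) ≤ r j (e' p.1) / 4 := by
  have hnonpos : ∀ z ∈ U, e'.symm z ∈ closure Ω → r j z ≤ 0 := fun z hz hzΩ =>
    nonpos_of_symm_mem_closure hd.isOpen hUt (hd.contDiff_r j).continuous.continuousOn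
      (fun y hy => (hmem j hj y hy).1) hz (closure_mono (hΩD j) hzΩ)
  have hq0 : r j (e' q) ≤ 0 := hnonpos _ hqU (by rwa [e'.left_inv hq'])
  have hcr : ContinuousAt (fun z => r j (e' z)) q :=
    (hd.contDiff_r j).continuous.continuousAt.comp (e'.continuousAt hq')
  rcases hq0.lt_or_eq with hlt | h0
  -- Here `q` lies inside `D j` and continuity suffices: the shifted value is below `r_j(q)/2`, and
  -- `r_j(p) > 2 r_j(q)`, so the former is below `r_j(p)/4`.
  · have h1 := (hcr.tendsto.comp (tendsto_chartShift v hq)).eventually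
      (gt_mem_nhds (show r j (e' q) < r j (e' q) / 2 by linarith))
    have h2 : ∀ᶠ p : M × ℝ in 𝓝 q ×ˢ 𝓝[>] 0, 2 * r j (e' q) < r j (e' p.1) :=
      (hcr.tendsto.comp tendsto_fst).eventually
        (lt_mem_nhds (show 2 * r j (e' q) < r j (e' q) by linarith))
    filter_upwards [h1, h2] with p hp1 hp2 _
    simp only [Function.comp_apply] at hp1
    constructor <;> linarith
  -- Here `q` lies on the boundary of `D j`, and the outward vector makes `r_j` decrease strictly.
  -- As `r_j(p) ≤ 0`, one has `r_j(p) ≤ r_j(p)/4`, so the factor is free.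
  · have hqD : q ∉ D j := fun h => by
      have := (hmem j hj _ hqU).1 (by rwa [e'.left_inv hq'])
      linarith
    have hqfr : q ∈ frontier (D j) := by
      rw [(hD j).frontier_eq]
      exact ⟨closure_mono (hΩD j) hqΩ, hqD⟩
    set O' : Set M := e'.source ∩ e' ⁻¹' U with hO'
    have hO'o : IsOpen O' := e'.isOpen_inter_preimage hd.isOpen
    have hsm : ContMDiffOn 𝓘(ℝ, Cn n) 𝓘(ℝ, ℝ) ∞ (r j ∘ e') O' := by
      have h1 : ContMDiffOn 𝓘(ℝ, Cn n) 𝓘(ℝ, Cn n) ∞ e' e'.source :=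
        (contMDiffOn_of_mem_maximalAtlas (holCharts_subset_real he')).of_le le_top
      exact (hd.contDiff_r j).contMDiff.comp_contMDiffOn (h1.mono inter_subset_left)
    have hdef : IsLocalDefiningFunction (n := n) (D j) q (r j ∘ e') := by
      refine isLocalDefiningFunction_of_fderiv_ne_zero hO'o ⟨hq', hqU⟩ hsm (fun z hz => ?_) he' hq' ?_
      · rw [Function.comp_apply, ← hmem j hj _ hz.2, e'.left_inv hz.1]
      · have h1 : ((r j ∘ e') ∘ e'.symm) =ᶠ[𝓝 (e' q)] r j := by
          filter_upwards [e'.open_target.mem_nhds (e'.map_source hq')] with z hz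
          simp only [Function.comp_apply, e'.right_inv hz]
        rw [h1.fderiv_eq]
        exact hd.fderiv_ne_zero hqU hj
    have hpos := (hv j hqfr).fderiv_pos he hq (hD j) hqfr hdef
    have hlt := eventually_lt_of_fderiv_pos (isOpen_chartImage e hO'o)
      (contDiffOn_comp_symm he hsm) (y := e q) (v := v)
      ⟨e.map_source hq, by rw [mem_preimage, e.left_inv hq]; exact ⟨hq', hqU⟩⟩ hpos
    have hlt' := (((e.continuousAt hq).tendsto.prodMap
      (tendsto_id (x := 𝓝[>] (0 : ℝ)))).eventually hlt)
    have hsrc : ∀ᶠ p : M × ℝ in 𝓝 q ×ˢ 𝓝[>] 0, p.1 ∈ e.source ∩ O' :=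
      tendsto_fst.eventually (inter_mem (e.open_source.mem_nhds hq) (hO'o.mem_nhds ⟨hq', hqU⟩))
    filter_upwards [hlt', hsrc] with p hp1 hp2 hpΩ
    simp only [Prod.map_fst, Prod.map_snd, id, Function.comp_apply, e.left_inv hp2.1] at hp1
    have h3 := hnonpos _ hp2.2.2 (by rwa [e'.left_inv hp2.2.1])
    rw [chartShift]
    constructor <;> linarith

theorem IsDomainWithGenericCorners.subset (hΩ : IsDomainWithGenericCorners (n := n) D Ω)
    (j : Fin N) : Ω ⊆ D j := by
  rw [hΩ.eq_iInter]
  exact iInter_subset D j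

variable [IsManifold 𝓘(ℂ, Cn n) ω M]

/-- Small shifts along a vector pointing outward move the points of `closure Ω` near `q` into
`Ω`. -/
theorem IsDomainWithGenericCorners.eventually_chartShift_mem
    (hΩ : IsDomainWithGenericCorners (n := n) D Ω) {e : OpenPartialHomeomorph M (Cn n)}
    (he : e ∈ holCharts n M) {q : M} (hq : q ∈ e.source) {v : Cn n}
    (hv : ∀ j, q ∈ frontier (D j) → PointsOutward e v (D j) q) :
    ∀ᶠ p : M × ℝ in 𝓝 q ×ˢ 𝓝[>] 0, p.1 ∈ closure Ω → chartShift e v p.2 p.1 ∈ Ω := by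
  by_cases hqΩ : q ∈ closure Ω
  · obtain ⟨U, S, r, a, hd, hqU, hUt, hmem⟩ := hΩ.exists_isCornerFrame hqΩ he hq
    have h1 : ∀ᶠ p : M × ℝ in 𝓝 q ×ˢ 𝓝[>] 0, ∀ j ∈ S, p.1 ∈ closure Ω →
        r j (e (chartShift e v p.2 p.1)) < 0 ∧
          r j (e (chartShift e v p.2 p.1)) ≤ r j (e p.1) / 4 :=
      (Finset.eventually_all S).2 fun j hj => hd.eventually_shift he he hmem
        (fun j => (hΩ.smoothlyBounded j).isOpen) hΩ.subset hUt hq hq hqU hqΩ hv hj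
    have hU : ∀ᶠ z in 𝓝 q, z ∈ e.source ∧ e z ∈ U :=
      (e.isOpen_inter_preimage hd.isOpen).mem_nhds ⟨hq, hqU⟩
    filter_upwards [h1, (tendsto_chartShift v hq).eventually hU] with p hp1 hp2 hp3
    have h2 := (hd.mem_iff _ hp2.2).2 fun j hj => (hp1 j hj hp3).1
    have h3 := h2.2
    rwa [mem_preimage, e.left_inv hp2.1] at h3
  · have h1 : ∀ᶠ p : M × ℝ in 𝓝 q ×ˢ 𝓝[>] 0, p.1 ∈ (closure Ω)ᶜ :=
      tendsto_fst.eventually (isClosed_closure.isOpen_compl.mem_nhds hqΩ)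
    filter_upwards [h1] with p hp hp' using absurd hp' hp

theorem abs_cornerWeight_le_of_forall {S : Finset (Fin N)} {r : Fin N → Cn n → ℝ} {y y' : Cn n}
    (hy : ∀ j ∈ S, r j y ≤ 0) (h : ∀ j ∈ S, r j y' ≤ r j y / 4) :
    |cornerWeight S r y| ≤ 4 ^ S.card * |cornerWeight S r y'| := by
  rw [cornerWeight, cornerWeight, Finset.abs_prod, Finset.abs_prod, ← Finset.prod_const,
    ← Finset.prod_mul_distrib]
  refine Finset.prod_le_prod (fun _ _ => abs_nonneg _) fun j hj => ?_
  have h1 := hy j hj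
  have h2 := h j hj
  rw [abs_of_nonpos h1, abs_of_nonpos (by linarith)]
  linarith

/-- In a corner piece the weight is controlled by its value at an inward shift. -/
theorem CornerPiece.eventually_cornerWeight_le (P : CornerPiece n D Ω)
    (hΩ : IsDomainWithGenericCorners (n := n) D Ω) {e : OpenPartialHomeomorph M (Cn n)}
    (he : e ∈ holCharts n M) {q : M} (hq : q ∈ e.source) (hq' : q ∈ P.e.source)
    (hqU : P.e q ∈ P.U) (hqΩ : q ∈ closure Ω) {v : Cn n}
    (hv : ∀ j, q ∈ frontier (D j) → PointsOutward e v (D j) q) :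
    ∀ᶠ p : M × ℝ in 𝓝 q ×ˢ 𝓝[>] 0, p.1 ∈ Ω →
      |cornerWeight P.S P.r (P.e p.1)| ≤
        4 ^ P.S.card * |cornerWeight P.S P.r (P.e (chartShift e v p.2 p.1))| := by
  have h1 : ∀ᶠ p : M × ℝ in 𝓝 q ×ˢ 𝓝[>] 0, ∀ j ∈ P.S, p.1 ∈ closure Ω →
      P.r j (P.e (chartShift e v p.2 p.1)) < 0 ∧
        P.r j (P.e (chartShift e v p.2 p.1)) ≤ P.r j (P.e p.1) / 4 :=
    (Finset.eventually_all P.S).2 fun j hj => P.frame.eventually_shift he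
      (chartAt_mem_holCharts P.x) P.mem_iff (fun j => (hΩ.smoothlyBounded j).isOpen) hΩ.subset
      P.U_subset hq hq' hqU hqΩ hv hj
  have hU : ∀ᶠ p : M × ℝ in 𝓝 q ×ˢ 𝓝[>] 0, p.1 ∈ P.e.source ∩ P.e ⁻¹' P.U :=
    tendsto_fst.eventually ((P.e.isOpen_inter_preimage P.frame.isOpen).mem_nhds ⟨hq', hqU⟩)
  filter_upwards [h1, hU] with p hp1 hp2 hp3
  refine abs_cornerWeight_le_of_forall (fun j hj => ?_) fun j hj => (hp1 j hj (subset_closure hp3)).2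
  refine ((P.mem_iff j hj _ hp2.2).1 ?_).le
  rw [P.e.left_inv hp2.1]
  exact hΩ.subset j hp3

end Shift

/-! ### Canonical extensions as limits of shifts -/

section ShiftLimit

variable {n N : ℕ} {M : Type*} [TopologicalSpace M] [ChartedSpace (Cn n) M]
  {D : Fin N → Set M} {Ω : Set M}

/-- The hypotheses on the coordinates `e` and the vector `v`: on the compact set `K` in the domain
of `e`, the vector `v` points outward. -/
structure IsOutwardOn (D : Fin N → Set M) (e : OpenPartialHomeomorph M (Cn n)) (v : Cn n)
    (K : Set M) : Prop where
  mem_holCharts : e ∈ holCharts n M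
  isCompact : IsCompact K
  subset_source : K ⊆ e.source
  pointsOutward : ∀ j, ∀ p ∈ frontier (D j) ∩ K, PointsOutward e v (D j) p

variable {e : OpenPartialHomeomorph M (Cn n)} {v : Cn n} {K : Set M}

theorem mdifferentiableOn_chartShift (he : e ∈ holCharts n M) {u : M → ℂ} {O : Set M} {ε : ℝ}
    (hu : MDifferentiableOn 𝓘(ℂ, Cn n) 𝓘(ℂ, ℂ) u Ω) (hs : O ⊆ e.source)
    (ht : ∀ z ∈ O, e z - (ε : ℂ) • v ∈ e.target) (hΩ : ∀ z ∈ O, chartShift e v ε z ∈ Ω) :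
    MDifferentiableOn 𝓘(ℂ, Cn n) 𝓘(ℂ, ℂ) (fun z => u (chartShift e v ε z)) O := by
  have h1 : MDifferentiableOn 𝓘(ℂ, Cn n) 𝓘(ℂ, Cn n) e O :=
    ((contMDiffOn_of_mem_maximalAtlas he).mdifferentiableOn (by simp)).mono hs
  have h2 : MDifferentiable 𝓘(ℂ, Cn n) 𝓘(ℂ, Cn n) fun y : Cn n => y - (ε : ℂ) • v :=
    (differentiable_id.sub_const _).mdifferentiable
  have h3 : MDifferentiableOn 𝓘(ℂ, Cn n) 𝓘(ℂ, Cn n) e.symm e.target :=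
    (contMDiffOn_symm_of_mem_maximalAtlas he).mdifferentiableOn (by simp)
  exact hu.comp (h3.comp (h2.comp_mdifferentiableOn h1) ht) hΩ

/-- The shift moves the compact set `closure Ω ∩ supp φ` into `Ω`, where `u` is continuous; so the
shifted function is bounded although `u` need not be. -/
theorem isTameOn_indicator_chartShift (he : e ∈ holCharts n M) {u : M → ℂ}
    (hu : MDifferentiableOn 𝓘(ℂ, Cn n) 𝓘(ℂ, ℂ) u Ω) {O : Set M} (hO : IsOpen O) {ε : ℝ}
    (hε : ∀ z ∈ O, z ∈ e.source ∧ e z - (ε : ℂ) • v ∈ e.target ∧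
      (z ∈ closure Ω → chartShift e v ε z ∈ Ω)) {φ : TestForm n M} (hφ : φ.supp ⊆ O) :
    IsTameOn Ω (Ω.indicator fun z => u (chartShift e v ε z)) φ ∧
      MDifferentiableOn 𝓘(ℂ, Cn n) 𝓘(ℂ, ℂ) (Ω.indicator fun z => u (chartShift e v ε z))
        (Ω ∩ O) := by
  have h1 : MDifferentiableOn 𝓘(ℂ, Cn n) 𝓘(ℂ, ℂ) (Ω.indicator fun z => u (chartShift e v ε z))
      (Ω ∩ O) :=
    (mdifferentiableOn_chartShift he hu (fun z hz => (hε z hz.2).1) (fun z hz => (hε z hz.2).2.1)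
      fun z hz => (hε z hz.2).2.2 (subset_closure hz.1)).congr fun z hz =>
        indicator_of_mem hz.1 _
  have hK : IsCompact (closure Ω ∩ φ.supp) := φ.isCompact_supp.inter_left isClosed_closure
  have hcont : ContinuousOn (fun z => u (chartShift e v ε z)) (closure Ω ∩ φ.supp) := by
    refine hu.continuousOn.comp (e.continuousOn_symm.comp
      ((e.continuousOn.mono fun z hz => (hε z (hφ hz.2)).1).sub continuousOn_const)
      fun z hz => (hε z (hφ hz.2)).2.1) fun z hz => (hε z (hφ hz.2)).2.2 hz.1
  obtain ⟨C, hC⟩ := hK.exists_bound_of_continuousOn hcont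
  refine ⟨⟨fun z hz => indicator_of_notMem hz _, ⟨O, hO, hφ, h1.continuousOn⟩, C, fun z hz => ?_⟩,
    h1⟩
  rw [indicator_of_mem hz.1]
  exact hC z ⟨subset_closure hz.1, hz.2⟩

variable [IsManifold 𝓘(ℂ, Cn n) ω M]

/-- Compactness of `K` turns the statements at its points into one neighbourhood and one range of
`ε`. -/
theorem IsOutwardOn.exists_chartShift_mem (hK : IsOutwardOn D e v K)
    (hΩ : IsDomainWithGenericCorners (n := n) D Ω) :
    ∃ O, IsOpen O ∧ K ⊆ O ∧ ∀ᶠ ε : ℝ in 𝓝[>] 0, ∀ z ∈ O, z ∈ e.source ∧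
      e z - (ε : ℂ) • v ∈ e.target ∧ (z ∈ closure Ω → chartShift e v ε z ∈ Ω) := by
  have h1 : ∀ᶠ p : M × ℝ in 𝓝ˢ K ×ˢ 𝓝[>] 0, p.1 ∈ e.source ∧
      e p.1 - (p.2 : ℂ) • v ∈ e.target ∧ (p.1 ∈ closure Ω → chartShift e v p.2 p.1 ∈ Ω) := by
    rw [hK.isCompact.nhdsSet_prod_eq_biSup]
    simp only [eventually_iSup]
    intro q hq
    have hqs := hK.subset_source hq
    have h2 : ∀ᶠ p : M × ℝ in 𝓝 q ×ˢ 𝓝[>] 0, p.1 ∈ e.source :=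
      tendsto_fst.eventually (e.open_source.mem_nhds hqs)
    exact h2.and (((tendsto_chart_sub_smul v hqs).eventually
      (e.open_target.mem_nhds (e.map_source hqs))).and
      (hΩ.eventually_chartShift_mem hK.mem_holCharts hqs fun j hj =>
        hK.pointsOutward j q ⟨hj, hq⟩))
  obtain ⟨A, hA, B, hB, hAB⟩ := eventually_prod_iff.1 h1
  obtain ⟨O, hO, hKO, hOA⟩ := mem_nhdsSet_iff_exists.1 hA
  exact ⟨O, hO, hKO, hB.mono fun ε hε z hz => hAB (hOA hz) hε⟩

variable [T2Space M] [Bundle.RiemannianBundle (fun x : M => TangentSpace 𝓘(ℝ, Cn n) x)]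
  [IsContinuousRiemannianBundle (Cn n) (fun x : M => TangentSpace 𝓘(ℝ, Cn n) x)]

/-- The weight at `y` is at most `4^|S|` times the weight at the shifted point, hence at most a
constant times the distance of the shifted point to `∂Ω`, which compensates the growth of `u` there.
-/
theorem CornerPiece.exists_norm_shift_mul_le (P : CornerPiece n D Ω)
    (hΩ : IsDomainWithGenericCorners (n := n) D Ω) (hK : IsOutwardOn D e v K) {k : ℕ} {u : M → ℂ}
    (hu : u ∈ growthSubmodule n Ω k) :
    ∃ C, ∀ᶠ ε : ℝ in 𝓝[>] 0, ∀ y ∈ P.W ∩ tsupport P.α, P.e.symm y ∈ K →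
      ‖u (chartShift e v ε (P.e.symm y))‖ * |cornerWeight P.S P.r y| ^ k ≤ C := by
  obtain ⟨-, -, B, hB⟩ := hu
  -- A slightly larger compact set, so that shifted points remain where the weight is bounded by the
  -- distance.
  obtain ⟨L, hL, hαL, hLU⟩ := exists_compact_between P.hasCompactSupport P.frame.isOpen
    P.tsupport_subset
  obtain ⟨C, hC0, hC⟩ := P.frame.exists_cornerWeight_le (chartAt_mem_holCharts P.x) hΩ.isOpen
    P.U_subset hL hLU
  have hαt := P.tsupport_subset.trans P.U_subset
  set A : Set M := closure Ω ∩ K ∩ P.e.symm '' tsupport P.α with hA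
  have hAc : IsCompact A := (hK.isCompact.inter_left isClosed_closure).inter
    (P.hasCompactSupport.isCompact.image_of_continuousOn (P.e.continuousOn_symm.mono hαt))
  have h1 : ∀ᶠ p : M × ℝ in 𝓝ˢ A ×ˢ 𝓝[>] 0, p.1 ∈ Ω → chartShift e v p.2 p.1 ∈ Ω ∧
      (chartShift e v p.2 p.1 ∈ P.e.source ∧ P.e (chartShift e v p.2 p.1) ∈ L) ∧
      |cornerWeight P.S P.r (P.e p.1)| ≤
        4 ^ P.S.card * |cornerWeight P.S P.r (P.e (chartShift e v p.2 p.1))| := by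
    rw [hAc.nhdsSet_prod_eq_biSup]
    simp only [eventually_iSup]
    rintro q ⟨⟨hqΩ, hqK⟩, y, hy, rfl⟩
    have hqs := hK.subset_source hqK
    have hq' : P.e.symm y ∈ P.e.source := P.e.map_target (hαt hy)
    have hqy : P.e (P.e.symm y) = y := P.e.right_inv (hαt hy)
    have hv : ∀ j, P.e.symm y ∈ frontier (D j) → PointsOutward e v (D j) (P.e.symm y) :=
      fun j hj => hK.pointsOutward j _ ⟨hj, hqK⟩
    have h2 : ∀ᶠ z in 𝓝 (P.e.symm y), z ∈ P.e.source ∩ P.e ⁻¹' interior L :=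
      (P.e.isOpen_inter_preimage isOpen_interior).mem_nhds ⟨hq', by
        rw [mem_preimage, hqy]; exact hαL hy⟩
    filter_upwards [hΩ.eventually_chartShift_mem hK.mem_holCharts hqs hv,
      (tendsto_chartShift v hqs).eventually h2,
      P.eventually_cornerWeight_le hΩ hK.mem_holCharts hqs hq'
        (by rw [hqy]; exact P.tsupport_subset hy) hqΩ hv] with p hp1 hp2 hp3 hpΩ
    exact ⟨hp1 (subset_closure hpΩ), ⟨hp2.1, interior_subset hp2.2⟩, hp3 hpΩ⟩
  obtain ⟨A', hA', B', hB', hAB⟩ := eventually_prod_iff.1 h1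
  refine ⟨(4 ^ P.S.card * C) ^ k * B, hB'.mono fun ε hε y hy hyK => ?_⟩
  have hyA : P.e.symm y ∈ A := ⟨⟨subset_closure hy.1.2, hyK⟩, y, hy.2, rfl⟩
  obtain ⟨h3, ⟨h4, h5⟩, h6⟩ := hAB (hA'.self_of_nhdsSet _ hyA) hε hy.1.2
  set τ := chartShift e v ε (P.e.symm y) with hτ
  have h7 := hC _ h5
  rw [P.e.left_inv h4] at h7
  simp only [P.e.right_inv hy.1.1] at h6
  calc ‖u τ‖ * |cornerWeight P.S P.r y| ^ k
      ≤ ‖u τ‖ * (4 ^ P.S.card * (C * boundaryDist n Ω τ)) ^ k := by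
        gcongr
        exact h6.trans (by gcongr)
    _ = (4 ^ P.S.card * C) ^ k * (‖u τ‖ * boundaryDist n Ω τ ^ k) := by ring
    _ ≤ (4 ^ P.S.card * C) ^ k * B := by
        gcongr
        exact hB τ h3

/-- Dominated convergence: the weighted shifted functions are uniformly bounded, Bell's operator of
the coefficient is bounded, and pointwise convergence is continuity of `u` in `Ω`. -/
theorem CornerPiece.tendsto_bellPairing_shift (P : CornerPiece n D Ω)
    (hΩ : IsDomainWithGenericCorners (n := n) D Ω) {φ : TestForm n M}
    (hφ : IsOutwardOn D e v φ.supp) {k : ℕ} {u : M → ℂ} (hu : u ∈ growthSubmodule n Ω k) :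
    Tendsto (fun ε : ℝ => bellPairing P.W P.S P.r P.a k
      (fun y => Ω.indicator (fun z => u (chartShift e v ε z)) (P.e.symm y)) (P.coeff φ.form))
      (𝓝[>] 0) (𝓝 (bellPairing P.W P.S P.r P.a k (fun y => u (P.e.symm y)) (P.coeff φ.form))) := by
  obtain ⟨C, hC⟩ := P.exists_norm_shift_mul_le hΩ hφ hu
  obtain ⟨B, hB⟩ := P.exists_forall_norm_bellCoeff_le k φ
  obtain ⟨O, hO, hφO, hOε⟩ := hφ.exists_chartShift_mem hΩ
  have hts := P.tsupport_coeff_subset φ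
  have hm : MeasurableSet (P.W ∩ tsupport (P.coeff φ.form)) :=
    P.frame.isOpen_domain.measurableSet.inter (isClosed_tsupport _).measurableSet
  have hfin : volume (P.W ∩ tsupport (P.coeff φ.form)) < ⊤ :=
    (measure_mono inter_subset_right).trans_lt
      (P.hasCompactSupport_coeff φ).isCompact.measure_lt_top
  have : IsFiniteMeasure (volume.restrict (P.W ∩ tsupport (P.coeff φ.form))) :=
    isFiniteMeasure_restrict.2 hfin.ne
  have hz : ∀ z ∉ tsupport (P.coeff φ.form),
      ((cornerWeight P.S P.r z ^ k : ℝ) : ℂ) * (cornerOp P.a P.S.toList)^[k] (P.coeff φ.form) z = 0 :=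
    fun z hz => by
      have h : P.bellCoeff k φ z = 0 := image_eq_zero_of_notMem_tsupport fun h =>
        hz (P.tsupport_bellCoeff_subset k φ h)
      rw [bellCoeff] at h
      rw [h, mul_zero]
  simp only [bellPairing]
  refine Tendsto.const_mul _ ?_
  simp only [setIntegral_eq_inter_tsupport (ψ := P.coeff φ.form) P.frame.isOpen_domain hz]
  refine tendsto_integral_filter_of_dominated_convergence (fun _ => C * B) ?_ ?_
    (integrable_const _) ?_
  · filter_upwards [hOε] with ε hε
    have h1 := (isTameOn_indicator_chartShift hφ.mem_holCharts hu.2.1 hO hε hφO).2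
    have hsub : P.W ∩ tsupport (P.coeff φ.form) ⊆ chartImage P.e Ω ∩ chartImage P.e O := fun y hy =>
      ⟨hy.1, P.U_subset (P.tsupport_coeff_subset_U φ hy.2), hφO (hts hy.2).2⟩
    have h2 := (continuousOn_comp_symm (e := P.e) h1.continuousOn).mono hsub
    refine (h2.mul (Continuous.continuousOn ?_)).aestronglyMeasurable hm
    exact (Complex.continuous_ofReal.comp
      ((contDiff_cornerWeight P.S P.frame.contDiff_r).continuous.pow k)).mul
      (P.contDiff_bellCoeff k φ).continuous
  · filter_upwards [hC] with ε hε
    refine (ae_restrict_iff' hm).2 (Eventually.of_forall fun y hy => ?_)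
    refine norm_mul_le_of_bound ?_ (hB y)
    rw [indicator_of_mem (show P.e.symm y ∈ Ω from hy.1.2)]
    exact hε y ⟨hy.1, (hts hy.2).1⟩ (hts hy.2).2
  · refine (ae_restrict_iff' hm).2 (Eventually.of_forall fun y hy => ?_)
    refine Tendsto.mul_const _ ?_
    simp only [indicator_of_mem (show P.e.symm y ∈ Ω from hy.1.2)]
    have h1 : ContinuousAt u (P.e.symm y) :=
      hu.2.1.continuousOn.continuousAt (hΩ.isOpen.mem_nhds hy.1.2)
    have h2 := (tendsto_chartShift v (hφ.subset_source (hts hy.2).2)).comp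
      ((tendsto_const_nhds (x := P.e.symm y)).prodMk (tendsto_id (x := 𝓝[>] (0 : ℝ))))
    exact h1.tendsto.comp h2

variable [SigmaCompactSpace M] {m : ℕ} {P : Fin m → CornerPiece n D Ω}

/-- For small `ε` the shifted function is bounded on the support, so its integral is already a sum
of pairings of order `k`, which pass to the limit one by one. -/
theorem tendsto_formIntegral_chartShift (hP : ComputesIntegral P)
    (hΩ : IsDomainWithGenericCorners (n := n) D Ω) {φ : TestForm n M}
    (hφ : IsOutwardOn D e v φ.supp) (f : PolyGrowth n Ω) :
    Tendsto (fun ε : ℝ => formIntegral (Ω.indicator fun z => f.fn (chartShift e v ε z)) φ)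
      (𝓝[>] 0) (𝓝 (canonicalExtension P hΩ.isOpen f φ)) := by
  obtain ⟨k, hk⟩ := f.exists_mem_growthSubmodule
  obtain ⟨O, hO, hφO, hOε⟩ := hφ.exists_chartShift_mem hΩ
  rw [canonicalExtension_apply P hΩ.isOpen f hk]
  refine (tendsto_finsetSum _ fun i _ => (P i).tendsto_bellPairing_shift hΩ hφ hk).congr' ?_
  filter_upwards [hOε] with ε hε
  obtain ⟨h1, h2⟩ := isTameOn_indicator_chartShift hφ.mem_holCharts hk.2.1 hO hε hφO
  exact (hP.formIntegral_eq_sum_bellPairing h1 hO hφO h2 k).symm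

end ShiftLimit

/-! ### Uniqueness -/

section Uniqueness

variable {n N : ℕ} {M : Type*} [TopologicalSpace M] [ChartedSpace (Cn n) M]

/-- The product of a test form and a smooth function. -/
def TestForm.mulSmooth (φ : TestForm n M) {ρ : M → ℝ}
    (hρ : ContMDiff 𝓘(ℝ, Cn n) 𝓘(ℝ, ℝ) ∞ ρ) : TestForm n M :=
  (⟨fun x => (ρ x : ℂ) • φ.form x, fun e he => by
      have h1 : ContDiffOn ℝ ∞ (fun y => ((ρ ∘ e.symm) y : ℂ)) e.target := by
        have h2 := contDiffOn_comp_symm he (hρ.contMDiffOn (s := univ))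
        rw [show chartImage e univ = e.target by simp [chartImage]] at h2
        exact Complex.ofRealCLM.contDiff.comp_contDiffOn h2
      exact h1.mul (φ.contDiffOn_formCoeff he),
    φ.isCompact_supp.of_isClosed_subset (isClosed_tsupport _)
      (closure_mono fun x hx h => hx (ContinuousAlternatingMap.ext fun w => by
        change (ρ x : ℂ) * φ.form x w = 0
        rw [h]
        exact mul_zero _))⟩ : testFormSubmodule n M)

theorem TestForm.mulSmooth_form (φ : TestForm n M) {ρ : M → ℝ}
    (hρ : ContMDiff 𝓘(ℝ, Cn n) 𝓘(ℝ, ℝ) ∞ ρ) (x : M) :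
    (φ.mulSmooth hρ).form x = (ρ x : ℂ) • φ.form x := rfl

theorem TestForm.supp_mulSmooth_subset (φ : TestForm n M) {ρ : M → ℝ}
    (hρ : ContMDiff 𝓘(ℝ, Cn n) 𝓘(ℝ, ℝ) ∞ ρ) : (φ.mulSmooth hρ).supp ⊆ tsupport ρ := by
  refine closure_mono fun x hx h => hx ?_
  refine ContinuousAlternatingMap.ext fun w => ?_
  change (ρ x : ℂ) * φ.form x w = 0
  rw [h, Complex.ofReal_zero, zero_mul]

theorem TestForm.ext_form {φ ψ : TestForm n M} (h : ∀ x, φ.form x = ψ.form x) : φ = ψ :=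
  Subtype.ext (funext h)

theorem TestForm.form_sum {ι : Type*} (s : Finset ι) (φ : ι → TestForm n M) (x : M) :
    (∑ i ∈ s, φ i).form x = ∑ i ∈ s, (φ i).form x := by
  have h : (∑ i ∈ s, φ i).form = ∑ i ∈ s, (φ i).form :=
    map_sum (testFormSubmodule n M).subtype φ s
  rw [h, Finset.sum_apply]

variable [IsManifold 𝓘(ℂ, Cn n) ω M] [T2Space M] [SigmaCompactSpace M]

/-- Test forms decompose into test forms subordinate to an open cover. -/
theorem TestForm.exists_sum_eq (φ : TestForm n M) {O : M → Set M} (hO : ∀ p, IsOpen (O p))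
    (hpO : ∀ p, p ∈ O p) :
    ∃ (T : Finset M) (ψ : M → TestForm n M), (∀ p, (ψ p).supp ⊆ O p) ∧ φ = ∑ p ∈ T, ψ p := by
  obtain ⟨ρ, hρ⟩ := SmoothPartitionOfUnity.exists_isSubordinate 𝓘(ℝ, Cn n) (isClosed_univ (X := M))
    O hO fun p _ => mem_iUnion.2 ⟨p, hpO p⟩
  have hfin : {p : M | (Function.support (ρ p) ∩ φ.supp).Nonempty}.Finite :=
    ρ.locallyFinite.finite_nonempty_inter_compact φ.isCompact_supp
  refine ⟨hfin.toFinset, fun p => φ.mulSmooth (ρ p).contMDiff, fun p =>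
    (φ.supp_mulSmooth_subset _).trans (hρ p), TestForm.ext_form fun x => ?_⟩
  rw [TestForm.form_sum]
  simp only [TestForm.mulSmooth_form]
  rw [← Finset.sum_smul, ← Complex.ofReal_sum]
  by_cases hx : φ.form x = 0
  · rw [hx, smul_zero]
  · have h1 : ∑ p ∈ hfin.toFinset, ρ p x = 1 := by
      rw [← ρ.sum_eq_one (mem_univ x)]
      refine (finsum_eq_sum_of_support_subset _ fun p hp => ?_).symm
      simp only [Finite.coe_toFinset, mem_ofPred_eq]
      exact ⟨x, hp, subset_tsupport _ hx⟩
    rw [h1, Complex.ofReal_one, one_smul]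

/-- Distributions that agree on the test forms to which the limit formula applies are equal. -/
theorem IsDomainWithGenericCorners.distribution_ext {D : Fin N → Set M} {Ω : Set M}
    (hΩ : IsDomainWithGenericCorners (n := n) D Ω) {T T' : DistributionSpace n M}
    (h : ∀ e ∈ holCharts n M, ∀ (v : Cn n) (φ : TestForm n M), φ.supp ⊆ e.source →
      (∀ j, ∀ p ∈ frontier (D j) ∩ φ.supp, PointsOutward e v (D j) p) → T φ = T' φ) : T = T' := by
  ext φ
  choose O v hO hpO hOs hv using hΩ.exists_pointsOutward
  obtain ⟨s, ψ, hψ, hφ⟩ := φ.exists_sum_eq hO hpO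
  rw [hφ, map_sum, map_sum]
  exact Finset.sum_congr rfl fun p _ => h _ (chartAt_mem_holCharts p) (v p) (ψ p)
    ((hψ p).trans (hOs p)) fun j q hq => hv p j q ⟨hq.1, hψ p hq.2⟩

end Uniqueness

end

/-! ### Existence and uniqueness of the canonical extension -/

theorem theorem2p4 {n : ℕ} {M : Type*} [TopologicalSpace M] [T2Space M] [SigmaCompactSpace M]
    [ChartedSpace (Cn n) M] [IsManifold 𝓘(ℂ, Cn n) ω M]
    [Bundle.RiemannianBundle (fun x : M => TangentSpace 𝓘(ℝ, Cn n) x)]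
    [IsContMDiffRiemannianBundle 𝓘(ℝ, Cn n) ∞ (Cn n) (fun x : M => TangentSpace 𝓘(ℝ, Cn n) x)]
    {N : ℕ} (D : Fin N → Set M) (Ω : Set M) (hΩ : IsDomainWithGenericCorners (n := n) D Ω) :
    ∃! ce : PolyGrowth n Ω →L[ℂ] DistributionSpace n M,
      -- `ce f` restricts to `f` on `Ω`
      (∀ (f : PolyGrowth n Ω) (φ : TestForm n M), φ.supp ⊆ Ω →
        ce f φ = formIntegral f.fn φ) ∧
      -- in coordinates, `⟨ce f, φ⟩` is the limit of `∫_Ω f(z - εv) φ`, `v` pointing outward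
      (∀ e ∈ holCharts n M, ∀ (v : Cn n) (φ : TestForm n M), φ.supp ⊆ e.source →
        (∀ j, ∀ p ∈ frontier (D j) ∩ φ.supp, PointsOutward e v (D j) p) →
        ∀ f : PolyGrowth n Ω,
          Tendsto (fun ε : ℝ =>
              formIntegral (Ω.indicator fun z => f.fn (e.symm (e z - (ε : ℂ) • v))) φ)
            (𝓝[>] 0) (𝓝 (ce f φ))) ∧
      -- if `f` extends continuously to `closure Ω`, then `ce f` is the extension by zero
      (∀ (f : PolyGrowth n Ω) (g : M → ℂ), ContinuousOn g (closure Ω) → EqOn g f.fn Ω →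
        ∀ φ : TestForm n M, ce f φ = formIntegral ((closure Ω).indicator g) φ) := by
  have := isContinuousRiemannianBundle_of_contMDiff (n := n) (M := M)
  obtain ⟨m, P, hP⟩ := hΩ.exists_cornerPieces
  refine ⟨canonicalExtension P hΩ.isOpen, ⟨fun f φ hφ => ?_, fun e he v φ hφ hv f => ?_,
    fun f g hg hgf φ => ?_⟩, fun ce hce => ?_⟩
  · exact canonicalExtension_of_supp_subset hP hΩ.isOpen f hφ
  · exact tendsto_formIntegral_chartShift hP hΩ ⟨he, φ.isCompact_supp, hφ, hv⟩ f
  · exact canonicalExtension_of_continuousOn hP hΩ f hg hgf φ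
  -- The limit formula alone determines the extension.
  · refine ContinuousLinearMap.ext fun f => hΩ.distribution_ext fun e he v φ hφ hv => ?_
    exact tendsto_nhds_unique (hce.2.1 e he v φ hφ hv f)
      (tendsto_formIntegral_chartShift hP hΩ ⟨he, φ.isCompact_supp, hφ, hv⟩ f)
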